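/- Let $k\ge 1$ and $r=\lfloor (k+1)/2\rfloor$. **Patterns.** Let $s_k(\lambda)$, $\lambda\in\mathbb Z^{r}$, be the number of integer arrays $(x^i_j)_{1\le i\le k,\,1\le j\le \lfloor (i+1)/2\rfloor}$ with $k$-th row $x^k=\lambda$, with all entries non-negative except possibly the last entry $x^{2l-1}_l$ of each odd row, and with $|x^{i}_{j+1}|\le |x^{i-1}_j|\le |x^i_j|$ whenever these entries exist. Let $\mathcal W^+=\{\lambda\in\mathbb Z^r:\lambda_1\ge\dots\ge\lambda_r\ge 0\}$. **Exponential waiting times.** Particles $(i,j)$, $1\le i\le k$, $1\le j\le\lfloor (i+1)/2\rfloor$, have positions $Y^i_j(t)\in\mathbb N$, $t\ge 0$, with $Y(0)=0$. Each particle has two clocks, one for jumps to the right and one for jumps to the left; all clocks are independent, with independent exponential waiting times of mean $1$ (Poisson processes of rate $1$). When the right clock of $(i,j)$ rings: if $i,j\ge2$ and $Y^i_j=Y^{i-1}_{j-1}$ nothing happens; otherwise $(i,j),(i+1,j),\dots,(i+l,j)$ jump to the right by one, $l$ being the largest integer with $Y^{i+l}_j=Y^i_j$. When the left clock of $(i,j)$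 rings: if $i=2j-1$ and $Y^i_j=0$, then everything happens as if the right clock had rung; if $i=2j-1$ and $Y^i_j\ge 1$, then $Y^i_j$ decreases by one; if $i\ne 2j-1$ and $Y^i_j=Y^{i-1}_j$, nothing happens; if $i\ne 2j-1$ and $Y^i_j>Y^{i-1}_j$, then $(i,j),(i+1,j+1),\dots,(i+l,j+l)$ jump to the left by one, $l$ being the largest integer with $Y^{i+l}_{j+l}=Y^i_j$. **Geometric jumps.** For $q\in(0,1)$ let $\xi^i_j(n+\frac12),\xi^i_j(n+1)$, $n\ge 0$, be independent with $\mathbb P(\xi=m)=(1-q)q^m$, $m\in\mathbb N$. Let $X(0)=0$ and define $X(n+\frac12)$ and $X(n+1)$ row by row, $l=1,\dots,k$, by $$X^l_i(n+\tfrac12)=\max\bigl(X^{l-1}_i(n),\ \min(X^l_i(n),X^{l-1}_{i-1}(n+\tfrac12))-\xi^l_i(n+\tfrac12)\bigr)\quad (2i\le l),$$ $$X^l_i(n+\tfrac12)=\min(X^l_i(n),X^{l-1}_{i-1}(n+\tfrac12))\quad (2i=l+1),$$ $$X^l_i(n+1)=\min\bigl(X^{l-1}_{i-1}(n+\tfrac12),\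 \max(X^{l-1}_i(n+1),X^l_i(n+\tfrac12))+\xi^l_i(n+1)\bigr)\quad (2i\le l),$$ $$X^l_i(n+1)=\min\bigl(X^{l-1}_{i-1}(n+\tfrac12),\ |X^l_i(n+\tfrac12)+\xi^l_i(n+1)-\xi^l_i(n+\tfrac12)|\bigr)\quad (2i=l+1),$$ where $X^{l-1}_0=+\infty$. **Statement.** The $k$-th row $(Y^k(t))_{t\ge0}$ is by itself (in its own filtration) a time-homogeneous continuous-time Markov process on $\mathcal W^+$. Its infinitesimal generator $A_k$ is given, for $\lambda\in\mathcal W^+$ and $\beta\in\{\lambda\pm e_1,\dots,\lambda\pm e_r\}$, where $e_1,\dots,e_r$ is the canonical basis of $\mathbb R^r$, by $$A_k(\lambda,\beta)=\begin{cases}2\,\dfrac{s_k(\beta)}{s_k(\lambda)}\,1_{\beta\in\mathcal W^+}&\text{if $k$ is odd, $\lambda_r=0$ and $\beta_r=1$,}\\[2mm] \dfrac{s_k(\beta)}{s_k(\lambda)}\,1_{\beta\in\mathcal W^+}&\text{otherwise,}\end{cases}$$ by $A_k(\lambda,\lambda)=-\sum_{\beta=\lambda\pm e_i}A_k(\lambda,\beta)$,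 and by $A_k(\lambda,\beta)=0$ for all other $\beta\in\mathcal W^+$. Moreover $Y^k$ is the $q\to0$ limit of the $k$-th row $X^k$ of the model with geometric jumps: if $q_n\in(0,1)$, $q_n\to0$, and $X_{(n)}$ is that model with parameter $q_n$, then the finite-dimensional distributions of $(X_{(n)}^k(\lfloor t/q_n\rfloor))_{t\ge0}$ converge to those of $(Y^k(t))_{t\ge0}$. -/

import Mathlib

open MeasureTheory ProbabilityTheory Filter Topology
open scoped NNReal

noncomputable section

/-! ### Particles, Gelfand-Tsetlin patterns, rows -/

/-- Labels `(i, j)` with `1 ≤ i ≤ k` and `1 ≤ j ≤ [(i + 1) / 2]`: the entries of a pattern with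
`k` rows, `i` being the row and `j` the place in the row. -/
abbrev Particle (k : ℕ) : Type :=
  {p : ℕ × ℕ // 1 ≤ p.1 ∧ p.1 ≤ k ∧ 1 ≤ p.2 ∧ 2 * p.2 ≤ p.1 + 1}

namespace Particle

/-- The row `i` of the particle `(i, j)`. -/
def row {k : ℕ} (p : Particle k) : ℕ := p.1.1

/-- The place `j` of the particle `(i, j)` in its row. -/
def idx {k : ℕ} (p : Particle k) : ℕ := p.1.2

/-- The particles `(2 l - 1, l)`, next to the wall: the last particle of each odd row. -/
def IsWall {k : ℕ} (p : Particle k) : Prop := 2 * p.idx = p.row + 1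

end Particle

/-- The entry `x^i_j`, with the value `0` when there is no particle `(i, j)`. -/
def entry {k : ℕ} {α : Type*} [Zero α] (x : Particle k → α) (i j : ℕ) : α :=
  if h : 1 ≤ i ∧ i ≤ k ∧ 1 ≤ j ∧ 2 * j ≤ i + 1 then x ⟨(i, j), h⟩ else 0

/-- The `k`-th row `(x^k_1, …, x^k_r)`, `r = [(k + 1) / 2]`, of a pattern with `k` rows. -/
def lastRow {k : ℕ} {α : Type*} (x : Particle k → α) : Fin ((k + 1) / 2) → α :=
  fun j => x ⟨(k, (j : ℕ) + 1), by have := j.isLt; dsimp only; omega⟩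

/-- Gelfand-Tsetlin patterns for the orthogonal group with `k` rows: all entries are natural
numbers except the last entry of each odd row, which is an integer of any sign, and
`|x^(i-1)| ⪯ |x^i|`, that is `|x^i_(j+1)| ≤ |x^(i-1)_j| ≤ |x^i_j|`. -/
structure IsGTPattern {k : ℕ} (x : Particle k → ℤ) : Prop where
  nonneg : ∀ p, ¬ p.IsWall → 0 ≤ x p
  lower : ∀ p p' : Particle k, p'.row = p.row + 1 → p'.idx = p.idx → |x p| ≤ |x p'|
  upper : ∀ p p' : Particle k, p'.row = p.row + 1 → p'.idx = p.idx + 1 → |x p'| ≤ |x p|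

/-- `s_k(l)`: the number of Gelfand-Tsetlin patterns whose `k`-th row is `l`. -/
def gtCount (k : ℕ) (l : Fin ((k + 1) / 2) → ℤ) : ℕ :=
  Nat.card {x : Particle k → ℤ // IsGTPattern x ∧ lastRow x = l}

/-- The integer vectors `l_1 ≥ l_2 ≥ … ≥ l_r ≥ 0`: the possible `k`-th rows of patterns with
non-negative entries, where `r = [(k + 1) / 2]`. -/
def rowSpace (k : ℕ) : Set (Fin ((k + 1) / 2) → ℤ) :=
  {l | Antitone l ∧ ∀ i, 0 ≤ l i}

/-! ### The model with exponential waiting times -/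

/-- The positions of the particles. -/
abbrev Config (k : ℕ) : Type := Particle k → ℕ

/-- The `k`-th row of a configuration, as an integer vector. -/
def configRow {k : ℕ} (x : Config k) : Fin ((k + 1) / 2) → ℤ := fun j => ((lastRow x j : ℕ) : ℤ)

inductive Direction : Type
  | left
  | right

open Classical in
/-- Particle `p = (i, j)` tries to jump to the right by one. It is blocked if `i, j ≥ 2` and
`x^i_j = x^(i-1)_(j-1)`; otherwise it jumps together with those particles `(i + m, j)` that are
at the same place (on a pattern `x^i_j ≤ x^(i+1)_j ≤ …`, so that these are consecutive). -/
def moveRight {k : ℕ} (x : Config k) (p : Particle k) : Config k :=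
  if 2 ≤ p.row ∧ 2 ≤ p.idx ∧ x p = entry x (p.row - 1) (p.idx - 1) then x
  else fun p' => if p.row ≤ p'.row ∧ p'.idx = p.idx ∧ x p' = x p then x p' + 1 else x p'

open Classical in
/-- Particle `p = (i, j)` tries to jump to the left by one. A particle next to the wall jumps
freely, but is reflected into an attempt to jump to the right when it is at `0`. Any other
particle is blocked if `x^i_j = x^(i-1)_j`; otherwise it jumps together with those particles
`(i + m, j + m)` that are at the same place (on a pattern `x^i_j ≥ x^(i+1)_(j+1) ≥ …`). -/
def moveLeft {k : ℕ} (x : Config k) (p : Particle k) : Config k :=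
  if p.IsWall then
    if x p = 0 then moveRight x p else Function.update x p (x p - 1)
  else if x p = entry x (p.row - 1) p.idx then x
  else fun p' =>
    if p.row ≤ p'.row ∧ p'.idx + p.row = p.idx + p'.row ∧ x p' = x p then x p' - 1 else x p'

/-- The effect of an attempted jump of the given particle in the given direction. -/
def move {k : ℕ} (x : Config k) : Particle k × Direction → Config k
  | (p, Direction.left) => moveLeft x p
  | (p, Direction.right) => moveRight x p

variable {Ω : Type*} [MeasurableSpace Ω]

/-- `N` counts the rings of a clock whose waiting times are independent and exponential with
mean one: a Poisson process with rate one. -/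
structure IsPoissonClock (N : ℝ≥0 → Ω → ℕ) (μ : Measure Ω) : Prop where
  measurable : ∀ t, Measurable (N t)
  indep : HasIndepIncrements N μ
  law : ∀ s t, s ≤ t → HasLaw (fun ω => N t ω - N s ω) (poissonMeasure (t - s)) μ
  path : ∀ᵐ ω ∂μ, N 0 ω = 0 ∧ Monotone (fun t => N t ω) ∧
    ∀ t, ContinuousWithinAt (fun s => N s ω) (Set.Ici t) t

/-- The process with exponential waiting times, started with all particles at `0`. Every particle
carries two clocks, one for each direction, all clocks being independent. The configuration does
not change during a time interval `(s, t]` in which no clock rings, and it changes from `x` to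
`move x c` during a time interval in which clock `c` rings once and no other clock rings.
(Almost surely no two rings are simultaneous, so that this determines the process.) -/
structure IsExponentialModel (k : ℕ) (μ : Measure Ω) (Y : ℝ≥0 → Ω → Config k) : Prop where
  measurable : ∀ t, Measurable (Y t)
  driven : ∃ N : Particle k × Direction → ℝ≥0 → Ω → ℕ,
    (∀ c, IsPoissonClock (N c) μ) ∧
    iIndepFun (fun c ω => (fun t => N c t ω : ℝ≥0 → ℕ)) μ ∧
    ∀ᵐ ω ∂μ, Y 0 ω = 0 ∧ ∀ s t, s ≤ t →
      ((∀ c, N c t ω = N c s ω) → Y t ω = Y s ω) ∧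
      ∀ c, N c t ω = N c s ω + 1 → (∀ c', c' ≠ c → N c' t ω = N c' s ω) →
        Y t ω = move (Y s ω) c

/-! ### The discrete model with geometric jumps -/

/-- From time `n` to time `n + 1/2`. Here `x i j = X^i_j(n)`, `ξ i j = ξ^i_j(n + 1/2)` and the
result is `X^i_j(n + 1/2)`. Rows are updated downward; in row `l + 1`, particle `j` is first pushed
by the new position of `(l, j - 1)`, and then, unless it is next to the wall, tries to jump to
the left and is blocked by the old position of `(l, j)`. -/
def leftHalfStep (x ξ : ℕ → ℕ → ℕ) : ℕ → ℕ → ℕ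
  | 0, _ => 0
  | l + 1, j =>
    let pushed := if j = 1 then x (l + 1) j else min (x (l + 1) j) (leftHalfStep x ξ l (j - 1))
    if 2 * j = l + 2 then pushed else max (x l j) (pushed - ξ (l + 1) j)

/-- From time `n + 1/2` to time `n + 1`. Here `y i j = X^i_j(n + 1/2)`, `ξ i j = ξ^i_j(n + 1/2)`,
`ξ' i j = ξ^i_j(n + 1)` and the result is `X^i_j(n + 1)`. In row `l + 1`, a particle next to the
wall makes the two-sided jump `ξ' - ξ` reflected at `0`; any other particle `j` is first pushed by
the new position of `(l, j)` and then jumps to the right. Jumps are blocked by the old position of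
`(l, j - 1)`, if there is such a particle. -/
def rightHalfStep (y ξ ξ' : ℕ → ℕ → ℕ) : ℕ → ℕ → ℕ
  | 0, _ => 0
  | l + 1, j =>
    let target :=
      if 2 * j = l + 2 then ((y (l + 1) j : ℤ) + ξ' (l + 1) j - ξ (l + 1) j).natAbs
      else max (rightHalfStep y ξ ξ' l j) (y (l + 1) j) + ξ' (l + 1) j
    if j = 1 then target else min (y l (j - 1)) target

/-- From time `n` to time `n + 1`. -/
def discreteStep {k : ℕ} (x ξ ξ' : Config k) : Config k := fun p =>
  rightHalfStep (leftHalfStep (entry x) (entry ξ)) (entry ξ) (entry ξ') p.row p.idx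

/-- The process with geometric jumps of parameter `q`, observed at integer times and started with
all particles at `0`. The variable `ξ p (2 n)` is `ξ^i_j(n + 1/2)` and `ξ p (2 n + 1)` is
`ξ^i_j(n + 1)`. -/
def IsGeometricModel (k : ℕ) (q : ℝ) (μ : Measure Ω) (X : ℕ → Ω → Config k) : Prop :=
  ∃ ξ : Particle k → ℕ → Ω → ℕ,
    (∀ p n, Measurable (ξ p n)) ∧
    iIndepFun (fun a : Particle k × ℕ => ξ a.1 a.2) μ ∧
    (∀ p n m, μ.real {ω | ξ p n ω = m} = q ^ m * (1 - q)) ∧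
    ∀ᵐ ω ∂μ, X 0 ω = 0 ∧
      ∀ n, X (n + 1) ω = discreteStep (X n ω) (fun p => ξ p (2 * n) ω) (fun p => ξ p (2 * n + 1) ω)

/-! ### Continuous-time Markov processes on a countable set -/

/-- Stochastic transition functions on a countable set. -/
structure IsTransitionFunction {S : Type*} (P : ℝ≥0 → S → S → ℝ) : Prop where
  nonneg : ∀ t x y, 0 ≤ P t x y
  sum_one : ∀ t x, HasSum (P t x) 1
  zero_self : ∀ x, P 0 x x = 1
  zero_ne : ∀ x y, x ≠ y → P 0 x y = 0
  chapman_kolmogorov : ∀ s t x y, HasSum (fun z => P s x z * P t z y) (P (s + t) x y)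

/-- The transition function `P` has the infinitesimal generator (the matrix of rates) `A`. -/
def HasGenerator {S : Type*} (P : ℝ≥0 → S → S → ℝ) (A : S → S → ℝ) : Prop :=
  ∀ x y, HasDerivWithinAt (fun t : ℝ => P t.toNNReal x y) (A x y) (Set.Ici 0) 0

/-- `Z` is a Markov process, in its own filtration, on the countable state space `S ⊆ E`, with
time-homogeneous transition probabilities and infinitesimal generator `A`. -/
structure IsMarkovProcessWithGenerator {E : Type*} (μ : Measure Ω) (Z : ℝ≥0 → Ω → E) (S : Set E)
    (A : S → S → ℝ) : Prop where
  mem : ∀ᵐ ω ∂μ, ∀ t, Z t ω ∈ S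
  markov : ∃ P : ℝ≥0 → S → S → ℝ, IsTransitionFunction P ∧ HasGenerator P A ∧
    ∀ (n : ℕ) (s : Fin (n + 1) → ℝ≥0) (t : ℝ≥0), Monotone s → s (Fin.last n) ≤ t →
      ∀ (x : Fin (n + 1) → S) (y : S),
        μ.real {ω | (∀ i, Z (s i) ω = x i) ∧ Z t ω = y} =
          μ.real {ω | ∀ i, Z (s i) ω = x i} * P (t - s (Fin.last n)) (x (Fin.last n)) y

/-! ### The generator of the `k`-th row -/

open Classical in
/-- The rate of the jump from `l` to `b`, for `b = l ± e_i`. -/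
def rowRate (k : ℕ) (l b : Fin ((k + 1) / 2) → ℤ) : ℝ :=
  if b ∈ rowSpace k then
    (if Odd k ∧ ∃ i : Fin ((k + 1) / 2), (i : ℕ) + 1 = (k + 1) / 2 ∧ l i = 0 ∧ b i = 1 then 2
      else 1) * ((gtCount k b : ℝ) / (gtCount k l : ℝ))
  else 0

open Classical in
/-- The vectors `l + e_1, …, l + e_r, l - e_1, …, l - e_r`. -/
def neighbours {r : ℕ} (l : Fin r → ℤ) : Finset (Fin r → ℤ) :=
  Finset.univ.image (fun i => l + Pi.single i 1) ∪ Finset.univ.image (fun i => l - Pi.single i 1)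

open Classical in
/-- The generator: nearest-neighbour jumps with the rates `rowRate`; the diagonal entry is minus the
total jump rate. -/
def rowGenerator (k : ℕ) (l b : rowSpace k) : ℝ :=
  if (b : Fin ((k + 1) / 2) → ℤ) ∈ neighbours (l : Fin ((k + 1) / 2) → ℤ) then rowRate k l b
  else if b = l then - ∑ c ∈ neighbours (l : Fin ((k + 1) / 2) → ℤ), rowRate k l c
  else 0

end

/-!
The proof compares both models with one random sequence of moves and computes the law of the row of
that sequence exactly.

*Intertwining.* Let `patternWeight x` be the number of Gelfand-Tsetlin patterns with given last row
whose absolute values are the interlacing configuration `x`. Suppose that, given its last row, a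
random interlacing configuration has a law proportional to `patternWeight`, and that one clock,
chosen uniformly, rings. Then the new configuration has the same property, and the law of its last
row has changed through the generator (`sum_preds_move_rowGenerator`). This is a count over the
configurations from which `z` can be reached. A jump to the right that leads to `z` is determined
by the lowest particle `P` that it moves (`lowerCol`), and so is a jump to the left (`raiseDiag`).
If `P` lies in the last row, these moves give the jump rates of the row. If `P` lies above the last
row, the row does not change, and what is missing to a constant number of such moves is made up by
the rings that have no effect because of a blocking (`count_inner_moves`). The factors `2` come
from the two signs of a non-zero wall entry and from the reflection at `0`. Summed over `z`, the
same identity shows that the numbers `gtCount` are an eigenvector, so that the rows of the generator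
sum to zero (`sum_neighbours_gtCount`).

*A sequence of moves.* Let every clock ring independently a random number of times in each step,
and perform a move whenever exactly one clock rings, once (`chain`, `IsNoise`). By the intertwining,
conditionally on its rows at the earlier times the configuration keeps a law proportional to
`patternWeight` on every row, and the row evolves by the operators `1 + a A` on summable functions
(`Spread.succ`); so its finite-dimensional distributions are products of entries of powers of
`1 + a A` (`IsNoise.spread_rowEvent`). Since the rates are bounded, `A` is a bounded operator, and
these powers converge to the semigroup `exp (t A)`, whose entries are the transition function
(`tendsto_one_add_smul_pow`, `rowTransition_isTransitionFunction`, `rowTransition_hasGenerator`).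

*Comparison.* A process that performs the right move in every step in which at most one ring occurs
agrees with the sequence up to a fixed time with a probability that tends to `1`, because the
probability of two rings in a step is quadratic in the length of the step
(`tendsto_real_rowEvent`). The model with geometric jumps is such a process when `q` is small: with
a single jump of size one, its two half-steps reduce to one move (`discreteStep_eq_stepMap`). The
model with exponential waiting times is such a process on every grid. As it does not depend on the
grid, its finite-dimensional distributions are equal to the limit (`real_rows_eq_rowPathProb`),
which gives the Markov property and the generator; those of the model with geometric jumps converge
to the same limit.
-/

/-! ### Interlacing configurations -/

namespace Particle

variable {k : ℕ}

lemma row_le (p : Particle k) : p.row ≤ k := p.2.2.1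

lemma bounds (p : Particle k) :
    1 ≤ p.row ∧ p.row ≤ k ∧ 1 ≤ p.idx ∧ 2 * p.idx ≤ p.row + 1 := p.2

lemma ext' {p q : Particle k} (h₁ : p.row = q.row) (h₂ : p.idx = q.idx) : p = q :=
  Subtype.ext (Prod.ext h₁ h₂)

/-- There is a particle at every admissible place. -/
lemma exists_of_bounds {i j : ℕ} (h : 1 ≤ i ∧ i ≤ k ∧ 1 ≤ j ∧ 2 * j ≤ i + 1) :
    ∃ p : Particle k, p.row = i ∧ p.idx = j := ⟨⟨(i, j), h⟩, rfl, rfl⟩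

instance : Finite (Particle k) :=
  Finite.of_injective (β := Fin (k + 1) × Fin (k + 1))
    (fun p => (⟨p.row, by have := p.bounds; omega⟩, ⟨p.idx, by have := p.bounds; omega⟩))
    (fun p q h => by
      simp only [Prod.mk.injEq, Fin.mk.injEq] at h
      exact ext' h.1 h.2)

noncomputable instance : Fintype (Particle k) := Fintype.ofFinite _

end Particle

lemma entry_eq {k : ℕ} {α : Type*} [Zero α] (x : Particle k → α) (p : Particle k) :
    entry x p.row p.idx = x p := by
  unfold entry
  exact dif_pos p.2

lemma entry_eq_of {k : ℕ} {α : Type*} [Zero α] (x : Particle k → α) {i j : ℕ} (p : Particle k)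
    (hi : p.row = i) (hj : p.idx = j) : entry x i j = x p := by
  subst hi hj
  exact entry_eq x p

/-- The inequalities `x^{i+1}_{j+1} ≤ x^i_j ≤ x^{i+1}_j` between consecutive rows of a
configuration. -/
structure IsInterlacing {k : ℕ} (x : Config k) : Prop where
  col : ∀ p p' : Particle k, p'.row = p.row + 1 → p'.idx = p.idx → x p ≤ x p'
  diag : ∀ p p' : Particle k, p'.row = p.row + 1 → p'.idx = p.idx + 1 → x p' ≤ x p

namespace IsInterlacing

variable {k : ℕ} {x : Config k}

lemma col_le (hx : IsInterlacing x) {p p' : Particle k} (hj : p.idx = p'.idx)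
    (hi : p.row ≤ p'.row) : x p ≤ x p' := by
  obtain ⟨n, hn⟩ := Nat.exists_eq_add_of_le hi
  induction n generalizing p' with
  | zero => rw [Particle.ext' (p := p) (q := p') (by omega) hj]
  | succ n ih =>
    have h1 := p.bounds
    have h2 := p'.bounds
    obtain ⟨q, hq1, hq2⟩ := Particle.exists_of_bounds (k := k) (i := p'.row - 1) (j := p'.idx)
      (by omega)
    exact (ih (p' := q) (by omega) (by omega) (by omega)).trans
      (hx.col q p' (by omega) (by omega))

lemma diag_le (hx : IsInterlacing x) {p p' : Particle k}
    (hj : p'.row + p.idx = p.row + p'.idx) (hi : p.row ≤ p'.row) : x p' ≤ x p := by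
  obtain ⟨n, hn⟩ := Nat.exists_eq_add_of_le hi
  induction n generalizing p' with
  | zero => rw [Particle.ext' (p := p) (q := p') (by omega) (by omega)]
  | succ n ih =>
    have h1 := p.bounds
    have h2 := p'.bounds
    obtain ⟨q, hq1, hq2⟩ := Particle.exists_of_bounds (k := k) (i := p'.row - 1) (j := p'.idx - 1)
      (by omega)
    exact (hx.diag q p' (by omega) (by omega)).trans
      (ih (p' := q) (by omega) (by omega) (by omega))

lemma zero : IsInterlacing (0 : Config k) := ⟨fun _ _ _ _ => le_rfl, fun _ _ _ _ => le_rfl⟩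

end IsInterlacing

/-- A jump to the right of `p` is blocked by the particle `(i - 1, j - 1)`. -/
def BlockedRight {k : ℕ} (x : Config k) (p : Particle k) : Prop :=
  2 ≤ p.row ∧ 2 ≤ p.idx ∧ x p = entry x (p.row - 1) (p.idx - 1)

/-- A particle next to the wall sits at `0`, so that its left clock acts as its right clock. -/
def Reflects {k : ℕ} (x : Config k) (p : Particle k) : Prop := p.IsWall ∧ x p = 0

/-! ### Moves and their reversal -/

section Moves

variable {k : ℕ} {x z : Config k} {p : Particle k}

lemma blockedRight_iff (x : Config k) (p : Particle k) :
    BlockedRight x p ↔ ∃ q : Particle k, q.row + 1 = p.row ∧ q.idx + 1 = p.idx ∧ x p = x q := by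
  have hp := p.bounds
  constructor
  · rintro ⟨h1, h2, h3⟩
    obtain ⟨q, hq1, hq2⟩ := Particle.exists_of_bounds (k := k) (i := p.row - 1) (j := p.idx - 1)
      (by omega)
    exact ⟨q, by omega, by omega, by rw [h3, entry_eq_of x q hq1 hq2]⟩
  · rintro ⟨q, hq1, hq2, h⟩
    have hq := q.bounds
    exact ⟨by omega, by omega, by rw [h, entry_eq_of x q (by omega) (by omega)]⟩

lemma moveRight_of_blocked (h : BlockedRight x p) : moveRight x p = x := if_pos h

lemma moveRight_apply (h : ¬ BlockedRight x p) (q : Particle k) :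
    moveRight x p q = open Classical in
      if p.row ≤ q.row ∧ q.idx = p.idx ∧ x q = x p then x q + 1 else x q := by
  unfold moveRight
  rw [if_neg (by exact h)]

lemma moveRight_eq_self_iff : moveRight x p = x ↔ BlockedRight x p := by
  refine ⟨fun h => ?_, moveRight_of_blocked⟩
  by_contra hb
  have := congrFun h p
  rw [moveRight_apply hb, if_pos ⟨le_rfl, rfl, rfl⟩] at this
  omega

lemma moveLeft_of_reflects (h : Reflects x p) : moveLeft x p = moveRight x p := by
  unfold moveLeft
  rw [if_pos h.1, if_pos h.2]

lemma moveLeft_of_wall (hp : p.IsWall) (h : x p ≠ 0) :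
    moveLeft x p = Function.update x p (x p - 1) := by
  unfold moveLeft
  rw [if_pos hp, if_neg h]

/-- The jump to the left of a particle away from the wall is blocked by the particle above. -/
lemma moveLeft_of_blocked (hp : ¬ p.IsWall) {q : Particle k} (hq : q.row + 1 = p.row)
    (hq' : q.idx = p.idx) (h : x p = x q) : moveLeft x p = x := by
  unfold moveLeft
  rw [if_neg hp, if_pos (by rw [h, entry_eq_of x q (by omega) (by omega)])]

lemma moveLeft_apply (hp : ¬ p.IsWall) {q : Particle k} (hq : q.row + 1 = p.row)
    (hq' : q.idx = p.idx) (h : x p ≠ x q) (p' : Particle k) :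
    moveLeft x p p' = open Classical in
      if p.row ≤ p'.row ∧ p'.idx + p.row = p.idx + p'.row ∧ x p' = x p then x p' - 1
      else x p' := by
  unfold moveLeft
  rw [if_neg hp, if_neg (by rw [entry_eq_of x q (by omega) (by omega)]; exact h)]

lemma exists_above (hp : ¬ p.IsWall) : ∃ q : Particle k, q.row + 1 = p.row ∧ q.idx = p.idx := by
  have h := p.bounds
  unfold Particle.IsWall at hp
  obtain ⟨q, hq1, hq2⟩ := Particle.exists_of_bounds (k := k) (i := p.row - 1) (j := p.idx)
    (by omega)
  exact ⟨q, by omega, hq2⟩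

/-- The particle `p` is the uppermost particle of its column at the site of `P`, hence the only
one whose jump to the right can have moved `P`. -/
def IsColStart (z : Config k) (p P : Particle k) : Prop :=
  p.idx = P.idx ∧ p.row ≤ P.row ∧ z p = z P ∧
    ∀ q : Particle k, q.idx = p.idx → q.row < p.row → z q < z p

/-- `z` can be reached by a jump to the right whose last moved particle is `P`. -/
def CanLower (z : Config k) (P : Particle k) : Prop :=
  1 ≤ z P ∧ ∀ q : Particle k, q.idx = P.idx + 1 → q.row ≤ P.row + 1 → z q < z P

open Classical in
/-- The configuration before a jump to the right that leads to `z` and whose last moved particle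
is `P`. -/
noncomputable def lowerCol (z : Config k) (P : Particle k) : Config k := fun q =>
  if q.idx = P.idx ∧ q.row ≤ P.row ∧ z q = z P then z q - 1 else z q

/-- The particle `p` is the uppermost particle of its diagonal at the site of `P`, hence the only
one whose jump to the left can have moved `P`. -/
def IsDiagStart (z : Config k) (p P : Particle k) : Prop :=
  p.row + P.idx = P.row + p.idx ∧ p.row ≤ P.row ∧ z p = z P ∧
    ∀ q : Particle k, q.row + p.idx = p.row + q.idx → q.row < p.row → z p < z q

/-- `z` can be reached by a jump to the left whose last moved particle is `P`. -/
def CanRaise (z : Config k) (P : Particle k) : Prop :=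
  ∀ q : Particle k, q.row + P.idx = P.row + q.idx + 1 → q.row ≤ P.row + 1 → z P < z q

open Classical in
/-- The configuration before a jump to the left that leads to `z` and whose last moved particle
is `P`. -/
noncomputable def raiseDiag (z : Config k) (P : Particle k) : Config k := fun q =>
  if q.row + P.idx = P.row + q.idx ∧ q.row ≤ P.row ∧ z q = z P then z q + 1 else z q

lemma lowerCol_isInterlacing (hz : IsInterlacing z) {P : Particle k} (h : CanLower z P) :
    IsInterlacing (lowerCol z P) := by
  constructor
  · intro q q' h1 h2
    have h3 := hz.col q q' h1 h2
    unfold lowerCol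
    split_ifs <;> omega
  · intro q q' h1 h2
    have h3 := hz.diag q q' h1 h2
    have h4 := h.2 q'
    unfold lowerCol
    split_ifs <;> omega

lemma raiseDiag_isInterlacing (hz : IsInterlacing z) {P : Particle k} (h : CanRaise z P) :
    IsInterlacing (raiseDiag z P) := by
  constructor
  · intro q q' h1 h2
    have h3 := hz.col q q' h1 h2
    have h4 := h q'
    unfold raiseDiag
    split_ifs <;> omega
  · intro q q' h1 h2
    have h3 := hz.diag q q' h1 h2
    unfold raiseDiag
    split_ifs <;> omega

lemma moveRight_lowerCol (hz : IsInterlacing z) {P : Particle k} (h : CanLower z P)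
    (hs : IsColStart z p P) : moveRight (lowerCol z P) p = z := by
  have hp : lowerCol z P p = z P - 1 := by
    unfold lowerCol; rw [if_pos ⟨hs.1, hs.2.1, hs.2.2.1⟩, hs.2.2.1]
  have hP := h.1
  have hb : ¬ BlockedRight (lowerCol z P) p := by
    rw [blockedRight_iff]
    rintro ⟨q, hq1, hq2, hq3⟩
    have h1 := hz.diag q p hq1.symm hq2.symm
    have h2 : lowerCol z P q = z q := by
      unfold lowerCol; rw [if_neg]; rintro ⟨h, -⟩; have := hs.1; omega
    have := hs.2.2.1
    omega
  funext q
  rw [moveRight_apply hb, hp]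
  have h3 := hs.2.2.2 q
  have h4 := hs.1
  have h6 := hs.2.2.1
  by_cases hq : q.idx = p.idx ∧ p.row ≤ q.row
  · have h5 := hz.col_le (p := p) (p' := q) hq.1.symm hq.2
    unfold lowerCol
    split_ifs <;> omega
  · unfold lowerCol
    split_ifs <;> omega

lemma lowerCol_ne {P : Particle k} (h : CanLower z P) : lowerCol z P ≠ z := by
  intro he
  have h1 := congrFun he P
  have h2 := h.1
  unfold lowerCol at h1
  rw [if_pos ⟨rfl, le_rfl, rfl⟩] at h1
  omega

lemma exists_of_moveRight (hx : IsInterlacing x) (hne : moveRight x p ≠ x) :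
    ∃ P : Particle k, IsColStart (moveRight x p) p P ∧ CanLower (moveRight x p) P ∧
      x = lowerCol (moveRight x p) P := by
  classical
  have hb : ¬ BlockedRight x p := fun h => hne (moveRight_of_blocked h)
  have hm := moveRight_apply hb
  obtain ⟨P, hP, hmax⟩ := Finset.exists_max_image
    (Finset.univ.filter fun q : Particle k => p.row ≤ q.row ∧ q.idx = p.idx ∧ x q = x p)
    Particle.row ⟨p, by simp⟩
  simp only [Finset.mem_filter, Finset.mem_univ, true_and] at hP hmax
  have hzP : moveRight x p P = x p + 1 := by rw [hm, if_pos hP, hP.2.2]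
  have hzp : moveRight x p p = x p + 1 := by rw [hm, if_pos ⟨le_rfl, rfl, rfl⟩]
  refine ⟨P, ⟨hP.2.1.symm, hP.1, by rw [hzP, hzp], ?_⟩, ⟨by omega, ?_⟩, ?_⟩
  · intro q hq hlt
    have := hx.col_le hq hlt.le
    rw [hzp, hm, if_neg (by omega)]
    omega
  · intro q hq hle
    have hqb := q.bounds
    have hPb := P.bounds
    obtain ⟨q', hq1, hq2⟩ := Particle.exists_of_bounds (k := k) (i := q.row - 1) (j := P.idx)
      (by omega)
    have h1 := hx.diag q' q (by omega) (by omega)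
    have h2 := hx.col_le (p := q') (p' := P) (by omega) (by omega)
    rw [hzP, hm, if_neg (by omega)]
    omega
  · funext q
    unfold lowerCol
    rw [hzP, hm]
    have h1 := hmax q
    by_cases hq : q.idx = P.idx ∧ q.row ≤ P.row
    · have h2 := hx.col_le hq.1 hq.2
      by_cases hc : p.row ≤ q.row ∧ q.idx = p.idx ∧ x q = x p
      · rw [if_pos hc, if_pos (by omega)]; omega
      · rw [if_neg hc, if_neg (by omega)]
    · rw [if_neg (c := p.row ≤ q.row ∧ q.idx = p.idx ∧ x q = x p)
        (by intro h; have := h1 h; omega), if_neg (by omega)]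

lemma moveLeft_raiseDiag (hz : IsInterlacing z) {P : Particle k}
    (hs : IsDiagStart z p P) :
    ¬ Reflects (raiseDiag z P) p ∧ moveLeft (raiseDiag z P) p = z := by
  have hp : raiseDiag z P p = z P + 1 := by
    unfold raiseDiag; rw [if_pos ⟨hs.1, hs.2.1, hs.2.2.1⟩, hs.2.2.1]
  have h6 := hs.2.2.1
  refine ⟨fun h => by have := h.2; omega, ?_⟩
  by_cases hw : p.IsWall
  · rw [moveLeft_of_wall hw (by omega), hp]
    funext q
    by_cases hq : q = p
    · subst hq; simp [h6]
    · rw [Function.update_of_ne hq]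
      unfold raiseDiag
      rw [if_neg]
      rintro ⟨h1, h2, h3⟩
      -- nothing lies below a wall particle on its diagonal, so `P = p`
      have hPp : P = p := by
        have := P.bounds
        have := hs.1
        have := hs.2.1
        unfold Particle.IsWall at hw
        exact Particle.ext' (by omega) (by omega)
      subst hPp
      have h4 := hs.2.2.2 q h1
      rcases h2.lt_or_eq with h5 | h5
      · have := h4 h5; omega
      · exact hq (Particle.ext' h5 (by omega))
  · obtain ⟨b, hb1, hb2⟩ := exists_above hw
    have h1 := hz.col b p hb1.symm hb2.symm
    have h7 := hs.1
    have h2 : raiseDiag z P b = z b := by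
      unfold raiseDiag; rw [if_neg]; omega
    funext q
    rw [moveLeft_apply hw hb1 hb2 (by omega), hp]
    have h3 := hs.2.2.2 q
    by_cases hq : q.row + p.idx = p.row + q.idx ∧ p.row ≤ q.row
    · have h5 := hz.diag_le (p := p) (p' := q) hq.1 hq.2
      unfold raiseDiag
      split_ifs <;> omega
    · unfold raiseDiag
      split_ifs <;> omega

lemma raiseDiag_ne (P : Particle k) : raiseDiag z P ≠ z := by
  intro he
  have h1 := congrFun he P
  unfold raiseDiag at h1
  rw [if_pos ⟨rfl, le_rfl, rfl⟩] at h1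
  omega

lemma exists_of_moveLeft (hx : IsInterlacing x) (hr : ¬ Reflects x p) (hne : moveLeft x p ≠ x) :
    ∃ P : Particle k, IsDiagStart (moveLeft x p) p P ∧ CanRaise (moveLeft x p) P ∧
      x = raiseDiag (moveLeft x p) P := by
  classical
  obtain ⟨P, hP, hmax⟩ := Finset.exists_max_image
    (Finset.univ.filter fun q : Particle k =>
      p.row ≤ q.row ∧ q.idx + p.row = p.idx + q.row ∧ x q = x p)
    Particle.row ⟨p, by simp⟩
  simp only [Finset.mem_filter, Finset.mem_univ, true_and] at hP hmax
  -- the cluster that moves consists of the particles at the same site on the diagonal of `p`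
  have key : 1 ≤ x p ∧ ∀ q, moveLeft x p q =
      if p.row ≤ q.row ∧ q.idx + p.row = p.idx + q.row ∧ x q = x p then x q - 1 else x q := by
    by_cases hw : p.IsWall
    · have h0 : x p ≠ 0 := fun h => hr ⟨hw, h⟩
      refine ⟨by omega, fun q => ?_⟩
      rw [moveLeft_of_wall hw h0]
      by_cases hq : q = p
      · subst hq; simp
      · rw [Function.update_of_ne hq, if_neg]
        rintro ⟨h1, h2, -⟩
        have := q.bounds
        unfold Particle.IsWall at hw
        exact hq (Particle.ext' (by omega) (by omega))
    · obtain ⟨b, hb1, hb2⟩ := exists_above hw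
      have h1 : x p ≠ x b := fun h => hne (moveLeft_of_blocked hw hb1 hb2 h)
      have h2 := hx.col b p hb1.symm hb2.symm
      exact ⟨by omega, moveLeft_apply hw hb1 hb2 h1⟩
  obtain ⟨hpos, hm⟩ := key
  have hzP : moveLeft x p P = x p - 1 := by rw [hm, if_pos hP, hP.2.2]
  have hzp : moveLeft x p p = x p - 1 := by rw [hm, if_pos ⟨le_rfl, rfl, rfl⟩]
  refine ⟨P, ⟨by omega, hP.1, by rw [hzP, hzp], ?_⟩, ?_, ?_⟩
  · intro q hq hlt
    have := hx.diag_le (p := q) (p' := p) (by omega) hlt.le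
    rw [hzp, hm, if_neg (by omega)]
    omega
  · intro q hq hle
    have hqb := q.bounds
    have hPb := P.bounds
    obtain ⟨q', hq1, hq2⟩ := Particle.exists_of_bounds (k := k) (i := q.row - 1) (j := q.idx)
      (by omega)
    have h1 := hx.col q' q (by omega) (by omega)
    have h2 := hx.diag_le (p := q') (p' := P) (by omega) (by omega)
    rw [hzP, hm, if_neg (by omega)]
    omega
  · funext q
    unfold raiseDiag
    rw [hzP, hm]
    have h1 := hmax q
    by_cases hq : q.row + P.idx = P.row + q.idx ∧ q.row ≤ P.row
    · have h2 := hx.diag_le (p := q) (p' := P) (by omega) hq.2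
      by_cases hc : p.row ≤ q.row ∧ q.idx + p.row = p.idx + q.row ∧ x q = x p
      · rw [if_pos hc, if_pos (by omega)]; omega
      · rw [if_neg hc, if_neg (by omega)]
    · rw [if_neg (c := p.row ≤ q.row ∧ q.idx + p.row = p.idx + q.row ∧ x q = x p)
        (by intro h; have := h1 h; omega), if_neg (by omega)]

lemma existsUnique_isColStart (hz : IsInterlacing z) (P : Particle k) :
    ∃! p, IsColStart z p P := by
  classical
  obtain ⟨p, hp, hmin⟩ := Finset.exists_min_image
    (Finset.univ.filter fun q : Particle k => q.idx = P.idx ∧ q.row ≤ P.row ∧ z q = z P)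
    Particle.row ⟨P, by simp⟩
  simp only [Finset.mem_filter, Finset.mem_univ, true_and] at hp hmin
  refine ⟨p, ⟨hp.1, hp.2.1, hp.2.2, fun q h1 h2 => ?_⟩, fun p' hp' => ?_⟩
  · have h3 := hz.col_le h1 h2.le
    have h4 := hmin q
    omega
  · have h1 := hmin p' ⟨hp'.1, hp'.2.1, hp'.2.2.1⟩
    have h2 := hp'.2.2.2 p (by rw [hp.1, hp'.1])
    have h3 := hp'.2.2.1
    have h4 := hp'.1
    exact Particle.ext' (by omega) (by omega)

lemma existsUnique_isDiagStart (hz : IsInterlacing z) (P : Particle k) :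
    ∃! p, IsDiagStart z p P := by
  classical
  obtain ⟨p, hp, hmin⟩ := Finset.exists_min_image
    (Finset.univ.filter fun q : Particle k =>
      q.row + P.idx = P.row + q.idx ∧ q.row ≤ P.row ∧ z q = z P)
    Particle.row ⟨P, by simp⟩
  simp only [Finset.mem_filter, Finset.mem_univ, true_and] at hp hmin
  refine ⟨p, ⟨hp.1, hp.2.1, hp.2.2, fun q h1 h2 => ?_⟩, fun p' hp' => ?_⟩
  · have h3 := hz.diag_le (p := q) (p' := p) (by omega) h2.le
    have h4 := hmin q
    omega
  · have h1 := hmin p' ⟨hp'.1, hp'.2.1, hp'.2.2.1⟩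
    have h5 := hp'.1
    have h2 := hp'.2.2.2 p (by omega)
    have h3 := hp'.2.2.1
    exact Particle.ext' (by omega) (by omega)

lemma IsInterlacing.moveRight (hx : IsInterlacing x) (p : Particle k) :
    IsInterlacing (moveRight x p) := by
  by_cases hb : BlockedRight x p
  · rwa [moveRight_of_blocked hb]
  have hm := moveRight_apply hb
  constructor
  · intro q q' h1 h2
    have h3 := hx.col q q' h1 h2
    rw [hm, hm]
    by_cases hq : p.idx = q.idx ∧ q.row < p.row
    · split_ifs <;> omega
    · split_ifs <;> omega
  · intro q q' h1 h2
    have h3 := hx.diag q q' h1 h2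
    rw [hm, hm]
    by_cases hc : p.row ≤ q'.row ∧ q'.idx = p.idx ∧ x q' = x p
    · rw [if_pos hc, if_neg (by omega)]
      by_cases he : q' = p
      · subst he
        have : x q' ≠ x q := fun h => hb ((blockedRight_iff _ _).2 ⟨q, by omega, by omega, h⟩)
        omega
      · have hlt : p.row < q'.row := by
          rcases hc.1.lt_or_eq with h | h
          · exact h
          · exact absurd (Particle.ext' h.symm hc.2.1) he
        have hpb := p.bounds
        have hqb := q.bounds
        obtain ⟨b, hb1, hb2⟩ : ∃ b : Particle k, b.row + 1 = p.row ∧ b.idx = q.idx := by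
          obtain ⟨b, hb1, hb2⟩ := Particle.exists_of_bounds (k := k) (i := p.row - 1)
            (j := q.idx) (by omega)
          exact ⟨b, by omega, hb2⟩
        have h4 := hx.col_le (p := b) (p' := q) hb2 (by omega)
        have h5 := hx.diag b p hb1.symm (by omega)
        have : x p ≠ x b := fun h => hb ((blockedRight_iff _ _).2 ⟨b, by omega, by omega, h⟩)
        omega
    · rw [if_neg hc]
      split_ifs <;> omega

lemma IsInterlacing.moveLeft (hx : IsInterlacing x) (p : Particle k) :
    IsInterlacing (moveLeft x p) := by
  by_cases hr : Reflects x p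
  · rw [moveLeft_of_reflects hr]; exact hx.moveRight p
  by_cases hne : _root_.moveLeft x p = x
  · rwa [hne]
  by_cases hw : p.IsWall
  · have h0 : x p ≠ 0 := fun h => hr ⟨hw, h⟩
    rw [moveLeft_of_wall hw h0]
    unfold Particle.IsWall at hw
    constructor
    · intro q q' h1 h2
      have h3 := hx.col q q' h1 h2
      have hb := q.bounds
      by_cases hq : q = p
      · subst hq
        rw [Function.update_self, Function.update_of_ne (by rintro rfl; omega)]; omega
      · rw [Function.update_of_ne hq, Function.update_of_ne (by rintro rfl; omega)]; exact h3
    · intro q q' h1 h2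
      have h3 := hx.diag q q' h1 h2
      have hb := q'.bounds
      have : q ≠ p := by rintro rfl; omega
      rw [Function.update_of_ne this]
      by_cases hq : q' = p
      · subst hq; rw [Function.update_self]; omega
      · rwa [Function.update_of_ne hq]
  · obtain ⟨b, hb1, hb2⟩ := exists_above hw
    have h1 : x p ≠ x b := fun h => hne (moveLeft_of_blocked hw hb1 hb2 h)
    have h2 := hx.col b p hb1.symm hb2.symm
    have hm := moveLeft_apply hw hb1 hb2 h1
    constructor
    · intro q q' h3 h4
      have h5 := hx.col q q' h3 h4
      rw [hm, hm]
      by_cases hc : p.row ≤ q'.row ∧ q'.idx + p.row = p.idx + q'.row ∧ x q' = x p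
      · rw [if_pos hc, if_neg (by omega)]
        have h6 := hx.diag_le (p := b) (p' := q) (by omega) (by omega)
        omega
      · rw [if_neg hc]
        split_ifs <;> omega
    · intro q q' h3 h4
      have h5 := hx.diag q q' h3 h4
      rw [hm, hm]
      split_ifs <;> omega

lemma IsInterlacing.move (hx : IsInterlacing x) (c : Particle k × Direction) :
    IsInterlacing (move x c) := by
  obtain ⟨p, d⟩ := c
  cases d
  · exact hx.moveLeft p
  · exact hx.moveRight p

end Moves

/-! ### The intertwining relation -/

section Weight

variable {k : ℕ}

open Classical in
/-- The number of Gelfand-Tsetlin patterns with given last row whose absolute values are the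
interlacing configuration `x`: each non-zero wall entry above the last row has two signs. -/
noncomputable def patternWeight (x : Config k) : ℕ :=
  ∏ p : Particle k, if p.IsWall ∧ p.row < k ∧ x p ≠ 0 then 2 else 1

lemma patternWeight_pos (x : Config k) : 0 < patternWeight x :=
  Finset.prod_pos fun p _ => by split_ifs <;> norm_num

lemma patternWeight_congr {x y : Config k}
    (h : ∀ p : Particle k, p.IsWall → p.row < k → (x p = 0 ↔ y p = 0)) :
    patternWeight x = patternWeight y := by
  unfold patternWeight
  refine Finset.prod_congr rfl fun p _ => ?_
  by_cases h1 : p.IsWall ∧ p.row < k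
  · simp [h1, h p h1.1 h1.2]
  · rw [if_neg (by tauto), if_neg (by tauto)]

lemma patternWeight_eq_two_mul {x y : Config k} {p : Particle k} (hp : p.IsWall) (hk : p.row < k)
    (hx : x p = 0) (hy : y p ≠ 0)
    (h : ∀ q : Particle k, q.IsWall → q.row < k → q ≠ p → (x q = 0 ↔ y q = 0)) :
    patternWeight y = 2 * patternWeight x := by
  classical
  unfold patternWeight
  rw [← Finset.mul_prod_erase _ _ (Finset.mem_univ p),
    ← Finset.mul_prod_erase (a := p) (f := fun q => if q.IsWall ∧ q.row < k ∧ x q ≠ 0 then 2 else 1)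
      _ (Finset.mem_univ p), if_pos ⟨hp, hk, hy⟩, if_neg (by simp [hx]), one_mul]
  congr 1
  refine Finset.prod_congr rfl fun q hq => ?_
  have hq := Finset.ne_of_mem_erase hq
  by_cases h1 : q.IsWall ∧ q.row < k
  · simp [h1, h q h1.1 h1.2 hq]
  · rw [if_neg (by tauto), if_neg (by tauto)]

open Classical in
/-- The weight before a jump to the right, counted twice if the left clock of the particle
next to the wall causes this jump as well. -/
lemma patternWeight_lowerCol {z : Config k} {p P : Particle k}
    (h : CanLower z P) (hs : IsColStart z p P) :
    (1 + if Reflects (lowerCol z P) p then 1 else 0) * patternWeight (lowerCol z P) =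
      (if P.IsWall ∧ P.row = k ∧ z P = 1 then 2 else 1) * patternWeight z := by
  have hpb := p.bounds
  have hPb := P.bounds
  have hP := h.1
  have hs1 := hs.1
  have hs2 := hs.2.1
  have hs3 := hs.2.2.1
  have hp : lowerCol z P p = z P - 1 := by
    unfold lowerCol; rw [if_pos ⟨hs1, hs2, hs3⟩, hs3]
  -- `p` is the only wall particle that can move
  have hmove : ∀ q : Particle k, q.IsWall → q ≠ p → lowerCol z P q = z q := by
    intro q hw hq
    have hqb := q.bounds
    unfold lowerCol
    rw [if_neg]
    rintro ⟨h1, h2, h3⟩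
    unfold Particle.IsWall at hw
    have h4 := hs.2.2.2 q (by omega)
    by_cases h5 : q.row < p.row
    · have := h4 h5; omega
    · exact hq (Particle.ext' (by omega) (by omega))
  by_cases hr : p.IsWall ∧ z P = 1
  · have hw := hr.1
    unfold Particle.IsWall at hw
    rw [if_pos ⟨hr.1, by omega⟩]
    by_cases hk : p.row < k
    · rw [patternWeight_eq_two_mul (x := lowerCol z P) (y := z) hr.1 hk (by omega) (by omega)
        fun q h1 _ h2 => by rw [hmove q h1 h2], if_neg, one_mul]
      unfold Particle.IsWall
      omega
    · have hPp : P = p := Particle.ext' (by omega) (by omega)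
      subst hPp
      rw [if_pos ⟨hr.1, by omega, hr.2⟩]
      congr 1
      refine patternWeight_congr fun q h1 h2 => ?_
      rw [hmove q h1 (by rintro rfl; omega)]
  · have hR : ¬ Reflects (lowerCol z P) p := fun hR => hr ⟨hR.1, by have := hR.2; omega⟩
    rw [if_neg hR, if_neg]
    · congr 1
      refine patternWeight_congr fun q h1 h2 => ?_
      by_cases hq : q = p
      · subst hq
        have : z P ≠ 1 := fun h => hr ⟨h1, h⟩
        omega
      · rw [hmove q h1 hq]
    · rintro ⟨h1, h2, h3⟩
      refine hr ⟨?_, h3⟩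
      unfold Particle.IsWall at h1 ⊢
      omega

open Classical in
lemma patternWeight_raiseDiag (z : Config k) (P : Particle k) :
    patternWeight (raiseDiag z P) =
      (if P.IsWall ∧ P.row < k ∧ z P = 0 then 2 else 1) * patternWeight z := by
  -- only the last particle of a diagonal can be next to the wall
  have hmove : ∀ q : Particle k, q.IsWall → q ≠ P → raiseDiag z P q = z q := by
    intro q hw hq
    have hqb := q.bounds
    have hPb := P.bounds
    unfold raiseDiag
    rw [if_neg]
    rintro ⟨h1, h2, h3⟩
    unfold Particle.IsWall at hw
    exact hq (Particle.ext' (by omega) (by omega))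
  have hP : raiseDiag z P P = z P + 1 := by
    unfold raiseDiag; rw [if_pos ⟨rfl, le_rfl, rfl⟩]
  split_ifs with h
  · exact patternWeight_eq_two_mul h.1 h.2.1 h.2.2 (by omega)
      fun q h1 _ h2 => by rw [hmove q h1 h2]
  · rw [one_mul]
    refine patternWeight_congr fun q h1 h2 => ?_
    by_cases hq : q = P
    · subst hq
      have : z q ≠ 0 := fun h0 => h ⟨h1, h2, h0⟩
      omega
    · rw [hmove q h1 hq]

end Weight

section Preds

variable {k : ℕ}

lemma le_move_add_one (x : Config k) (c : Particle k × Direction) (q : Particle k) :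
    x q ≤ move x c q + 1 := by
  have hR : ∀ p, x q ≤ moveRight x p q + 1 := by
    intro p
    by_cases hb : BlockedRight x p
    · rw [moveRight_of_blocked hb]; omega
    · rw [moveRight_apply hb]; split_ifs <;> omega
  obtain ⟨p, d⟩ := c
  cases d
  · change x q ≤ moveLeft x p q + 1
    by_cases hr : Reflects x p
    · rw [moveLeft_of_reflects hr]; exact hR p
    by_cases hw : p.IsWall
    · rw [moveLeft_of_wall hw (fun h => hr ⟨hw, h⟩)]
      by_cases hq : q = p
      · subst hq; rw [Function.update_self]; omega
      · rw [Function.update_of_ne hq]; omega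
    · obtain ⟨b, hb1, hb2⟩ := exists_above hw
      by_cases h1 : x p = x b
      · rw [moveLeft_of_blocked hw hb1 hb2 h1]; omega
      · rw [moveLeft_apply hw hb1 hb2 h1]; split_ifs <;> omega
  · exact hR p

open Classical in
/-- A finite set that contains all interlacing configurations from which `z` can be reached by one
move. -/
noncomputable def preds (z : Config k) : Finset (Config k) :=
  (Fintype.piFinset fun p => Finset.range (z p + 2)).filter IsInterlacing

lemma mem_preds {x z : Config k} : x ∈ preds z ↔ IsInterlacing x ∧ ∀ p, x p ≤ z p + 1 := by
  unfold preds
  simp only [Finset.mem_filter, Fintype.mem_piFinset, Finset.mem_range]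
  exact ⟨fun h => ⟨h.2, fun p => by have := h.1 p; omega⟩,
    fun h => ⟨fun p => by have := h.2 p; omega, h.1⟩⟩

lemma mem_preds_of_move {x z : Config k} {c : Particle k × Direction} (hx : IsInterlacing x)
    (h : move x c = z) : x ∈ preds z :=
  mem_preds.2 ⟨hx, fun p => by have := le_move_add_one x c p; rw [h] at this; omega⟩

lemma self_mem_preds {z : Config k} (hz : IsInterlacing z) : z ∈ preds z :=
  mem_preds.2 ⟨hz, fun p => by omega⟩

lemma lowerCol_injOn (z : Config k) : Set.InjOn (lowerCol z) {P | CanLower z P} := by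
  intro P hP Q hQ h
  have key : ∀ P Q : Particle k, CanLower z P → lowerCol z P = lowerCol z Q →
      P.idx = Q.idx ∧ P.row ≤ Q.row := by
    intro P Q hP h
    have h1 := congrFun h P
    have := hP.1
    unfold lowerCol at h1
    rw [if_pos ⟨rfl, le_rfl, rfl⟩] at h1
    split_ifs at h1 with h2
    · exact ⟨h2.1, h2.2.1⟩
    · omega
  have h1 := key P Q hP h
  have h2 := key Q P hQ h.symm
  exact Particle.ext' (by omega) (by omega)

lemma raiseDiag_injective (z : Config k) : Function.Injective (raiseDiag z) := by
  intro P Q h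
  have key : ∀ P Q : Particle k, raiseDiag z P = raiseDiag z Q →
      P.row + Q.idx = Q.row + P.idx ∧ P.row ≤ Q.row := by
    intro P Q h
    have h1 := congrFun h P
    unfold raiseDiag at h1
    rw [if_pos ⟨rfl, le_rfl, rfl⟩] at h1
    split_ifs at h1 with h2
    · exact ⟨h2.1, h2.2.1⟩
    · omega
  have h1 := key P Q h
  have h2 := key Q P h.symm
  exact Particle.ext' (by omega) (by omega)

open Classical in
lemma sum_ne_moveRight {z : Config k} (hz : IsInterlacing z) (p : Particle k)
    (F : Config k → ℝ) :
    ∑ x ∈ preds z with moveRight x p = z ∧ x ≠ z, F x =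
      ∑ P with IsColStart z p P ∧ CanLower z P, F (lowerCol z P) := by
  symm
  refine Finset.sum_nbij (lowerCol z) ?_ ?_ ?_ fun _ _ => rfl
  · intro P hP
    simp only [Finset.mem_filter, Finset.mem_univ, true_and] at hP ⊢
    have h1 := moveRight_lowerCol hz hP.2 hP.1
    exact ⟨mem_preds_of_move (c := (p, Direction.right)) (lowerCol_isInterlacing hz hP.2) h1, h1,
      lowerCol_ne hP.2⟩
  · exact (lowerCol_injOn z).mono fun P hP => by simp at hP; exact hP.2
  · intro x hx
    simp only [Finset.coe_filter, Set.mem_ofPred_eq, mem_preds] at hx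
    obtain ⟨⟨hx1, -⟩, hx2, hx3⟩ := hx
    obtain ⟨P, h1, h2, h3⟩ := exists_of_moveRight (p := p) hx1 (by rw [hx2]; exact hx3.symm)
    rw [hx2] at h1 h2 h3
    exact ⟨P, by simp [h1, h2], h3.symm⟩

open Classical in
/-- The second sum on the right comes from the left clocks that act as right clocks. -/
lemma sum_ne_moveLeft {z : Config k} (hz : IsInterlacing z) (p : Particle k)
    (F : Config k → ℝ) :
    ∑ x ∈ preds z with moveLeft x p = z ∧ x ≠ z, F x =
      (∑ P with IsDiagStart z p P ∧ CanRaise z P, F (raiseDiag z P)) +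
      ∑ P with IsColStart z p P ∧ CanLower z P,
        if Reflects (lowerCol z P) p then F (lowerCol z P) else 0 := by
  rw [← sum_ne_moveRight hz p fun x => if Reflects x p then F x else 0, ← Finset.sum_filter,
    Finset.filter_filter]
  have h2 : (preds z).filter (fun x => (moveRight x p = z ∧ x ≠ z) ∧ Reflects x p) =
      ((preds z).filter fun x => moveLeft x p = z ∧ x ≠ z).filter fun x => Reflects x p := by
    rw [Finset.filter_filter]
    refine Finset.filter_congr fun x _ => and_congr_left fun hr => ?_
    rw [moveLeft_of_reflects hr]
  rw [h2, ← Finset.sum_filter_not_add_sum_filter (p := fun x => Reflects x p)]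
  congr 1
  symm
  refine Finset.sum_nbij (raiseDiag z) ?_ ((raiseDiag_injective z).injOn) ?_ fun _ _ => rfl
  · intro P hP
    simp only [Finset.mem_filter, Finset.mem_univ, true_and] at hP ⊢
    have h1 := moveLeft_raiseDiag hz hP.1
    exact ⟨⟨mem_preds_of_move (c := (p, Direction.left)) (raiseDiag_isInterlacing hz hP.2) h1.2,
      h1.2, raiseDiag_ne P⟩, h1.1⟩
  · intro x hx
    simp only [Finset.coe_filter, Set.mem_ofPred_eq, mem_preds, Finset.mem_filter] at hx
    obtain ⟨⟨⟨hx1, -⟩, hx2, hx3⟩, hx4⟩ := hx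
    obtain ⟨P, h1, h2, h3⟩ := exists_of_moveLeft (p := p) hx1 hx4 (by rw [hx2]; exact hx3.symm)
    rw [hx2] at h1 h2 h3
    exact ⟨P, by simp [h1, h2], h3.symm⟩

open Classical in
lemma sum_preds_eq {z : Config k} (hz : IsInterlacing z) (f : Config k → Config k)
    (F : Config k → ℝ) :
    ∑ x ∈ preds z with f x = z, F x =
      (if f z = z then F z else 0) + ∑ x ∈ preds z with f x = z ∧ x ≠ z, F x := by
  rw [Finset.sum_filter, ← Finset.add_sum_erase _ _ (self_mem_preds hz)]
  congr 1
  rw [← Finset.sum_filter]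
  refine Finset.sum_congr ?_ fun _ _ => rfl
  ext x
  simp only [Finset.mem_filter, Finset.mem_erase]
  tauto

open Classical in
/-- A double sum over the pairs of a last moved particle `P` and the first moved particle `p`, when
`P` determines `p`. -/
lemma sum_sum_start {S : Particle k → Particle k → Prop} {C : Particle k → Prop}
    {H : Particle k → Particle k → ℝ} {H' : Particle k → ℝ} (hS : ∀ P, ∃! p, S p P)
    (hH : ∀ p P, S p P → C P → H p P = H' P) :
    ∑ p, ∑ P with S p P ∧ C P, H p P = ∑ P with C P, H' P := by
  simp_rw [Finset.sum_filter]
  rw [Finset.sum_comm]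
  refine Finset.sum_congr rfl fun P _ => ?_
  obtain ⟨p, hp, hu⟩ := hS P
  rw [Finset.sum_eq_single p]
  · by_cases hC : C P
    · rw [if_pos ⟨hp, hC⟩, if_pos hC, hH p P hp hC]
    · rw [if_neg (by tauto), if_neg hC]
  · intro q _ hq
    exact if_neg fun h => hq (hu q h.1)
  · simp

lemma configRow_eq_of_lt {x y : Config k} (h : ∀ q : Particle k, q.row = k → x q = y q) :
    configRow x = configRow y := by
  funext j
  unfold configRow lastRow
  rw [h _ rfl]

open Classical in
/-- The number of particles with a given property. -/
noncomputable def particleCount (A : Particle k → Prop) : ℕ := (Finset.univ.filter A).card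

lemma card_filter_eq_particleCount (A : Particle k → Prop) [DecidablePred A] :
    (Finset.univ.filter A).card = particleCount A := by
  unfold particleCount
  congr

/-- The number of clocks whose ring does not change `z`. -/
noncomputable def nullCount (z : Config k) : ℕ :=
  particleCount (fun p => moveRight z p = z) + particleCount (fun p => moveLeft z p = z)

open Classical in
/-- The moves that lead to `z`, indexed by the lowest particle `P` that they move. A jump to the
left counts twice if `P` is a wall particle above the last row at `0`, since its sign is lost; a
jump to the right counts twice if `P` is a wall particle of the last row at `1`, since both clocks
of `P` cause it. -/
lemma sum_moves_eq {z : Config k} (hz : IsInterlacing z) (g : (Fin ((k + 1) / 2) → ℤ) → ℝ) :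
    (∑ p, ∑ x ∈ preds z with moveRight x p = z, g (configRow x) * patternWeight x) +
      (∑ p, ∑ x ∈ preds z with moveLeft x p = z, g (configRow x) * patternWeight x) =
    patternWeight z * (nullCount z * g (configRow z) +
      (∑ P with CanRaise z P,
        (if P.IsWall ∧ P.row < k ∧ z P = 0 then 2 else 1) * g (configRow (raiseDiag z P))) +
      ∑ P with CanLower z P,
        (if P.IsWall ∧ P.row = k ∧ z P = 1 then 2 else 1) * g (configRow (lowerCol z P))) := by
  set F : Config k → ℝ := fun x => g (configRow x) * patternWeight x with hF
  have h1 := fun p => sum_preds_eq hz (fun x => moveRight x p) F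
  have h2 := fun p => sum_preds_eq hz (fun x => moveLeft x p) F
  simp_rw [h1, h2, sum_ne_moveRight hz, sum_ne_moveLeft hz]
  simp_rw [Finset.sum_add_distrib]
  have h3 : ∑ p, ∑ P with IsDiagStart z p P ∧ CanRaise z P, F (raiseDiag z P) =
      ∑ P with CanRaise z P, F (raiseDiag z P) :=
    sum_sum_start (existsUnique_isDiagStart hz) fun _ _ _ _ => rfl
  have h4 : (∑ p, ∑ P with IsColStart z p P ∧ CanLower z P, F (lowerCol z P)) +
      ∑ p, ∑ P with IsColStart z p P ∧ CanLower z P,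
        (if Reflects (lowerCol z P) p then F (lowerCol z P) else 0) =
      ∑ P with CanLower z P, (if P.IsWall ∧ P.row = k ∧ z P = 1 then 2 else 1) *
        g (configRow (lowerCol z P)) * patternWeight z := by
    rw [← Finset.sum_add_distrib]
    simp_rw [← Finset.sum_add_distrib]
    refine sum_sum_start (existsUnique_isColStart hz) fun p P hs hc => ?_
    have h5 : ((1 + if Reflects (lowerCol z P) p then 1 else 0) *
        (patternWeight (lowerCol z P) : ℝ)) =
        (if P.IsWall ∧ P.row = k ∧ z P = 1 then 2 else 1) * patternWeight z := by
      exact_mod_cast patternWeight_lowerCol hc hs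
    rw [mul_right_comm, ← h5]
    simp only [hF]
    split_ifs <;> ring
  have h5 : ∑ P with CanRaise z P, F (raiseDiag z P) =
      ∑ P with CanRaise z P, (if P.IsWall ∧ P.row < k ∧ z P = 0 then 2 else 1) *
        g (configRow (raiseDiag z P)) * patternWeight z := by
    refine Finset.sum_congr rfl fun P _ => ?_
    simp only [hF, patternWeight_raiseDiag]
    push_cast
    ring
  rw [h3, h5]
  have h6 : (∑ p, if moveRight z p = z then F z else 0) + (∑ p, if moveLeft z p = z then F z else 0)
      = patternWeight z * (nullCount z * g (configRow z)) := by
    rw [← Finset.sum_filter, ← Finset.sum_filter, Finset.sum_const, Finset.sum_const, nullCount,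
      card_filter_eq_particleCount, card_filter_eq_particleCount]
    simp only [hF, nsmul_eq_mul]
    push_cast
    ring
  have h7 := Finset.sum_mul (Finset.univ.filter fun P => CanRaise z P)
    (fun P => (if P.IsWall ∧ P.row < k ∧ z P = 0 then (2 : ℝ) else 1) *
        g (configRow (raiseDiag z P))) (patternWeight z : ℝ)
  have h8 := Finset.sum_mul (Finset.univ.filter fun P => CanLower z P)
    (fun P => (if P.IsWall ∧ P.row = k ∧ z P = 1 then (2 : ℝ) else 1) *
        g (configRow (lowerCol z P))) (patternWeight z : ℝ)
  rw [← h7]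
  rw [← h8] at h4
  linear_combination h4 + h6

end Preds

noncomputable instance : Fintype Direction :=
  ⟨⟨{Direction.left, Direction.right}, by simp⟩, fun d => by cases d <;> simp⟩

lemma sum_direction {M : Type*} [AddCommMonoid M] (f : Direction → M) :
    ∑ d, f d = f Direction.left + f Direction.right := by
  change (Multiset.map f {Direction.left, Direction.right}).sum = _
  simp

section Count

variable {k : ℕ} {z : Config k}

lemma moveLeft_eq_self_iff (hz : IsInterlacing z) (p : Particle k) :
    moveLeft z p = z ↔ (p.IsWall ∧ z p = 0 ∧ BlockedRight z p) ∨
      (¬ p.IsWall ∧ ∃ q : Particle k, q.row + 1 = p.row ∧ q.idx = p.idx ∧ z p = z q) := by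
  by_cases hw : p.IsWall
  · by_cases h0 : z p = 0
    · rw [moveLeft_of_reflects ⟨hw, h0⟩, moveRight_eq_self_iff]
      tauto
    · rw [moveLeft_of_wall hw h0]
      constructor
      · intro h
        have := congrFun h p
        rw [Function.update_self] at this
        omega
      · rintro (h | h) <;> tauto
  · obtain ⟨b, hb1, hb2⟩ := exists_above hw
    have h2 := hz.col b p hb1.symm hb2.symm
    constructor
    · intro h
      refine Or.inr ⟨hw, b, hb1, hb2, ?_⟩
      by_contra hne
      have := congrFun h p
      rw [moveLeft_apply hw hb1 hb2 hne, if_pos ⟨le_rfl, rfl, rfl⟩] at this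
      omega
    · rintro (h | ⟨-, q, hq1, hq2, h⟩)
      · tauto
      · exact moveLeft_of_blocked hw hq1 hq2 h

lemma canLower_iff_of_not_wall (hz : IsInterlacing z) {P q : Particle k}
    (hq : q.row = P.row + 1) (hq' : q.idx = P.idx + 1) : CanLower z P ↔ ¬ z q = z P := by
  have h1 := hz.diag P q hq hq'
  constructor
  · intro h h2
    have := h.2 q hq' hq.le
    omega
  · intro h
    refine ⟨by omega, fun q' h2 h3 => ?_⟩
    have := hz.col_le (p := q') (p' := q) (by omega) (by omega)
    omega

lemma canLower_iff_of_wall {P : Particle k} (hP : P.IsWall) : CanLower z P ↔ 1 ≤ z P := by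
  refine ⟨fun h => h.1, fun h => ⟨h, fun q h1 h2 => ?_⟩⟩
  have := q.bounds
  unfold Particle.IsWall at hP
  omega

lemma canRaise_iff (hz : IsInterlacing z) {P q : Particle k}
    (hq : q.row = P.row + 1) (hq' : q.idx = P.idx) : CanRaise z P ↔ ¬ z q = z P := by
  have h1 := hz.col P q hq hq'
  constructor
  · intro h h2
    have := h q (by omega) hq.le
    omega
  · intro h q' h2 h3
    have := hz.diag_le (p := q') (p' := q) (by omega) (by omega)
    omega

lemma exists_below {P : Particle k} (hP : P.row < k) :
    ∃ q : Particle k, q.row = P.row + 1 ∧ q.idx = P.idx := by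
  have := P.bounds
  exact Particle.exists_of_bounds (by omega)

lemma exists_below_right {P : Particle k} (hP : P.row < k) (hw : ¬ P.IsWall) :
    ∃ q : Particle k, q.row = P.row + 1 ∧ q.idx = P.idx + 1 := by
  have := P.bounds
  unfold Particle.IsWall at hw
  exact Particle.exists_of_bounds (by omega)

/-- Cardinalities agree along a relation that is a bijection between two sets of particles. -/
lemma card_filter_eq_of_rel {A B : Particle k → Prop} (R : Particle k → Particle k → Prop)
    (h₁ : ∀ P, A P → ∃ q, R P q ∧ B q) (h₂ : ∀ q, B q → ∃ P, R P q ∧ A P)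
    (hu₁ : ∀ P P' q, R P q → R P' q → P = P') (hu₂ : ∀ P q q', R P q → R P q' → q = q') :
    particleCount A = particleCount B := by
  classical
  choose f hf using h₁
  rw [← card_filter_eq_particleCount, ← card_filter_eq_particleCount]
  refine Finset.card_bij (fun P hP => f P (by simpa using hP)) ?_ ?_ ?_
  · intro P hP
    simpa using (hf P (by simpa using hP)).2
  · intro P hP P' hP' h
    have h1 := (hf P (by simpa using hP)).1
    have h2 := (hf P' (by simpa using hP')).1
    rw [← h] at h2
    exact hu₁ _ _ _ h1 h2
  · intro q hq
    obtain ⟨P, hP, hA⟩ := h₂ q (by simpa using hq)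
    exact ⟨P, by simpa using hA, hu₂ _ _ _ (hf P hA).1 hP⟩

/-- Blocked right clocks correspond to particles off the wall that cannot have been the last to
move in a jump to the right. -/
lemma card_blockedRight (hz : IsInterlacing z) :
    particleCount (fun P : Particle k => P.row < k ∧ ¬ P.IsWall ∧ ¬ CanLower z P) =
      particleCount (fun q : Particle k => BlockedRight z q) := by
  refine card_filter_eq_of_rel (fun P q => q.row = P.row + 1 ∧ q.idx = P.idx + 1) ?_ ?_ ?_ ?_
  · rintro P ⟨h1, h2, h3⟩
    obtain ⟨q, hq1, hq2⟩ := exists_below_right h1 h2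
    rw [canLower_iff_of_not_wall hz hq1 hq2, not_not] at h3
    exact ⟨q, ⟨hq1, hq2⟩, (blockedRight_iff _ _).2 ⟨P, hq1.symm, hq2.symm, h3⟩⟩
  · intro q hq
    obtain ⟨P, hP1, hP2, hP3⟩ := (blockedRight_iff _ _).1 hq
    have := q.bounds
    refine ⟨P, ⟨hP1.symm, hP2.symm⟩, by omega, by unfold Particle.IsWall; omega, ?_⟩
    rw [canLower_iff_of_not_wall hz hP1.symm hP2.symm, not_not]
    exact hP3
  · rintro P P' q ⟨h1, h2⟩ ⟨h3, h4⟩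
    exact Particle.ext' (by omega) (by omega)
  · rintro P q q' ⟨h1, h2⟩ ⟨h3, h4⟩
    exact Particle.ext' (by omega) (by omega)

/-- Blocked left clocks off the wall correspond to particles that cannot have been the last to
move in a jump to the left. -/
lemma card_blockedLeft (hz : IsInterlacing z) :
    particleCount (fun P : Particle k => P.row < k ∧ ¬ CanRaise z P) =
      particleCount (fun p : Particle k => ¬ p.IsWall ∧
        ∃ q : Particle k, q.row + 1 = p.row ∧ q.idx = p.idx ∧ z p = z q) := by
  refine card_filter_eq_of_rel (fun P q => q.row = P.row + 1 ∧ q.idx = P.idx) ?_ ?_ ?_ ?_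
  · rintro P ⟨h1, h3⟩
    obtain ⟨q, hq1, hq2⟩ := exists_below h1
    rw [canRaise_iff hz hq1 hq2, not_not] at h3
    have := P.bounds
    exact ⟨q, ⟨hq1, hq2⟩, by unfold Particle.IsWall; omega, P, hq1.symm, hq2.symm, h3⟩
  · rintro q ⟨hq, P, hP1, hP2, hP3⟩
    have := q.bounds
    refine ⟨P, ⟨hP1.symm, hP2.symm⟩, by omega, ?_⟩
    rw [canRaise_iff hz hP1.symm hP2.symm, not_not]
    exact hP3
  · rintro P P' q ⟨h1, h2⟩ ⟨h3, h4⟩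
    exact Particle.ext' (by omega) (by omega)
  · rintro P q q' ⟨h1, h2⟩ ⟨h3, h4⟩
    exact Particle.ext' (by omega) (by omega)

/-- A wall particle `P = (i, j)` at `0` below which `(i + 1, j)` is at `0` too corresponds to the
blocked wall particle `(i + 2, j + 1)`, as long as that row exists. -/
lemma card_blockedReflection (hz : IsInterlacing z) :
    particleCount (fun P : Particle k => (P.row < k ∧ P.IsWall ∧ z P = 0 ∧ ¬ CanRaise z P) ∧
        P.row + 1 ≠ k) =
      particleCount (fun q : Particle k => q.IsWall ∧ z q = 0 ∧ BlockedRight z q) := by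
  refine card_filter_eq_of_rel (fun P q => q.row = P.row + 2 ∧ q.idx = P.idx + 1) ?_ ?_ ?_ ?_
  · rintro P ⟨⟨h1, h2, h3, h4⟩, h5⟩
    have hPb := P.bounds
    unfold Particle.IsWall at h2
    obtain ⟨b, hb1, hb2⟩ := exists_below h1
    rw [canRaise_iff hz hb1 hb2, not_not] at h4
    obtain ⟨q, hq1, hq2⟩ := Particle.exists_of_bounds (k := k) (i := P.row + 2) (j := P.idx + 1)
      (by omega)
    have h6 := hz.diag b q (by omega) (by omega)
    refine ⟨q, ⟨hq1, hq2⟩, by unfold Particle.IsWall; omega, by omega, ?_⟩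
    exact (blockedRight_iff _ _).2 ⟨b, by omega, by omega, by omega⟩
  · rintro q ⟨h1, h2, h3⟩
    obtain ⟨b, hb1, hb2, hb3⟩ := (blockedRight_iff _ _).1 h3
    have hqb := q.bounds
    have hbb := b.bounds
    unfold Particle.IsWall at h1
    obtain ⟨P, hP1, hP2⟩ := Particle.exists_of_bounds (k := k) (i := q.row - 2) (j := b.idx)
      (by omega)
    have h6 := hz.col P b (by omega) (by omega)
    refine ⟨P, ⟨by omega, by omega⟩, ⟨by omega, by unfold Particle.IsWall; omega, by omega, ?_⟩,
      by omega⟩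
    rw [canRaise_iff hz (q := b) (by omega) (by omega), not_not]
    omega
  · rintro P P' q ⟨h1, h2⟩ ⟨h3, h4⟩
    exact Particle.ext' (by omega) (by omega)
  · rintro P q q' ⟨h1, h2⟩ ⟨h3, h4⟩
    exact Particle.ext' (by omega) (by omega)

/-- The case left out in `card_blockedReflection`: the row `i + 1` is the last one. -/
lemma card_lastEvenRow (hz : IsInterlacing z) :
    particleCount (fun P : Particle k => (P.row < k ∧ P.IsWall ∧ z P = 0 ∧ ¬ CanRaise z P) ∧
        P.row + 1 = k) =
      particleCount (fun q : Particle k => q.row = k ∧ 2 * q.idx = k ∧ z q = 0) := by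
  refine card_filter_eq_of_rel (fun P q => q.row = P.row + 1 ∧ q.idx = P.idx) ?_ ?_ ?_ ?_
  · rintro P ⟨⟨h1, h2, h3, h4⟩, h5⟩
    unfold Particle.IsWall at h2
    obtain ⟨q, hq1, hq2⟩ := exists_below h1
    rw [canRaise_iff hz hq1 hq2, not_not] at h4
    exact ⟨q, ⟨hq1, hq2⟩, by omega, by omega, by omega⟩
  · rintro q ⟨h1, h2, h3⟩
    have hqb := q.bounds
    obtain ⟨P, hP1, hP2⟩ := Particle.exists_of_bounds (k := k) (i := k - 1) (j := q.idx)
      (by omega)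
    have h6 := hz.col P q (by omega) (by omega)
    refine ⟨P, ⟨by omega, by omega⟩, ⟨by omega, by unfold Particle.IsWall; omega, by omega, ?_⟩,
      by omega⟩
    rw [canRaise_iff hz (q := q) (by omega) (by omega), not_not]
    omega
  · rintro P P' q ⟨h1, h2⟩ ⟨h3, h4⟩
    exact Particle.ext' (by omega) (by omega)
  · rintro P q q' ⟨h1, h2⟩ ⟨h3, h4⟩
    exact Particle.ext' (by omega) (by omega)

lemma card_filter_split (A B : Particle k → Prop) :
    particleCount A =
      particleCount (fun P => A P ∧ B P) + particleCount (fun P => A P ∧ ¬ B P) := by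
  classical
  simp_rw [← card_filter_eq_particleCount]
  rw [← Finset.card_filter_add_card_filter_not (s := {P | A P}) (p := B), Finset.filter_filter,
    Finset.filter_filter]

/-- The number of particles above the last row. -/
noncomputable def innerCount (k : ℕ) : ℕ := particleCount (fun P : Particle k => P.row < k)

open Classical in
/-- The moves that do not change the last row balance: their number is twice the number of
particles above the last row, up to a correction by one if `k` is even and the last particle is at
`0`. -/
lemma count_inner_moves (hz : IsInterlacing z) :
    particleCount (fun P : Particle k => P.row < k ∧ CanLower z P) +
      (∑ P with P.row < k ∧ CanRaise z P, if P.IsWall ∧ z P = 0 then 2 else 1) + nullCount z +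
      particleCount (fun q : Particle k => q.row = k ∧ 2 * q.idx = k ∧ z q = 0) =
      2 * innerCount k := by
  have e1 := card_blockedRight hz
  have e2 := card_blockedLeft hz
  have e3 := card_blockedReflection hz
  have e4 := card_lastEvenRow hz
  have e5 : nullCount z = particleCount (fun q : Particle k => BlockedRight z q) +
      (particleCount (fun p : Particle k => ¬ p.IsWall ∧
          ∃ q : Particle k, q.row + 1 = p.row ∧ q.idx = p.idx ∧ z p = z q) +
        particleCount (fun q : Particle k => q.IsWall ∧ z q = 0 ∧ BlockedRight z q)) := by
    unfold nullCount
    simp_rw [moveRight_eq_self_iff, moveLeft_eq_self_iff hz]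
    congr 1
    simp_rw [← card_filter_eq_particleCount]
    rw [add_comm, ← Finset.card_union_of_disjoint, ← Finset.filter_or]
    rw [Finset.disjoint_filter]
    tauto
  have e6 : (∑ P : Particle k with P.row < k ∧ CanRaise z P, if P.IsWall ∧ z P = 0 then 2 else 1) =
      particleCount (fun P : Particle k => P.row < k ∧ CanRaise z P) +
        particleCount (fun P : Particle k => (P.row < k ∧ P.IsWall ∧ z P = 0) ∧ CanRaise z P) := by
    have : ∀ P : Particle k, (if P.IsWall ∧ z P = 0 then 2 else 1) =
        1 + if P.IsWall ∧ z P = 0 then 1 else 0 := fun P => by split_ifs <;> rfl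
    simp_rw [this, ← card_filter_eq_particleCount]
    rw [Finset.sum_add_distrib, Finset.card_eq_sum_ones, ← Finset.sum_filter,
      Finset.card_eq_sum_ones, Finset.filter_filter]
    congr 2
    ext P
    simp only [Finset.mem_filter]
    tauto
  have e7 := card_filter_split (fun P : Particle k => P.row < k) (fun P => CanRaise z P)
  have e8 := card_filter_split (fun P : Particle k => P.row < k) (fun P => P.IsWall)
  have e9 := card_filter_split (fun P : Particle k => P.row < k ∧ ¬ P.IsWall)
    (fun P => CanLower z P)
  have e10 := card_filter_split (fun P : Particle k => P.row < k ∧ P.IsWall)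
    (fun P => CanLower z P)
  have e11 := card_filter_split (fun P : Particle k => P.row < k ∧ P.IsWall ∧ z P = 0)
    (fun P => CanRaise z P)
  have e12 := card_filter_split
    (fun P : Particle k => P.row < k ∧ P.IsWall ∧ z P = 0 ∧ ¬ CanRaise z P) (fun P => P.row + 1 = k)
  have e13 := card_filter_split (fun P : Particle k => P.row < k ∧ CanLower z P)
    (fun P => P.IsWall)
  have e14 : particleCount (fun P : Particle k => (P.row < k ∧ P.IsWall) ∧ ¬ CanLower z P) =
      particleCount (fun P : Particle k => P.row < k ∧ P.IsWall ∧ z P = 0) := by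
    congr 1
    ext P
    by_cases hw : P.IsWall
    · rw [canLower_iff_of_wall hw, not_le, Nat.lt_one_iff]
      tauto
    · tauto
  simp only [and_assoc, ne_eq, and_comm (a := CanLower z _)] at *
  unfold innerCount
  omega

end Count

section Rows

variable {k : ℕ}

/-- The particles of the last row. -/
def lastParticle (k : ℕ) (j : Fin ((k + 1) / 2)) : Particle k :=
  ⟨(k, (j : ℕ) + 1), by have := j.isLt; dsimp only; omega⟩

lemma lastParticle_row (j : Fin ((k + 1) / 2)) : (lastParticle k j).row = k := rfl
lemma lastParticle_idx (j : Fin ((k + 1) / 2)) : (lastParticle k j).idx = j + 1 := rfl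

lemma configRow_apply (x : Config k) (j : Fin ((k + 1) / 2)) :
    configRow x j = (x (lastParticle k j) : ℤ) := rfl

lemma lastParticle_injective : Function.Injective (lastParticle k) := by
  intro i j h
  have := congrArg Particle.idx h
  rw [lastParticle_idx, lastParticle_idx] at this
  exact Fin.ext (by omega)

lemma exists_lastParticle {P : Particle k} (hP : P.row = k) : ∃ j, lastParticle k j = P := by
  have := P.bounds
  refine ⟨⟨P.idx - 1, by omega⟩, Particle.ext' hP.symm ?_⟩
  rw [lastParticle_idx]
  simp only
  omega

lemma eq_lastParticle_iff {P : Particle k} {j : Fin ((k + 1) / 2)} :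
    P = lastParticle k j ↔ P.row = k ∧ P.idx = j + 1 :=
  ⟨by rintro rfl; exact ⟨rfl, rfl⟩, fun h => Particle.ext' h.1 h.2⟩

lemma configRow_mem_rowSpace {x : Config k} (hx : IsInterlacing x) : configRow x ∈ rowSpace k := by
  refine ⟨fun i j hij => ?_, fun i => by rw [configRow_apply]; positivity⟩
  rw [configRow_apply, configRow_apply]
  have hP := (lastParticle k j).bounds
  have hi := (lastParticle k i).bounds
  have e1 := lastParticle_row j
  have e2 := lastParticle_idx j
  have e3 := lastParticle_row i
  have e4 := lastParticle_idx i
  have hij' : (i : ℕ) ≤ j := hij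
  -- the entry `(k - j + i, i)` lies between the two
  obtain ⟨q, hq1, hq2⟩ := Particle.exists_of_bounds (k := k) (i := k - ((j : ℕ) - i))
    (j := (i : ℕ) + 1) (by omega)
  have h1 := hx.col_le (p := q) (p' := lastParticle k i) (by omega) (by omega)
  have h2 := hx.diag_le (p := q) (p' := lastParticle k j) (by omega) (by omega)
  exact_mod_cast h2.trans h1

lemma configRow_lowerCol_of_lt {z : Config k} {P : Particle k} (hP : P.row < k) :
    configRow (lowerCol z P) = configRow z :=
  configRow_eq_of_lt fun q hq => by unfold lowerCol; rw [if_neg]; omega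

lemma configRow_raiseDiag_of_lt {z : Config k} {P : Particle k} (hP : P.row < k) :
    configRow (raiseDiag z P) = configRow z :=
  configRow_eq_of_lt fun q hq => by unfold raiseDiag; rw [if_neg]; omega

lemma configRow_lowerCol {z : Config k} {j : Fin ((k + 1) / 2)}
    (h : CanLower z (lastParticle k j)) :
    configRow (lowerCol z (lastParticle k j)) = configRow z - Pi.single j 1 := by
  funext i
  rw [Pi.sub_apply, configRow_apply, configRow_apply]
  have h1 := h.1
  unfold lowerCol
  by_cases hij : i = j
  · subst hij
    rw [if_pos ⟨rfl, le_rfl, rfl⟩, Pi.single_eq_same]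
    omega
  · rw [if_neg, Pi.single_eq_of_ne hij, sub_zero]
    rw [lastParticle_idx, lastParticle_idx]
    rintro ⟨h2, -⟩
    exact hij (Fin.ext (by omega))

lemma configRow_raiseDiag (z : Config k) (j : Fin ((k + 1) / 2)) :
    configRow (raiseDiag z (lastParticle k j)) = configRow z + Pi.single j 1 := by
  funext i
  rw [Pi.add_apply, configRow_apply, configRow_apply]
  unfold raiseDiag
  by_cases hij : i = j
  · subst hij
    rw [if_pos ⟨rfl, le_rfl, rfl⟩, Pi.single_eq_same]
    push_cast
    rfl
  · rw [if_neg, Pi.single_eq_of_ne hij, add_zero]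
    rw [lastParticle_idx, lastParticle_idx, lastParticle_row, lastParticle_row]
    rintro ⟨h2, -⟩
    exact hij (Fin.ext (by omega))

lemma canLower_lastParticle_iff {z : Config k} (hz : IsInterlacing z) (j : Fin ((k + 1) / 2)) :
    CanLower z (lastParticle k j) ↔ configRow z - Pi.single j 1 ∈ rowSpace k := by
  constructor
  · intro h
    rw [← configRow_lowerCol h]
    exact configRow_mem_rowSpace (lowerCol_isInterlacing hz h)
  · intro h
    have h0 := h.2 j
    rw [Pi.sub_apply, Pi.single_eq_same, configRow_apply] at h0
    refine ⟨by omega, fun q hq1 hq2 => ?_⟩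
    have hqb := q.bounds
    rw [lastParticle_idx] at hq1
    obtain ⟨i, hi⟩ : ∃ i : Fin ((k + 1) / 2), (i : ℕ) = j + 1 := ⟨⟨j + 1, by omega⟩, rfl⟩
    have h1 := hz.col_le (p := q) (p' := lastParticle k i) (by rw [lastParticle_idx]; omega)
      (by rw [lastParticle_row]; omega)
    have h2 := h.1 (show j ≤ i from Fin.le_def.2 (by omega))
    rw [Pi.sub_apply, Pi.sub_apply, Pi.single_eq_same,
      Pi.single_eq_of_ne (by intro h; rw [h] at hi; omega), configRow_apply, configRow_apply] at h2
    omega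

lemma canRaise_lastParticle_iff {z : Config k} (hz : IsInterlacing z) (j : Fin ((k + 1) / 2)) :
    CanRaise z (lastParticle k j) ↔ configRow z + Pi.single j 1 ∈ rowSpace k := by
  constructor
  · intro h
    rw [← configRow_raiseDiag]
    exact configRow_mem_rowSpace (raiseDiag_isInterlacing hz h)
  · intro h q hq1 hq2
    have hqb := q.bounds
    rw [lastParticle_idx, lastParticle_row] at hq1
    have hjlt := j.isLt
    obtain ⟨i, hi⟩ : ∃ i : Fin ((k + 1) / 2), (i : ℕ) + 1 = j :=
      ⟨⟨j - 1, by omega⟩, by simp only; omega⟩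
    have h1 := hz.diag_le (p := q) (p' := lastParticle k i)
      (by rw [lastParticle_idx, lastParticle_row]; omega)
      (by rw [lastParticle_row]; omega)
    have h2 := h.1 (show i ≤ j from Fin.le_def.2 (by omega))
    rw [Pi.add_apply, Pi.add_apply, Pi.single_eq_same,
      Pi.single_eq_of_ne (by intro h; rw [h] at hi; omega), configRow_apply, configRow_apply] at h2
    omega

open Classical in
lemma sum_lastRow (C : Particle k → Prop) (F : Particle k → ℝ) :
    ∑ P with C P ∧ P.row = k, F P =
      ∑ j, if C (lastParticle k j) then F (lastParticle k j) else 0 := by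
  rw [← Finset.sum_filter]
  symm
  refine Finset.sum_nbij (lastParticle k) ?_ lastParticle_injective.injOn ?_ fun _ _ => rfl
  · intro j hj
    simpa [lastParticle_row] using hj
  · intro P hP
    simp only [Finset.coe_filter, Finset.mem_univ, true_and, Set.mem_ofPred_eq] at hP
    obtain ⟨j, rfl⟩ := exists_lastParticle hP.2
    exact ⟨j, by simpa using hP.1, rfl⟩

open Classical in
/-- The diagonal coefficient of the intertwining relation at the row `b`. It counts, with their
weights, the moves into a configuration with last row `b` that do not change the last row. -/
noncomputable def holdRate (k : ℕ) (b : Fin ((k + 1) / 2) → ℤ) : ℝ :=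
  2 * innerCount k -
    if Even k ∧ ∃ i : Fin ((k + 1) / 2), (i : ℕ) + 1 = (k + 1) / 2 ∧ b i = 0 then 1 else 0

open Classical in
lemma card_lastEven_eq (z : Config k) :
    particleCount (fun q : Particle k => q.row = k ∧ 2 * q.idx = k ∧ z q = 0) =
    if Even k ∧ ∃ i : Fin ((k + 1) / 2), (i : ℕ) + 1 = (k + 1) / 2 ∧ configRow z i = 0
      then 1 else 0 := by
  split_ifs with h
  · obtain ⟨⟨m, hm⟩, i, hi1, hi2⟩ := h
    rw [configRow_apply] at hi2
    rw [← card_filter_eq_particleCount, Finset.card_eq_one]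
    refine ⟨lastParticle k i, ?_⟩
    ext q
    simp only [Finset.mem_filter, Finset.mem_univ, true_and, Finset.mem_singleton]
    rw [eq_lastParticle_iff]
    refine ⟨fun h => ⟨h.1, by omega⟩, fun h => ⟨h.1, by omega, ?_⟩⟩
    rw [eq_lastParticle_iff.2 h]
    omega
  · rw [← card_filter_eq_particleCount, Finset.card_eq_zero, Finset.filter_eq_empty_iff]
    rintro q - ⟨h1, h2, h3⟩
    obtain ⟨j, rfl⟩ := exists_lastParticle h1
    rw [lastParticle_idx] at h2
    exact h ⟨⟨j + 1, by omega⟩, j, by omega, by rw [configRow_apply]; omega⟩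

open Classical in
/-- The intertwining relation. The sum of `g (configRow x) * patternWeight x` over all moves `x → z`
depends on `z` only through its weight and its last row. -/
theorem sum_preds_move {z : Config k} (hz : IsInterlacing z)
    (g : (Fin ((k + 1) / 2) → ℤ) → ℝ) :
    ∑ c : Particle k × Direction, ∑ x ∈ preds z with move x c = z,
        g (configRow x) * patternWeight x =
    patternWeight z * (holdRate k (configRow z) * g (configRow z) +
      (∑ j : Fin ((k + 1) / 2), if configRow z + Pi.single j 1 ∈ rowSpace k then
        g (configRow z + Pi.single j 1) else 0) +
      ∑ j : Fin ((k + 1) / 2), if configRow z - Pi.single j 1 ∈ rowSpace k then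
        (if Odd k ∧ (j : ℕ) + 1 = (k + 1) / 2 ∧ configRow z j = 1 then 2 else 1) *
          g (configRow z - Pi.single j 1) else 0) := by
  have hcount : (particleCount (fun P : Particle k => P.row < k ∧ CanLower z P) : ℝ) +
      (∑ P : Particle k with P.row < k ∧ CanRaise z P, if P.IsWall ∧ z P = 0 then (2 : ℝ) else 1) +
      nullCount z = holdRate k (configRow z) := by
    have h1 := congrArg (Nat.cast : ℕ → ℝ) (count_inner_moves hz)
    rw [card_lastEven_eq] at h1
    push_cast at h1
    unfold holdRate
    linarith
  rw [Fintype.sum_prod_type]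
  simp_rw [sum_direction]
  rw [Finset.sum_add_distrib, add_comm]
  refine (sum_moves_eq hz g).trans ?_
  congr 1
  rw [← hcount, ← Finset.sum_filter_add_sum_filter_not (Finset.univ.filter fun P => CanRaise z P)
      (fun P => P.row = k),
    ← Finset.sum_filter_add_sum_filter_not (Finset.univ.filter fun P => CanLower z P)
      (fun P => P.row = k)]
  simp_rw [Finset.filter_filter]
  rw [sum_lastRow, sum_lastRow]
  have hlt : ∀ P : Particle k, ¬ P.row = k ↔ P.row < k := fun P => by
    have := P.row_le; omega
  have e1 : ∑ P : Particle k with CanRaise z P ∧ ¬ P.row = k,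
      (if P.IsWall ∧ P.row < k ∧ z P = 0 then (2 : ℝ) else 1) * g (configRow (raiseDiag z P)) =
      (∑ P : Particle k with P.row < k ∧ CanRaise z P,
        if P.IsWall ∧ z P = 0 then (2 : ℝ) else 1) * g (configRow z) := by
    rw [Finset.sum_mul]
    refine Finset.sum_congr (by ext P; simp [hlt, and_comm]) fun P hP => ?_
    simp only [Finset.mem_filter, Finset.mem_univ, true_and] at hP
    rw [configRow_raiseDiag_of_lt hP.1]
    simp [hP.1]
  have e2 : ∑ P : Particle k with CanLower z P ∧ ¬ P.row = k,
      (if P.IsWall ∧ P.row = k ∧ z P = 1 then (2 : ℝ) else 1) * g (configRow (lowerCol z P)) =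
      particleCount (fun P : Particle k => P.row < k ∧ CanLower z P) * g (configRow z) := by
    rw [← card_filter_eq_particleCount, ← nsmul_eq_mul, ← Finset.sum_const]
    refine Finset.sum_congr (by ext P; simp [hlt, and_comm]) fun P hP => ?_
    simp only [Finset.mem_filter, Finset.mem_univ, true_and] at hP
    rw [configRow_lowerCol_of_lt hP.1, if_neg (by omega), one_mul]
  have e3 : (∑ j : Fin ((k + 1) / 2), if CanRaise z (lastParticle k j) then
      (if (lastParticle k j).IsWall ∧ (lastParticle k j).row < k ∧ z (lastParticle k j) = 0
        then (2 : ℝ) else 1) * g (configRow (raiseDiag z (lastParticle k j))) else 0) =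
      ∑ j : Fin ((k + 1) / 2), if configRow z + Pi.single j 1 ∈ rowSpace k
        then g (configRow z + Pi.single j 1) else 0 := by
    refine Finset.sum_congr rfl fun j _ => ?_
    rw [lastParticle_row, if_neg (c := _ ∧ k < k ∧ _) (by omega), one_mul, configRow_raiseDiag]
    simp only [canRaise_lastParticle_iff hz]
  have e4 : (∑ j : Fin ((k + 1) / 2), if CanLower z (lastParticle k j) then
      (if (lastParticle k j).IsWall ∧ (lastParticle k j).row = k ∧ z (lastParticle k j) = 1
        then (2 : ℝ) else 1) * g (configRow (lowerCol z (lastParticle k j))) else 0) =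
      ∑ j : Fin ((k + 1) / 2), if configRow z - Pi.single j 1 ∈ rowSpace k then
        (if Odd k ∧ (j : ℕ) + 1 = (k + 1) / 2 ∧ configRow z j = 1 then 2 else 1) *
          g (configRow z - Pi.single j 1) else 0 := by
    refine Finset.sum_congr rfl fun j _ => ?_
    have hw : (lastParticle k j).IsWall ↔ Odd k ∧ (j : ℕ) + 1 = (k + 1) / 2 := by
      unfold Particle.IsWall
      rw [lastParticle_idx, lastParticle_row]
      refine ⟨fun h => ⟨⟨j, by omega⟩, by omega⟩, ?_⟩
      rintro ⟨⟨m, hm⟩, h⟩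
      omega
    by_cases hc : CanLower z (lastParticle k j)
    · rw [if_pos hc, if_pos ((canLower_lastParticle_iff hz j).1 hc), configRow_lowerCol hc]
      congr 1
      refine if_congr ?_ rfl rfl
      rw [hw, lastParticle_row, configRow_apply]
      norm_cast
      tauto
    · rw [if_neg hc, if_neg (fun h => hc ((canLower_lastParticle_iff hz j).2 h))]
  rw [e1, e2, e3, e4]
  ring

end Rows

/-! ### Counting patterns with a given last row -/

section Fibers

variable {k : ℕ}

lemma le_sum_row {x : Config k} {b : Fin ((k + 1) / 2) → ℤ} (hx : IsInterlacing x)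
    (h : configRow x = b) (p : Particle k) : x p ≤ ∑ i, (b i).toNat := by
  have hb := p.bounds
  obtain ⟨q, hq1, hq2⟩ := Particle.exists_of_bounds (k := k) (i := k) (j := p.idx) (by omega)
  obtain ⟨j, rfl⟩ := exists_lastParticle hq1
  have h1 := hx.col_le (p := p) (p' := lastParticle k j) hq2.symm (by omega)
  have h2 : (b j).toNat = x (lastParticle k j) := by rw [← h, configRow_apply, Int.toNat_natCast]
  rw [← h2] at h1
  exact h1.trans (Finset.single_le_sum (f := fun i => (b i).toNat) (fun _ _ => Nat.zero_le _)
    (Finset.mem_univ j))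

lemma finite_rowFiber (b : Fin ((k + 1) / 2) → ℤ) :
    {x : Config k | IsInterlacing x ∧ configRow x = b}.Finite :=
  (Set.finite_Icc (0 : Config k) (fun _ => ∑ i, (b i).toNat)).subset fun _ hx =>
    ⟨fun _ => Nat.zero_le _, fun p => le_sum_row hx.1 hx.2 p⟩

/-- The interlacing configurations with a given last row. -/
noncomputable def rowFiber (b : Fin ((k + 1) / 2) → ℤ) : Finset (Config k) :=
  (finite_rowFiber b).toFinset

lemma mem_rowFiber {b : Fin ((k + 1) / 2) → ℤ} {x : Config k} :
    x ∈ rowFiber b ↔ IsInterlacing x ∧ configRow x = b := by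
  simp [rowFiber]

open Classical in
/-- The possible values, with sign, of an entry with given absolute value. -/
noncomputable def signChoices (y : Config k) (p : Particle k) : Finset ℤ :=
  if p.IsWall ∧ p.row < k then {(y p : ℤ), -(y p : ℤ)} else {(y p : ℤ)}

lemma natAbs_of_mem_signChoices {y : Config k} {p : Particle k} {a : ℤ}
    (h : a ∈ signChoices y p) : a.natAbs = y p := by
  unfold signChoices at h
  split_ifs at h <;> simp at h <;> omega

open Classical in
lemma card_signChoices (y : Config k) (p : Particle k) :
    (signChoices y p).card = if p.IsWall ∧ p.row < k ∧ y p ≠ 0 then 2 else 1 := by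
  unfold signChoices
  by_cases h : p.IsWall ∧ p.row < k
  · rw [if_pos h]
    by_cases h0 : y p = 0
    · rw [if_neg (by tauto)]
      simp [h0]
    · rw [if_pos (by tauto), Finset.card_pair]
      omega
  · rw [if_neg h, if_neg (by tauto), Finset.card_singleton]

/-- Patterns with last row `b` are interlacing configurations with signs for the wall entries above
the last row. -/
lemma isGTPattern_iff {b : Fin ((k + 1) / 2) → ℤ} (hb : b ∈ rowSpace k) (x : Particle k → ℤ) :
    (IsGTPattern x ∧ lastRow x = b) ↔
      ∃ y ∈ rowFiber b, ∀ p, x p ∈ signChoices y p := by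
  have hlast : ∀ j, lastRow x j = x (lastParticle k j) := fun _ => rfl
  constructor
  · rintro ⟨hx, hr⟩
    refine ⟨fun p => (x p).natAbs,
      mem_rowFiber.2 ⟨⟨fun p p' h1 h2 => ?_, fun p p' h1 h2 => ?_⟩, ?_⟩, fun p => ?_⟩
    · have := hx.lower p p' h1 h2
      rw [Int.abs_eq_natAbs, Int.abs_eq_natAbs] at this
      exact_mod_cast this
    · have := hx.upper p p' h1 h2
      rw [Int.abs_eq_natAbs, Int.abs_eq_natAbs] at this
      exact_mod_cast this
    · funext j
      have h1 := hb.2 j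
      rw [← hr, hlast] at h1 ⊢
      exact Int.natAbs_of_nonneg h1
    · unfold signChoices
      split_ifs with h
      · simp only [Finset.mem_insert, Finset.mem_singleton]
        omega
      · rw [Finset.mem_singleton]
        by_cases hw : p.IsWall
        · have hp := p.row_le
          obtain ⟨j, rfl⟩ := exists_lastParticle (P := p) (by by_contra h'; exact h ⟨hw, by omega⟩)
          have h1 := hb.2 j
          rw [← hr, hlast] at h1
          exact (Int.natAbs_of_nonneg h1).symm
        · exact (Int.natAbs_of_nonneg (hx.nonneg p hw)).symm
  · rintro ⟨y, hy, hxy⟩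
    obtain ⟨hy, hr⟩ := mem_rowFiber.1 hy
    have habs := fun p => natAbs_of_mem_signChoices (hxy p)
    have hpos : ∀ p : Particle k, ¬ (p.IsWall ∧ p.row < k) → x p = y p := by
      intro p hp
      have := hxy p
      unfold signChoices at this
      rw [if_neg hp, Finset.mem_singleton] at this
      exact this
    refine ⟨⟨fun p hp => ?_, fun p p' h1 h2 => ?_, fun p p' h1 h2 => ?_⟩, ?_⟩
    · rw [hpos p (by tauto)]; positivity
    · have := hy.col p p' h1 h2
      rw [Int.abs_eq_natAbs, Int.abs_eq_natAbs, habs, habs]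
      exact_mod_cast this
    · have := hy.diag p p' h1 h2
      rw [Int.abs_eq_natAbs, Int.abs_eq_natAbs, habs, habs]
      exact_mod_cast this
    · funext j
      rw [hlast, hpos _ (by rw [lastParticle_row]; omega), ← hr, configRow_apply]

/-- The number of Gelfand-Tsetlin patterns is the total weight of their absolute values. -/
lemma gtCount_eq {b : Fin ((k + 1) / 2) → ℤ} (hb : b ∈ rowSpace k) :
    gtCount k b = ∑ y ∈ rowFiber b, patternWeight y := by
  classical
  have h1 : {x : Particle k → ℤ | IsGTPattern x ∧ lastRow x = b} =
      ↑((rowFiber b).biUnion fun y => Fintype.piFinset (signChoices y)) := by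
    ext x
    rw [Finset.coe_biUnion]
    simp only [Set.mem_ofPred_eq, isGTPattern_iff hb, Set.mem_iUnion, Finset.mem_coe,
      Fintype.mem_piFinset, exists_prop]
  unfold gtCount
  rw [← Set.coe_ofPred, h1, Nat.card_eq_card_toFinset, Finset.toFinset_coe, Finset.card_biUnion]
  · refine Finset.sum_congr rfl fun y _ => ?_
    rw [Fintype.card_piFinset, patternWeight]
    exact Finset.prod_congr rfl fun p _ => card_signChoices y p
  · intro y _ y' _ hne
    refine Finset.disjoint_left.2 fun x hx hx' => hne ?_
    rw [Fintype.mem_piFinset] at hx hx'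
    funext p
    rw [← natAbs_of_mem_signChoices (hx p), ← natAbs_of_mem_signChoices (hx' p)]

lemma rowFiber_nonempty {b : Fin ((k + 1) / 2) → ℤ} (hb : b ∈ rowSpace k) :
    (rowFiber b).Nonempty := by
  have hlt : ∀ p : Particle k, p.idx - 1 < (k + 1) / 2 := fun p => by
    have := p.bounds
    omega
  refine ⟨fun p => (b ⟨p.idx - 1, hlt p⟩).toNat, mem_rowFiber.2 ⟨⟨fun p p' _ h => ?_,
    fun p p' _ h => ?_⟩, ?_⟩⟩
  · simp only [h, le_refl]
  · have := p.bounds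
    exact Int.toNat_le_toNat (hb.1 (Fin.le_def.2 (by simp only; omega)))
  · funext j
    rw [configRow_apply, Int.toNat_of_nonneg (hb.2 _)]
    rfl

lemma gtCount_pos {b : Fin ((k + 1) / 2) → ℤ} (hb : b ∈ rowSpace k) : 0 < gtCount k b := by
  rw [gtCount_eq hb]
  exact Finset.sum_pos (fun y _ => patternWeight_pos y) (rowFiber_nonempty hb)

end Fibers

/-! ### The generator of the last row -/

section Generator

variable {k : ℕ}

lemma mem_neighbours {r : ℕ} {l b : Fin r → ℤ} :
    b ∈ neighbours l ↔ ∃ i, b = l + Pi.single i 1 ∨ b = l - Pi.single i 1 := by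
  unfold neighbours
  simp only [Finset.mem_union, Finset.mem_image, Finset.mem_univ, true_and, exists_or,
    eq_comm (a := b)]

lemma mem_neighbours_comm {r : ℕ} {l b : Fin r → ℤ} : b ∈ neighbours l ↔ l ∈ neighbours b := by
  simp only [mem_neighbours]
  constructor <;>
  · rintro ⟨i, rfl | rfl⟩
    · exact ⟨i, Or.inr (by simp)⟩
    · exact ⟨i, Or.inl (by simp)⟩

lemma self_notMem_neighbours {r : ℕ} (l : Fin r → ℤ) : l ∉ neighbours l := by
  rw [mem_neighbours]
  rintro ⟨i, h | h⟩
  · have := congrFun h i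
    rw [Pi.add_apply, Pi.single_eq_same] at this
    omega
  · have := congrFun h i
    rw [Pi.sub_apply, Pi.single_eq_same] at this
    omega

lemma sum_neighbours {r : ℕ} (l : Fin r → ℤ) (f : (Fin r → ℤ) → ℝ) :
    ∑ b ∈ neighbours l, f b =
      (∑ i, f (l + Pi.single i 1)) + ∑ i, f (l - Pi.single i 1) := by
  classical
  have hinj : Function.Injective fun i : Fin r => (Pi.single i 1 : Fin r → ℤ) := by
    intro i j h
    by_contra hne
    have := congrFun h i
    simp [Pi.single_eq_of_ne hne] at this
  have h1 : neighbours l = Finset.univ.image (fun i => l + Pi.single i 1) ∪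
      Finset.univ.image (fun i => l - Pi.single i 1) := by
    ext b
    simp only [mem_neighbours, Finset.mem_union, Finset.mem_image, Finset.mem_univ, true_and,
      exists_or, eq_comm (a := b)]
  rw [h1, Finset.sum_union, Finset.sum_image, Finset.sum_image]
  · exact fun i _ j _ h => hinj (sub_right_injective h)
  · exact fun i _ j _ h => hinj (add_right_injective _ h)
  · rw [Finset.disjoint_left]
    intro b h1 h2
    simp only [Finset.mem_image, Finset.mem_univ, true_and] at h1 h2
    obtain ⟨i, rfl⟩ := h1
    obtain ⟨j, h⟩ := h2
    have := congrArg (fun f => ∑ t, f t) h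
    simp [Finset.sum_add_distrib, Finset.sum_sub_distrib] at this
    omega

open Classical in
/-- The factor `2` for the jump of the last particle of an odd row from `0` to `1`. -/
noncomputable def reflectionFactor (k : ℕ) (l b : Fin ((k + 1) / 2) → ℤ) : ℝ :=
  if Odd k ∧ ∃ i : Fin ((k + 1) / 2), (i : ℕ) + 1 = (k + 1) / 2 ∧ l i = 0 ∧ b i = 1 then 2 else 1

lemma rowRate_eq {l b : Fin ((k + 1) / 2) → ℤ} (hb : b ∈ rowSpace k) :
    rowRate k l b = reflectionFactor k l b * (gtCount k b / gtCount k l) := by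
  unfold rowRate reflectionFactor
  rw [if_pos hb]

lemma reflectionFactor_add (b : Fin ((k + 1) / 2) → ℤ) (j : Fin ((k + 1) / 2)) :
    reflectionFactor k (b + Pi.single j 1) b = 1 := by
  unfold reflectionFactor
  rw [if_neg]
  rintro ⟨-, i, -, h1, h2⟩
  rw [Pi.add_apply, h2] at h1
  have : (0 : ℤ) ≤ (Pi.single j 1 : Fin ((k + 1) / 2) → ℤ) i := by
    rw [Pi.single_apply]; split_ifs <;> norm_num
  omega

open Classical in
lemma reflectionFactor_sub (b : Fin ((k + 1) / 2) → ℤ) (j : Fin ((k + 1) / 2)) :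
    reflectionFactor k (b - Pi.single j 1) b =
      if Odd k ∧ (j : ℕ) + 1 = (k + 1) / 2 ∧ b j = 1 then 2 else 1 := by
  unfold reflectionFactor
  refine if_congr (and_congr_right fun _ => ⟨?_, ?_⟩) rfl rfl
  · rintro ⟨i, h1, h2, h3⟩
    have hij : i = j := by
      by_contra hne
      rw [Pi.sub_apply, Pi.single_eq_of_ne hne] at h2
      omega
    exact hij ▸ ⟨h1, h3⟩
  · rintro ⟨h1, h2⟩
    exact ⟨j, h1, by rw [Pi.sub_apply, Pi.single_eq_same, h2]; rfl, h2⟩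

open Classical in
/-- The intertwining relation as a sum over the neighbours of the last row. -/
lemma sum_preds_move_neighbours {z : Config k} (hz : IsInterlacing z)
    (g : (Fin ((k + 1) / 2) → ℤ) → ℝ) :
    ∑ c : Particle k × Direction, ∑ x ∈ preds z with move x c = z,
        g (configRow x) * patternWeight x =
      patternWeight z * (holdRate k (configRow z) * g (configRow z) +
        ∑ l ∈ neighbours (configRow z) with l ∈ rowSpace k,
          reflectionFactor k l (configRow z) * g l) := by
  rw [sum_preds_move hz, Finset.sum_filter, sum_neighbours, ← add_assoc]
  simp only [reflectionFactor_add, reflectionFactor_sub, one_mul]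

open Classical in
/-- A move changes at most one entry of the last row: otherwise the right-hand side of the
intertwining relation, for the indicator function of the old row, would vanish. -/
lemma configRow_move_mem {x : Config k} (hx : IsInterlacing x) (c : Particle k × Direction) :
    configRow (move x c) ∈ insert (configRow x) (neighbours (configRow x)) := by
  have hz := hx.move c
  have h := sum_preds_move_neighbours hz (fun l => if l = configRow x then 1 else 0)
  by_contra hc
  rw [Finset.mem_insert, mem_neighbours_comm, not_or] at hc
  rw [if_neg hc.1, mul_zero, zero_add, Finset.sum_eq_zero (s := Finset.filter _ _), mul_zero] at h
  · have h1 : ∀ c' : Particle k × Direction, ∀ y : Config k,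
        (0 : ℝ) ≤ (if configRow y = configRow x then 1 else 0) * patternWeight y := by
      intro c' y
      split_ifs <;> positivity
    rw [Finset.sum_eq_zero_iff_of_nonneg fun c' _ => Finset.sum_nonneg fun y _ => h1 c' y] at h
    have h2 := h c (Finset.mem_univ _)
    rw [Finset.sum_eq_zero_iff_of_nonneg fun y _ => h1 c y] at h2
    have h3 := h2 x (Finset.mem_filter.2 ⟨mem_preds_of_move hx rfl, rfl⟩)
    rw [if_pos rfl, one_mul] at h3
    have := patternWeight_pos x
    norm_cast at h3
    omega
  · intro l hl
    rw [Finset.mem_filter] at hl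
    rw [if_neg (by rintro rfl; exact hc.2 hl.1), mul_zero]

/-- The intertwining relation for the indicator function of the row exhibits `holdRate` as a sum of
non-negative terms. -/
lemma holdRate_nonneg {b : Fin ((k + 1) / 2) → ℤ} (hb : b ∈ rowSpace k) : 0 ≤ holdRate k b := by
  classical
  obtain ⟨z, hz⟩ := rowFiber_nonempty hb
  obtain ⟨hzi, rfl⟩ := mem_rowFiber.1 hz
  have h := sum_preds_move_neighbours hzi (fun l => if l = configRow z then 1 else 0)
  rw [if_pos rfl, mul_one, Finset.sum_eq_zero (s := Finset.filter _ _), add_zero] at h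
  · have h1 : (0 : ℝ) ≤ patternWeight z * holdRate k (configRow z) := by
      rw [← h]
      refine Finset.sum_nonneg fun c _ => Finset.sum_nonneg fun y _ => ?_
      split_ifs <;> positivity
    exact nonneg_of_mul_nonneg_right h1 (by exact_mod_cast patternWeight_pos z)
  · intro l hl
    rw [Finset.mem_filter] at hl
    rw [if_neg (by rintro rfl; exact self_notMem_neighbours _ hl.1), mul_zero]

/-- The number of clocks. -/
noncomputable def clockCount (k : ℕ) : ℕ := Fintype.card (Particle k × Direction)

open Classical in
/-- Summing the intertwining relation over the target configuration gives the eigenvalue equation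
for the numbers of patterns. -/
lemma sum_neighbours_gtCount {l : Fin ((k + 1) / 2) → ℤ} (hl : l ∈ rowSpace k) :
    holdRate k l * gtCount k l +
      ∑ b ∈ neighbours l with b ∈ rowSpace k, reflectionFactor k l b * gtCount k b =
      clockCount k * gtCount k l := by
  set T : Finset (Fin ((k + 1) / 2) → ℤ) := insert l ((neighbours l).filter (· ∈ rowSpace k))
    with hT
  have hTW : ∀ b ∈ T, b ∈ rowSpace k := by
    intro b hb
    rw [hT, Finset.mem_insert, Finset.mem_filter] at hb
    rcases hb with rfl | hb
    · exact hl
    · exact hb.2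
  set Z : Finset (Config k) := T.biUnion rowFiber with hZ
  have hdisj : Set.PairwiseDisjoint (T : Set (Fin ((k + 1) / 2) → ℤ)) (rowFiber (k := k)) := by
    intro b _ b' _ hne
    refine Finset.disjoint_left.2 fun x hx hx' => hne ?_
    rw [← (mem_rowFiber.1 hx).2, ← (mem_rowFiber.1 hx').2]
  have hsum : ∀ b ∈ T, (gtCount k b : ℝ) = ∑ y ∈ rowFiber b, (patternWeight y : ℝ) := by
    intro b hb
    rw [gtCount_eq (hTW b hb)]
    push_cast
    rfl
  have hmaps : ∀ c : Particle k × Direction, ∀ x ∈ rowFiber l, move x c ∈ Z := by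
    intro c x hx
    obtain ⟨hxi, rfl⟩ := mem_rowFiber.1 hx
    rw [hZ, Finset.mem_biUnion]
    refine ⟨configRow (move x c), ?_, mem_rowFiber.2 ⟨hxi.move c, rfl⟩⟩
    have := configRow_move_mem hxi c
    rw [Finset.mem_insert] at this
    rw [hT, Finset.mem_insert, Finset.mem_filter]
    exact this.imp_right fun h => ⟨h, configRow_mem_rowSpace (hxi.move c)⟩
  have hL : ∑ z ∈ Z, ∑ c : Particle k × Direction, ∑ x ∈ preds z with move x c = z,
      (if configRow x = l then (1 : ℝ) else 0) * patternWeight x =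
      clockCount k * gtCount k l := by
    rw [Finset.sum_comm, clockCount, ← Finset.card_univ, ← nsmul_eq_mul, ← Finset.sum_const]
    refine Finset.sum_congr rfl fun c _ => ?_
    rw [hsum l (Finset.mem_insert_self _ _), ← Finset.sum_fiberwise_of_maps_to (hmaps c)]
    refine Finset.sum_congr rfl fun z hz => ?_
    simp_rw [ite_mul, one_mul, zero_mul]
    rw [← Finset.sum_filter, Finset.filter_filter]
    refine Finset.sum_congr ?_ fun _ _ => rfl
    ext x
    rw [Finset.mem_filter, Finset.mem_filter, mem_rowFiber]
    constructor
    · rintro ⟨h1, h2, h3⟩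
      exact ⟨⟨(mem_preds.1 h1).1, h3⟩, h2⟩
    · rintro ⟨⟨h1, h2⟩, h3⟩
      exact ⟨mem_preds_of_move h1 h3, h3, h2⟩
  have hR : ∑ z ∈ Z, ∑ c : Particle k × Direction, ∑ x ∈ preds z with move x c = z,
      (if configRow x = l then (1 : ℝ) else 0) * patternWeight x =
      ∑ b ∈ T, gtCount k b * (holdRate k b * (if b = l then 1 else 0) +
        ∑ l' ∈ neighbours b with l' ∈ rowSpace k,
          reflectionFactor k l' b * (if l' = l then 1 else 0)) := by
    rw [hZ, Finset.sum_biUnion hdisj]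
    refine Finset.sum_congr rfl fun b hb => ?_
    rw [hsum b hb, Finset.sum_mul]
    refine Finset.sum_congr rfl fun z hz => ?_
    obtain ⟨hzi, rfl⟩ := mem_rowFiber.1 hz
    exact sum_preds_move_neighbours hzi fun l' => if l' = l then 1 else 0
  rw [hL] at hR
  rw [hR, hT, Finset.sum_insert (by simp [self_notMem_neighbours])]
  congr 1
  · rw [if_pos rfl, Finset.sum_eq_zero]
    · ring
    · intro l' hl'
      rw [Finset.mem_filter] at hl'
      rw [if_neg (by rintro rfl; exact self_notMem_neighbours _ hl'.1), mul_zero]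
  · refine Finset.sum_congr rfl fun b hb => ?_
    rw [Finset.mem_filter] at hb
    rw [if_neg (by rintro rfl; exact self_notMem_neighbours _ hb.1), mul_zero, zero_add,
      Finset.sum_eq_single l]
    · rw [if_pos rfl]; ring
    · intro l' _ hne
      rw [if_neg hne, mul_zero]
    · intro h
      exact absurd (Finset.mem_filter.2 ⟨mem_neighbours_comm.1 hb.1, hl⟩) h

lemma sum_rowRate {l : Fin ((k + 1) / 2) → ℤ} (hl : l ∈ rowSpace k) :
    ∑ b ∈ neighbours l, rowRate k l b = clockCount k - holdRate k l := by
  classical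
  have h1 := sum_neighbours_gtCount hl
  have h2 : (gtCount k l : ℝ) ≠ 0 := by exact_mod_cast (gtCount_pos hl).ne'
  have h3 : ∑ b ∈ neighbours l, rowRate k l b =
      (∑ b ∈ neighbours l with b ∈ rowSpace k, reflectionFactor k l b * gtCount k b) /
        gtCount k l := by
    rw [Finset.sum_filter, Finset.sum_div]
    refine Finset.sum_congr rfl fun b _ => ?_
    by_cases hb : b ∈ rowSpace k
    · rw [if_pos hb, rowRate_eq hb]; ring
    · rw [if_neg hb, zero_div]
      exact if_neg hb
  rw [h3, div_eq_iff h2]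
  linarith

lemma rowRate_nonneg (l b : Fin ((k + 1) / 2) → ℤ) : 0 ≤ rowRate k l b := by
  unfold rowRate
  split_ifs <;> positivity

lemma rowGenerator_self (l : rowSpace k) :
    rowGenerator k l l = holdRate k l - clockCount k := by
  unfold rowGenerator
  rw [if_neg (self_notMem_neighbours _), if_pos rfl, sum_rowRate l.2]
  ring

lemma rowGenerator_of_mem {l b : rowSpace k} (h : (b : Fin ((k + 1) / 2) → ℤ) ∈ neighbours l.1) :
    rowGenerator k l b = reflectionFactor k l b * (gtCount k b.1 / gtCount k l.1) := by
  unfold rowGenerator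
  rw [if_pos h, rowRate_eq b.2]

lemma rowGenerator_nonneg {l b : rowSpace k} (h : b ≠ l) : 0 ≤ rowGenerator k l b := by
  unfold rowGenerator
  split_ifs
  · exact rowRate_nonneg _ _
  · exact le_rfl

lemma neg_clockCount_le_rowGenerator_self (l : rowSpace k) :
    -(clockCount k : ℝ) ≤ rowGenerator k l l := by
  rw [rowGenerator_self]
  linarith [holdRate_nonneg l.2]

open Classical in
/-- A row and its neighbours among the possible rows. -/
noncomputable def rowBall (b : rowSpace k) : Finset (rowSpace k) :=
  (insert (b : Fin ((k + 1) / 2) → ℤ) (neighbours b.1)).subtype (· ∈ rowSpace k)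

lemma mem_rowBall {b l : rowSpace k} : l ∈ rowBall b ↔ l = b ∨ l.1 ∈ neighbours b.1 := by
  classical
  unfold rowBall
  rw [Finset.mem_subtype, Finset.mem_insert, Subtype.ext_iff]

lemma rowGenerator_eq_zero {l b : rowSpace k} (h : b ∉ rowBall l) : rowGenerator k l b = 0 := by
  rw [mem_rowBall, not_or] at h
  unfold rowGenerator
  rw [if_neg h.2, if_neg h.1]

lemma mem_rowBall_comm {b l : rowSpace k} : l ∈ rowBall b ↔ b ∈ rowBall l := by
  rw [mem_rowBall, mem_rowBall, mem_neighbours_comm, eq_comm]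

open Classical in
lemma sum_rowBall (b : rowSpace k) (f : rowSpace k → ℝ) :
    ∑ l ∈ rowBall b, f l = f b +
      ∑ l ∈ neighbours b.1, if h : l ∈ rowSpace k then f ⟨l, h⟩ else 0 := by
  have h0 : ∀ l : rowSpace k, f l = (fun l' : Fin ((k + 1) / 2) → ℤ =>
      if h : l' ∈ rowSpace k then f ⟨l', h⟩ else 0) l := fun l => by
    simp only
    rw [dif_pos l.2]
  rw [Finset.sum_congr rfl fun l _ => h0 l, rowBall, Finset.sum_subtype_eq_sum_filter
      (f := fun l' => if h : l' ∈ rowSpace k then f ⟨l', h⟩ else 0),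
    Finset.sum_filter, Finset.sum_insert (self_notMem_neighbours _), if_pos b.2, dif_pos b.2]
  congr 1
  refine Finset.sum_congr rfl fun l _ => ?_
  split_ifs <;> rfl

/-- The rows of the generator sum to zero. -/
lemma sum_rowGenerator (l : rowSpace k) : ∑ b ∈ rowBall l, rowGenerator k l b = 0 := by
  classical
  rw [sum_rowBall, rowGenerator_self]
  have h : ∑ b ∈ neighbours l.1, (if h : b ∈ rowSpace k then rowGenerator k l ⟨b, h⟩ else 0) =
      ∑ b ∈ neighbours l.1, rowRate k l b := by
    refine Finset.sum_congr rfl fun b hb => ?_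
    by_cases hW : b ∈ rowSpace k
    · rw [dif_pos hW]
      exact if_pos hb
    · rw [dif_neg hW]
      exact (if_neg hW).symm
  rw [h, sum_rowRate l.2]
  ring

open Classical in
/-- The intertwining relation in terms of the generator: a measure on rows is spread over the
interlacing configurations proportionally to the weights, and one ring of a random clock acts on
it through the generator of the last row. -/
lemma sum_preds_move_rowGenerator {z : Config k} (hz : IsInterlacing z) (u : rowSpace k → ℝ) :
    ∑ c : Particle k × Direction, ∑ x ∈ preds z with move x c = z,
        (if h : configRow x ∈ rowSpace k then u ⟨configRow x, h⟩ / gtCount k (configRow x) else 0) *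
          patternWeight x =
      patternWeight z / gtCount k (configRow z) *
        (clockCount k * u ⟨configRow z, configRow_mem_rowSpace hz⟩ +
          ∑ l ∈ rowBall ⟨configRow z, configRow_mem_rowSpace hz⟩,
            u l * rowGenerator k l ⟨configRow z, configRow_mem_rowSpace hz⟩) := by
  have hW := configRow_mem_rowSpace hz
  set b : rowSpace k := ⟨configRow z, hW⟩ with hb
  have hs : (gtCount k (configRow z) : ℝ) ≠ 0 := by exact_mod_cast (gtCount_pos hW).ne'
  refine (sum_preds_move_neighbours hz fun l =>
    if h : l ∈ rowSpace k then u ⟨l, h⟩ / gtCount k l else 0).trans ?_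
  rw [dif_pos hW, sum_rowBall, rowGenerator_self, Finset.sum_filter, div_mul_eq_mul_div,
    mul_div_assoc]
  congr 1
  rw [add_div, add_div, ← hb, add_left_comm]
  have h1 : ∑ l ∈ neighbours (configRow z), (if l ∈ rowSpace k then
      reflectionFactor k l (configRow z) *
        (if h : l ∈ rowSpace k then u ⟨l, h⟩ / gtCount k l else 0) else 0) =
      (∑ l ∈ neighbours b.1, if h : l ∈ rowSpace k then u ⟨l, h⟩ * rowGenerator k ⟨l, h⟩ b
        else 0) / gtCount k (configRow z) := by
    rw [Finset.sum_div]
    refine Finset.sum_congr rfl fun l hl => ?_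
    by_cases h : l ∈ rowSpace k
    · rw [if_pos h, dif_pos h, dif_pos h, rowGenerator_of_mem (mem_neighbours_comm.1 hl)]
      field_simp
      simp only [hb]
      field_simp
    · rw [if_neg h, dif_neg h, zero_div]
  rw [h1]
  ring

end Generator

/-! ### Exponentials of bounded generators -/

section Exponential

variable {B : Type*} [NormedRing B]

lemma norm_pow_le_of_le {M : ℝ} {x : B} (h1 : ‖(1 : B)‖ ≤ 1) (hx : ‖x‖ ≤ M) (m : ℕ) :
    ‖x ^ m‖ ≤ M ^ m := by
  induction m with
  | zero => simpa using h1
  | succ m ih =>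
    rw [pow_succ, pow_succ]
    exact (norm_mul_le _ _).trans (mul_le_mul ih hx (norm_nonneg _) ((norm_nonneg _).trans ih))

lemma norm_pow_sub_pow_le {M : ℝ} {x y : B} (h1 : ‖(1 : B)‖ ≤ 1) (hM : 1 ≤ M) (hx : ‖x‖ ≤ M)
    (hy : ‖y‖ ≤ M) (m : ℕ) : ‖x ^ m - y ^ m‖ ≤ m * M ^ m * ‖x - y‖ := by
  induction m with
  | zero => simp
  | succ m ih =>
    have e : x ^ (m + 1) - y ^ (m + 1) = x ^ m * (x - y) + (x ^ m - y ^ m) * y := by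
      rw [pow_succ, pow_succ]; noncomm_ring
    have h2 : ‖x ^ m * (x - y)‖ ≤ M ^ (m + 1) * ‖x - y‖ := by
      refine (norm_mul_le _ _).trans (mul_le_mul_of_nonneg_right ?_ (norm_nonneg _))
      exact (norm_pow_le_of_le h1 hx m).trans (pow_le_pow_right₀ hM (Nat.le_succ m))
    have h3 : ‖(x ^ m - y ^ m) * y‖ ≤ m * M ^ (m + 1) * ‖x - y‖ := by
      refine (norm_mul_le _ _).trans ?_
      calc ‖x ^ m - y ^ m‖ * ‖y‖ ≤ (m * M ^ m * ‖x - y‖) * M :=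
            mul_le_mul ih hy (norm_nonneg _) (by positivity)
        _ = m * M ^ (m + 1) * ‖x - y‖ := by ring
    rw [e]
    refine (norm_add_le _ _).trans ((add_le_add h2 h3).trans (le_of_eq ?_))
    push_cast
    ring

variable [NormedAlgebra ℝ B] [CompleteSpace B]

/-- Euler's approximation of the exponential. Both `1 + a L` and `exp (a L)` have norm at most
`1 + a (‖L‖ + 1)` for small `a`, and they differ by `o(a)`. -/
lemma tendsto_one_add_smul_pow (h1 : ‖(1 : B)‖ ≤ 1) (L : B) {a : ℕ → ℝ} {m : ℕ → ℕ} {t : ℝ}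
    (ha : ∀ n, 0 < a n) (ha0 : Tendsto a atTop (𝓝 0))
    (hm : Tendsto (fun n => m n * a n) atTop (𝓝 t)) :
    Tendsto (fun n => (1 + a n • L) ^ m n) atTop (𝓝 (NormedSpace.exp (t • L))) := by
  let _ : NormedAlgebra ℚ B := NormedAlgebra.restrictScalars ℚ ℝ B
  have hexp : Tendsto (fun n => NormedSpace.exp (a n • L) ^ m n) atTop
      (𝓝 (NormedSpace.exp (t • L))) := by
    have h : ∀ n, NormedSpace.exp (a n • L) ^ m n = NormedSpace.exp ((m n * a n) • L) := by
      intro n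
      rw [← NormedSpace.exp_nsmul, mul_smul, Nat.cast_smul_eq_nsmul]
    simp_rw [h]
    exact (NormedSpace.exp_continuous.tendsto _).comp (hm.smul_const L)
  have hder := (hasDerivAt_exp_smul_const (𝕂 := ℝ) L (0 : ℝ)).isLittleO
  have hlit : (fun n => NormedSpace.exp (a n • L) - (1 + a n • L)) =o[atTop] a := by
    have := hder.comp_tendsto ha0
    refine this.congr (fun n => ?_) (fun n => ?_)
    · simp [sub_sub]
    · simp
  set K := ‖L‖ + 1 with hK
  have hdiff : Tendsto (fun n => (1 + a n • L) ^ m n - NormedSpace.exp (a n • L) ^ m n) atTop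
      (𝓝 0) := by
    rw [tendsto_zero_iff_norm_tendsto_zero]
    have hsmall : Tendsto (fun n => ‖NormedSpace.exp (a n • L) - (1 + a n • L)‖ / a n) atTop
        (𝓝 0) := by
      have := hlit.norm_left.tendsto_div_nhds_zero
      exact this
    have hbound : Tendsto (fun n => (m n * a n) * Real.exp (K * (m n * a n)) *
        (‖NormedSpace.exp (a n • L) - (1 + a n • L)‖ / a n)) atTop (𝓝 0) := by
      have h2 : Tendsto (fun n => (m n * a n) * Real.exp (K * (m n * a n))) atTop
          (𝓝 (t * Real.exp (K * t))) :=
        hm.mul ((Real.continuous_exp.tendsto _).comp (hm.const_mul K))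
      simpa using h2.mul hsmall
    refine squeeze_zero' (Eventually.of_forall fun n => norm_nonneg _) ?_ hbound
    filter_upwards [hlit.bound (show (0 : ℝ) < 1 by norm_num)] with n hn
    have han := ha n
    rw [one_mul, Real.norm_eq_abs, abs_of_pos han] at hn
    have hx : ‖1 + a n • L‖ ≤ 1 + a n * K := by
      refine (norm_add_le _ _).trans ?_
      rw [norm_smul, Real.norm_eq_abs, abs_of_pos han, hK]
      nlinarith
    have hx' : ‖1 + a n • L‖ ≤ 1 + a n * ‖L‖ := by
      refine (norm_add_le _ _).trans ?_
      rw [norm_smul, Real.norm_eq_abs, abs_of_pos han]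
      linarith
    have hy : ‖NormedSpace.exp (a n • L)‖ ≤ 1 + a n * K := by
      have : NormedSpace.exp (a n • L) =
          (NormedSpace.exp (a n • L) - (1 + a n • L)) + (1 + a n • L) := by abel
      rw [this]
      refine (norm_add_le _ _).trans ?_
      rw [hK]
      linarith
    have hK0 : 0 ≤ K := by positivity
    refine (norm_pow_sub_pow_le h1 (by nlinarith) hx hy (m n)).trans ?_
    have hM : (1 + a n * K) ^ m n ≤ Real.exp (K * (m n * a n)) := by
      have h3 : 1 + a n * K ≤ Real.exp (a n * K) := by
        have := Real.add_one_le_exp (a n * K); linarith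
      refine (pow_le_pow_left₀ (by positivity) h3 _).trans (le_of_eq ?_)
      rw [← Real.exp_nat_mul]
      ring_nf
    rw [norm_sub_rev]
    calc (m n : ℝ) * (1 + a n * K) ^ m n * ‖NormedSpace.exp (a n • L) - (1 + a n • L)‖
        ≤ m n * Real.exp (K * (m n * a n)) * ‖NormedSpace.exp (a n • L) - (1 + a n • L)‖ := by
          gcongr
      _ = _ := by field_simp
  simpa using hdiff.add hexp

end Exponential

/-! ### Operators on summable functions -/

section SummableFunctions

/-- The summable real functions on `S`: finite signed measures on a countable set. -/
abbrev L1 (S : Type*) : Type _ := lp (fun _ : S => ℝ) 1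

variable {S : Type*}

open Classical in
/-- The unit mass at a point. -/
noncomputable def unitMass (x : S) : L1 S := lp.single 1 x 1

lemma unitMass_self (x : S) : unitMass x x = 1 := by
  classical
  exact lp.single_apply_self _ _ _

lemma unitMass_ne {x y : S} (h : y ≠ x) : unitMass x y = 0 := by
  classical
  exact lp.single_apply_ne _ _ _ h

lemma norm_unitMass (x : S) : ‖unitMass x‖ = 1 := by
  classical
  unfold unitMass
  rw [lp.norm_single (by norm_num)]
  simp

lemma hasSum_smul_unitMass (u : L1 S) : HasSum (fun x => u x • unitMass x) u := by
  classical
  have := lp.hasSum_single (p := 1) (by norm_num) u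
  convert this using 2 with x
  unfold unitMass
  rw [← lp.single_smul]
  simp

lemma summable_norm_L1 (u : L1 S) : Summable fun x => ‖u x‖ := by
  simpa using u.2.summable

lemma summable_norm_smul {F : Type*} [NormedAddCommGroup F] [NormedSpace ℝ F] {κ : S → F} {C : ℝ}
    (hκ : ∀ x, ‖κ x‖ ≤ C) (u : L1 S) : Summable fun x => ‖u x • κ x‖ := by
  refine Summable.of_nonneg_of_le (fun _ => norm_nonneg _) (fun x => ?_)
    ((summable_norm_L1 u).mul_right C)
  rw [norm_smul]
  exact mul_le_mul_of_nonneg_left (hκ x) (norm_nonneg _)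

/-- The operator on summable functions that maps the unit mass at `x` to `κ x`. -/
noncomputable def kernelOp (κ : S → L1 S) (C : ℝ) (hκ : ∀ x, ‖κ x‖ ≤ C) : L1 S →L[ℝ] L1 S :=
  LinearMap.mkContinuous
    { toFun := fun u => ∑' x, u x • κ x
      map_add' := fun u v => by
        rw [← ((summable_norm_smul hκ u).of_norm).tsum_add ((summable_norm_smul hκ v).of_norm)]
        refine tsum_congr fun x => ?_
        rw [lp.coeFn_add, Pi.add_apply, add_smul]
      map_smul' := fun c u => by
        rw [RingHom.id_apply, ← ((summable_norm_smul hκ u).of_norm).tsum_const_smul]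
        refine tsum_congr fun x => ?_
        rw [lp.coeFn_smul, Pi.smul_apply, smul_smul, smul_eq_mul] }
    C fun u => by
      have h1 := norm_tsum_le_tsum_norm (summable_norm_smul hκ u)
      refine h1.trans ?_
      have h2 : ‖u‖ = ∑' x, ‖u x‖ := by
        rw [lp.norm_eq_tsum_rpow (by norm_num)]
        simp
      rw [h2, ← tsum_mul_left]
      refine (summable_norm_smul hκ u).tsum_le_tsum (fun x => ?_)
        ((summable_norm_L1 u).mul_left C)
      rw [norm_smul, mul_comm]
      exact mul_le_mul_of_nonneg_right (hκ x) (norm_nonneg _)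

lemma kernelOp_apply {κ : S → L1 S} {C : ℝ} (hκ : ∀ x, ‖κ x‖ ≤ C) (u : L1 S) (y : S) :
    kernelOp κ C hκ u y = ∑' x, u x * κ x y := by
  change (∑' x, u x • κ x : L1 S) y = _
  have h := ((summable_norm_smul hκ u).of_norm).hasSum
  have h2 := h.mapL (lp.evalCLM ℝ (fun _ : S => ℝ) 1 y)
  exact h2.tsum_eq.symm

lemma eval_hasSum {ι : Type*} {f : ι → L1 S} {a : L1 S} (h : HasSum f a) (y : S) :
    HasSum (fun i => f i y) (a y) := h.mapL (lp.evalCLM ℝ (fun _ : S => ℝ) 1 y)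

lemma tendsto_eval {ι : Type*} {l : Filter ι} {f : ι → L1 S} {a : L1 S} (h : Tendsto f l (𝓝 a))
    (y : S) : Tendsto (fun i => f i y) l (𝓝 (a y)) :=
  ((lp.evalCLM ℝ (fun _ : S => ℝ) 1 y).continuous.tendsto a).comp h

lemma totalMass_unitMass (x : S) : lp.tsumCLM ℝ S ℝ (unitMass x) = 1 := by
  have h : HasSum (fun y => unitMass x y) (unitMass x x) :=
    hasSum_single (f := fun y => unitMass x y) x fun y hy => unitMass_ne hy
  rw [unitMass_self] at h
  exact h.tsum_eq

lemma norm_one_le : ‖(1 : L1 S →L[ℝ] L1 S)‖ ≤ 1 := ContinuousLinearMap.norm_id_le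

end SummableFunctions

/-! ### The semigroup of the last row -/

section Semigroup

variable {k : ℕ}

/-- The row `l` of the generator as a summable function. -/
noncomputable def generatorRow (l : rowSpace k) : L1 (rowSpace k) :=
  ∑ b ∈ rowBall l, rowGenerator k l b • unitMass b

lemma generatorRow_apply (l b : rowSpace k) : generatorRow l b = rowGenerator k l b := by
  unfold generatorRow
  rw [lp.coeFn_sum, Finset.sum_apply]
  simp_rw [lp.coeFn_smul, Pi.smul_apply, smul_eq_mul]
  by_cases hb : b ∈ rowBall l
  · rw [Finset.sum_eq_single b (fun c _ hc => by rw [unitMass_ne hc.symm, mul_zero])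
      (fun h => absurd hb h), unitMass_self, mul_one]
  · rw [rowGenerator_eq_zero hb, Finset.sum_eq_zero]
    intro c hc
    rw [unitMass_ne (by rintro rfl; exact hb hc), mul_zero]

lemma norm_generatorRow_le (l : rowSpace k) : ‖generatorRow l‖ ≤ 2 * clockCount k := by
  classical
  have hl : l ∈ rowBall l := mem_rowBall.2 (Or.inl rfl)
  unfold generatorRow
  refine (norm_sum_le _ _).trans ?_
  simp_rw [norm_smul, norm_unitMass, mul_one, Real.norm_eq_abs]
  have h1 := sum_rowGenerator l
  rw [← Finset.add_sum_erase _ _ hl] at h1 ⊢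
  have h2 : ∑ b ∈ (rowBall l).erase l, |rowGenerator k l b| =
      ∑ b ∈ (rowBall l).erase l, rowGenerator k l b :=
    Finset.sum_congr rfl fun b hb => abs_of_nonneg (rowGenerator_nonneg (Finset.ne_of_mem_erase hb))
  have h3 : 0 ≤ ∑ b ∈ (rowBall l).erase l, rowGenerator k l b :=
    Finset.sum_nonneg fun b hb => rowGenerator_nonneg (Finset.ne_of_mem_erase hb)
  rw [h2, abs_of_nonpos (by linarith)]
  linarith [neg_clockCount_le_rowGenerator_self l]

/-- The generator of the last row, acting on summable functions (from the right). -/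
noncomputable def generatorOp (k : ℕ) : L1 (rowSpace k) →L[ℝ] L1 (rowSpace k) :=
  kernelOp generatorRow (2 * clockCount k) norm_generatorRow_le

lemma generatorOp_apply (u : L1 (rowSpace k)) (b : rowSpace k) :
    generatorOp k u b = ∑ l ∈ rowBall b, u l * rowGenerator k l b := by
  unfold generatorOp
  rw [kernelOp_apply, tsum_eq_sum (s := rowBall b)]
  · exact Finset.sum_congr rfl fun l _ => by rw [generatorRow_apply]
  · intro l hl
    rw [generatorRow_apply, rowGenerator_eq_zero (by rwa [mem_rowBall_comm]), mul_zero]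

lemma generatorOp_unitMass (l b : rowSpace k) :
    generatorOp k (unitMass l) b = rowGenerator k l b := by
  rw [generatorOp_apply]
  by_cases hl : l ∈ rowBall b
  · rw [Finset.sum_eq_single l (fun c _ hc => by rw [unitMass_ne hc, zero_mul])
      (fun h => absurd hl h), unitMass_self, one_mul]
  · rw [rowGenerator_eq_zero (by rwa [mem_rowBall_comm]), Finset.sum_eq_zero]
    intro c hc
    rw [unitMass_ne (by rintro rfl; exact hl hc), zero_mul]

/-- One step of the discrete approximation: jumps occur at `a` times their rates. -/
noncomputable def eulerOp (k : ℕ) (a : ℝ) : L1 (rowSpace k) →L[ℝ] L1 (rowSpace k) :=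
  1 + a • generatorOp k

lemma eulerOp_apply (a : ℝ) (u : L1 (rowSpace k)) (b : rowSpace k) :
    eulerOp k a u b = u b + a * ∑ l ∈ rowBall b, u l * rowGenerator k l b := by
  rw [← generatorOp_apply]
  rfl

lemma eulerOp_nonneg {a : ℝ} (ha : 0 ≤ a) (ha' : a * clockCount k ≤ 1) {u : L1 (rowSpace k)}
    (hu : ∀ l, 0 ≤ u l) (b : rowSpace k) : 0 ≤ eulerOp k a u b := by
  classical
  rw [eulerOp_apply, ← Finset.add_sum_erase _ _ (mem_rowBall.2 (Or.inl (rfl : b = b)))]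
  have h1 : 0 ≤ ∑ l ∈ (rowBall b).erase b, u l * rowGenerator k l b :=
    Finset.sum_nonneg fun l hl =>
      mul_nonneg (hu l) (rowGenerator_nonneg (Finset.ne_of_mem_erase hl).symm)
  have h2 := neg_clockCount_le_rowGenerator_self b
  have h3 : 0 ≤ 1 + a * rowGenerator k b b := by nlinarith
  have h4 := mul_nonneg (hu b) h3
  have h5 := mul_nonneg ha h1
  nlinarith

lemma eulerOp_pow_nonneg {a : ℝ} (ha : 0 ≤ a) (ha' : a * clockCount k ≤ 1) {u : L1 (rowSpace k)}
    (hu : ∀ l, 0 ≤ u l) (m : ℕ) (b : rowSpace k) : 0 ≤ (eulerOp k a ^ m) u b := by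
  induction m generalizing b with
  | zero => simpa using hu b
  | succ m ih =>
    rw [pow_succ']
    exact eulerOp_nonneg ha ha' ih b

lemma tsum_generatorOp (u : L1 (rowSpace k)) :
    lp.tsumCLM ℝ (rowSpace k) ℝ (generatorOp k u) = 0 := by
  have h1 : ∀ l : rowSpace k, lp.tsumCLM ℝ (rowSpace k) ℝ (unitMass l) = 1 := by
    exact fun l => totalMass_unitMass l
  have h2 : ∀ l : rowSpace k, lp.tsumCLM ℝ (rowSpace k) ℝ (generatorRow l) = 0 := by
    intro l
    unfold generatorRow
    rw [map_sum, ← sum_rowGenerator l]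
    exact Finset.sum_congr rfl fun b _ => by rw [map_smul, h1, smul_eq_mul, mul_one]
  have h3 : HasSum (fun l => u l • generatorRow l) (generatorOp k u) :=
    ((summable_norm_smul norm_generatorRow_le u).of_norm).hasSum
  have h4 := h3.mapL (lp.tsumCLM ℝ (rowSpace k) ℝ)
  rw [← h4.tsum_eq]
  simp [h2]

lemma tsum_eulerOp_pow (a : ℝ) (m : ℕ) (u : L1 (rowSpace k)) :
    lp.tsumCLM ℝ (rowSpace k) ℝ ((eulerOp k a ^ m) u) = lp.tsumCLM ℝ (rowSpace k) ℝ u := by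
  induction m with
  | zero => simp
  | succ m ih =>
    rw [pow_succ', ← ih]
    change lp.tsumCLM ℝ (rowSpace k) ℝ ((eulerOp k a ^ m) u +
      a • generatorOp k ((eulerOp k a ^ m) u)) = _
    rw [map_add, map_smul, tsum_generatorOp, smul_zero, add_zero]

/-- The semigroup `exp (t A)` of the last row. -/
noncomputable def rowSemigroup (k : ℕ) (t : ℝ) : L1 (rowSpace k) →L[ℝ] L1 (rowSpace k) :=
  NormedSpace.exp (t • generatorOp k)

lemma tendsto_eulerOp_pow {a : ℕ → ℝ} {m : ℕ → ℕ} {t : ℝ} (ha : ∀ n, 0 < a n)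
    (ha0 : Tendsto a atTop (𝓝 0)) (hm : Tendsto (fun n => m n * a n) atTop (𝓝 t)) :
    Tendsto (fun n => eulerOp k (a n) ^ m n) atTop (𝓝 (rowSemigroup k t)) :=
  tendsto_one_add_smul_pow norm_one_le _ ha ha0 hm

lemma tendsto_eulerOp_pow_apply {a : ℕ → ℝ} {m : ℕ → ℕ} {t : ℝ} (ha : ∀ n, 0 < a n)
    (ha0 : Tendsto a atTop (𝓝 0)) (hm : Tendsto (fun n => m n * a n) atTop (𝓝 t))
    (u : L1 (rowSpace k)) :
    Tendsto (fun n => (eulerOp k (a n) ^ m n) u) atTop (𝓝 (rowSemigroup k t u)) :=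
  ((ContinuousLinearMap.apply ℝ (L1 (rowSpace k)) u).continuous.tendsto _).comp
    (tendsto_eulerOp_pow ha ha0 hm)

/-- Transition probabilities of the last row. -/
noncomputable def rowTransition (k : ℕ) (t : ℝ≥0) (l b : rowSpace k) : ℝ :=
  rowSemigroup k t (unitMass l) b

/-- Steps `a n`, so small that `eulerOp k (a n)` is positive, which reach the time `t`. -/
lemma exists_euler_approx (k : ℕ) (t : ℝ≥0) : ∃ (a : ℕ → ℝ) (m : ℕ → ℕ), (∀ n, 0 < a n) ∧
    (∀ n, a n * clockCount k ≤ 1) ∧ Tendsto a atTop (𝓝 0) ∧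
      Tendsto (fun n => m n * a n) atTop (𝓝 (t : ℝ)) := by
  have h0 : Tendsto (fun n : ℕ => ((clockCount k : ℝ) + n + 1)) atTop atTop := by
    have : Tendsto (fun n : ℕ => (n : ℝ)) atTop atTop := tendsto_natCast_atTop_atTop
    simp_rw [add_assoc, add_comm (clockCount k : ℝ)]
    exact tendsto_atTop_add_const_right _ _ (tendsto_atTop_add_const_right _ _ this)
  refine ⟨fun n => ((clockCount k : ℝ) + n + 1)⁻¹,
    fun n => ⌊(t : ℝ) * ((clockCount k : ℝ) + n + 1)⌋₊, fun n => by positivity, fun n => ?_,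
    tendsto_inv_atTop_zero.comp h0, ?_⟩
  · rw [inv_mul_le_iff₀ (by positivity)]
    have : (0 : ℝ) ≤ n := by positivity
    linarith
  · have := (tendsto_nat_floor_mul_div_atTop (R := ℝ) t.2).comp h0
    simpa [Function.comp_def, div_eq_mul_inv] using this

/-- Positivity and conservation of mass pass to the limit from Euler's approximation. -/
lemma rowTransition_isTransitionFunction (k : ℕ) : IsTransitionFunction (rowTransition k) where
  nonneg t l b := by
    obtain ⟨a, m, h1, h2, h3, h4⟩ := exists_euler_approx k t
    refine ge_of_tendsto' (tendsto_eval (tendsto_eulerOp_pow_apply h1 h3 h4 (unitMass l)) b)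
      fun n => eulerOp_pow_nonneg (h1 n).le (h2 n) (fun c => ?_) _ _
    by_cases hc : c = l
    · rw [hc, unitMass_self]; norm_num
    · rw [unitMass_ne hc]
  sum_one t l := by
    obtain ⟨a, m, h1, h2, h3, h4⟩ := exists_euler_approx k t
    have h5 := ((lp.tsumCLM ℝ (rowSpace k) ℝ).continuous.tendsto _).comp
      (tendsto_eulerOp_pow_apply h1 h3 h4 (unitMass l))
    simp only [Function.comp_def, tsum_eulerOp_pow] at h5
    have h6 := tendsto_nhds_unique h5 tendsto_const_nhds
    rw [totalMass_unitMass, lp.tsumCLM_apply] at h6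
    have h7 := (summable_norm_L1 (rowSemigroup k t (unitMass l))).of_norm.hasSum
    rw [h6] at h7
    exact h7
  zero_self l := by
    have : rowSemigroup k ((0 : ℝ≥0) : ℝ) = 1 := by
      unfold rowSemigroup
      rw [NNReal.coe_zero, zero_smul, NormedSpace.exp_zero]
    unfold rowTransition
    rw [this]
    exact unitMass_self l
  zero_ne l b h := by
    have : rowSemigroup k ((0 : ℝ≥0) : ℝ) = 1 := by
      unfold rowSemigroup
      rw [NNReal.coe_zero, zero_smul, NormedSpace.exp_zero]
    unfold rowTransition
    rw [this]
    exact unitMass_ne h.symm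
  chapman_kolmogorov s t l b := by
    let _ : NormedAlgebra ℚ (L1 (rowSpace k) →L[ℝ] L1 (rowSpace k)) :=
      NormedAlgebra.restrictScalars ℚ ℝ _
    have h1 : rowSemigroup k ((s + t : ℝ≥0) : ℝ) = rowSemigroup k t * rowSemigroup k s := by
      unfold rowSemigroup
      rw [NNReal.coe_add, add_comm (s : ℝ), add_smul, NormedSpace.exp_add_of_commute]
      exact ((Commute.refl (generatorOp k)).smul_left _).smul_right _
    have h2 := hasSum_smul_unitMass (rowSemigroup k s (unitMass l))
    have h3 := eval_hasSum (h2.mapL (rowSemigroup k t)) b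
    unfold rowTransition
    rw [h1]
    refine h3.congr_fun fun c => ?_
    rw [map_smul, lp.coeFn_smul, Pi.smul_apply, smul_eq_mul]

lemma rowTransition_hasGenerator (k : ℕ) : HasGenerator (rowTransition k) (rowGenerator k) := by
  intro l b
  have h1 := hasDerivAt_exp_smul_const (𝕂 := ℝ) (generatorOp k) (0 : ℝ)
  have h2 : HasDerivAt (fun t : ℝ => rowSemigroup k t (unitMass l) b)
      (generatorOp k (unitMass l) b) 0 := by
    have h3 := (((lp.evalCLM ℝ (fun _ : rowSpace k => ℝ) 1 b).comp
      (ContinuousLinearMap.apply ℝ (L1 (rowSpace k)) (unitMass l))).hasFDerivAt).comp_hasDerivAt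
        (0 : ℝ) h1
    rw [zero_smul, NormedSpace.exp_zero, one_mul] at h3
    exact h3
  rw [generatorOp_unitMass] at h2
  refine h2.hasDerivWithinAt.congr_of_mem (fun t ht => ?_) (Set.mem_Ici.2 le_rfl)
  unfold rowTransition
  rw [Real.coe_toNNReal t ht]

end Semigroup

/-! ### The random sequence of moves -/

section Chain

variable {k : ℕ}

open Classical in
/-- One step driven by the numbers of rings of all clocks: if exactly one clock rings, and only
once, the corresponding move takes place; otherwise the step is ignored. -/
noncomputable def stepMap (x : Config k) (r : Particle k × Direction → ℕ) : Config k :=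
  if h : ∃ c, r = Pi.single c 1 then move x h.choose else x

lemma single_one_injective {ι : Type*} [DecidableEq ι] :
    Function.Injective fun c : ι => (Pi.single c 1 : ι → ℕ) := by
  intro c d h
  by_contra hne
  have := congrFun h c
  simp [Pi.single_eq_of_ne hne] at this

open Classical in
lemma stepMap_single (x : Config k) (c : Particle k × Direction) :
    stepMap x (Pi.single c 1) = move x c := by
  have h : ∃ d, (Pi.single c 1 : Particle k × Direction → ℕ) = Pi.single d 1 := ⟨c, rfl⟩
  unfold stepMap
  rw [dif_pos h, ← single_one_injective h.choose_spec]

open Classical in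
lemma stepMap_of_forall_ne {x : Config k} {r : Particle k × Direction → ℕ}
    (h : ∀ c, r ≠ Pi.single c 1) : stepMap x r = x := by
  unfold stepMap
  rw [dif_neg]
  push Not
  exact h

lemma stepMap_zero (x : Config k) : stepMap x 0 = x := by
  classical
  refine stepMap_of_forall_ne fun c h => ?_
  have := congrFun h c
  simp at this

lemma IsInterlacing.stepMap {x : Config k} (hx : IsInterlacing x)
    (r : Particle k × Direction → ℕ) : IsInterlacing (stepMap x r) := by
  unfold _root_.stepMap
  split_ifs
  · exact hx.move _
  · exact hx

/-- The configurations obtained from `0` by the steps `stepMap`. -/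
noncomputable def chain (r : ℕ → Particle k × Direction → ℕ) : ℕ → Config k
  | 0 => 0
  | n + 1 => stepMap (chain r n) (r n)

lemma chain_isInterlacing (r : ℕ → Particle k × Direction → ℕ) (n : ℕ) :
    IsInterlacing (chain r n) := by
  induction n with
  | zero => exact IsInterlacing.zero
  | succ n ih => exact ih.stepMap _

end Chain

section Noise

variable {k : ℕ} {Ω : Type*}

/-- The numbers of rings of all clocks during all steps. -/
def rings (U : Particle k × Direction → ℕ → Ω → ℕ) (ω : Ω) : ℕ → Particle k × Direction → ℕ :=
  fun j c => U c j ω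

/-- The events that depend only on the steps before the `n`-th. -/
abbrev past (U : Particle k × Direction → ℕ → Ω → ℕ) (n : ℕ) : MeasurableSpace Ω :=
  ⨆ a ∈ {a : (Particle k × Direction) × ℕ | a.2 < n}, MeasurableSpace.comap (U a.1 a.2) ⊤

lemma past_mono {U : Particle k × Direction → ℕ → Ω → ℕ} {m n : ℕ} (h : m ≤ n) :
    past U m ≤ past U n :=
  biSup_mono fun _ ha => lt_of_lt_of_le ha h

lemma measurable_past {U : Particle k × Direction → ℕ → Ω → ℕ} (c : Particle k × Direction)
    {j n : ℕ} (h : j < n) :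
    Measurable[past U n] (U c j) := by
  have h1 : MeasurableSpace.comap (U c j) ⊤ ≤ past U n :=
    le_biSup (fun a : (Particle k × Direction) × ℕ => MeasurableSpace.comap (U a.1 a.2) ⊤)
      (i := (c, j)) h
  exact measurable_iff_comap_le.2 h1

variable [MeasurableSpace Ω]

/-- The numbers `U c j` of rings of the clocks `c` during the steps `j` are independent, vanish
with probability `b` and are equal to `1` with probability `θ b`, where `1 - θ ≤ b`. Both geometric
and Poisson variables are of this kind. -/
structure IsNoise (ν : Measure Ω) (θ b : ℝ) (U : Particle k × Direction → ℕ → Ω → ℕ) : Prop where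
  measurable : ∀ c j, Measurable (U c j)
  indep : iIndepFun (fun a : (Particle k × Direction) × ℕ => U a.1 a.2) ν
  zero : ∀ c j, ν.real {ω | U c j ω = 0} = b
  one : ∀ c j, ν.real {ω | U c j ω = 1} = θ * b
  pos : 0 < θ
  le : 1 - θ ≤ b

variable {ν : Measure Ω} {θ b : ℝ} {U : Particle k × Direction → ℕ → Ω → ℕ}

lemma past_le (hU : ∀ c j, Measurable (U c j)) (n : ℕ) : past U n ≤ ‹MeasurableSpace Ω› :=
  iSup₂_le fun a _ => (hU a.1 a.2).comap_le

omit [MeasurableSpace Ω] in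
lemma measurable_chain_past (n : ℕ) :
    Measurable[past U n] fun ω => chain (rings U ω) n := by
  induction n with
  | zero => exact @measurable_const _ _ _ (past U 0) _
  | succ n ih =>
    have h1 : Measurable[past U (n + 1)] fun ω => chain (rings U ω) n :=
      ih.mono (past_mono n.le_succ) le_rfl
    have h2 : Measurable[past U (n + 1)] fun ω => rings U ω n :=
      @measurable_pi_lambda _ _ _ (past U (n + 1)) _ _ fun c => measurable_past c n.lt_succ_self
    have h3 : Measurable fun p : Config k × (Particle k × Direction → ℕ) => stepMap p.1 p.2 :=
      measurable_of_countable _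
    exact h3.comp (h1.prodMk h2)

lemma measurable_chain (hU : ∀ c j, Measurable (U c j)) (n : ℕ) :
    Measurable fun ω => chain (rings U ω) n :=
  (measurable_chain_past n).mono (past_le hU n) le_rfl

lemma measurable_rings (hU : ∀ c j, Measurable (U c j)) (n : ℕ) :
    Measurable fun ω => rings U ω n :=
  measurable_pi_lambda _ fun c => hU c n

namespace IsNoise

lemma indep_past (h : IsNoise ν θ b U) {n : ℕ} {A : Set Ω}
    (hA : MeasurableSet[past U n] A) (r : Particle k × Direction → ℕ) :
    ν.real (A ∩ {ω | rings U ω n = r}) = ν.real A * ν.real {ω | rings U ω n = r} := by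
  have hle : ∀ a : (Particle k × Direction) × ℕ,
      MeasurableSpace.comap (U a.1 a.2) ⊤ ≤ ‹MeasurableSpace Ω› :=
    fun a => (h.measurable a.1 a.2).comap_le
  have hdisj : Disjoint {a : (Particle k × Direction) × ℕ | a.2 < n} {a | a.2 = n} := by
    rw [Set.disjoint_left]
    intro a (h1 : a.2 < n) (h2 : a.2 = n)
    omega
  have hind := indep_iSup_of_disjoint hle h.indep hdisj
  have hB : MeasurableSet[⨆ a ∈ {a : (Particle k × Direction) × ℕ | a.2 = n},
      MeasurableSpace.comap (U a.1 a.2) ⊤] {ω | rings U ω n = r} := by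
    have : {ω | rings U ω n = r} = ⋂ c, U c n ⁻¹' {r c} := by
      ext ω
      simp only [Set.mem_ofPred_eq, Set.mem_iInter, Set.mem_preimage, Set.mem_singleton_iff,
        funext_iff]
      rfl
    rw [this]
    refine @MeasurableSet.iInter _ _ (_) _ _ fun c => ?_
    refine le_biSup (fun a : (Particle k × Direction) × ℕ => MeasurableSpace.comap (U a.1 a.2) ⊤)
      (i := (c, n)) (by simp) _ ?_
    exact ⟨{r c}, trivial, rfl⟩
  rw [Indep_iff] at hind
  simp only [measureReal_def]
  rw [hind A _ hA hB, ENNReal.toReal_mul]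

lemma real_rings_eq (h : IsNoise ν θ b U) (n : ℕ) (r : Particle k × Direction → ℕ) :
    ν.real {ω | rings U ω n = r} = ∏ c, ν.real {ω | U c n ω = r c} := by
  have h1 := h.indep.precomp (g := fun c : Particle k × Direction => (c, n))
    (fun c d hcd => (Prod.mk.inj hcd).1)
  have h2 := h1.meas_iInter (s := fun c => {ω | U c n ω = r c}) fun c => ⟨{r c}, trivial, rfl⟩
  have h3 : {ω | rings U ω n = r} = ⋂ c, {ω | U c n ω = r c} := by
    ext ω
    simp only [Set.mem_ofPred_eq, Set.mem_iInter, funext_iff]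
    rfl
  rw [h3, measureReal_def, h2, ENNReal.toReal_prod]
  rfl

lemma real_rings_zero (h : IsNoise ν θ b U) (n : ℕ) :
    ν.real {ω | rings U ω n = 0} = b ^ clockCount k := by
  rw [h.real_rings_eq]
  simp [h.zero, clockCount]

open Classical in
lemma real_rings_single (h : IsNoise ν θ b U) (n : ℕ) (c : Particle k × Direction) :
    ν.real {ω | rings U ω n = Pi.single c 1} = θ * b ^ clockCount k := by
  rw [h.real_rings_eq, ← Finset.mul_prod_erase _ _ (Finset.mem_univ c), Pi.single_eq_same, h.one,
    Finset.prod_congr rfl fun d hd => by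
      rw [Pi.single_eq_of_ne (Finset.ne_of_mem_erase hd), h.zero],
    Finset.prod_const, Finset.card_erase_of_mem (Finset.mem_univ c), Finset.card_univ, mul_assoc,
    ← pow_succ', clockCount]
  congr 2
  have : 0 < Fintype.card (Particle k × Direction) := Fintype.card_pos_iff.2 ⟨c⟩
  omega

end IsNoise

variable [IsProbabilityMeasure ν]

open Classical in
/-- Splitting an event according to which single clock rings, if any. -/
lemma real_eq_sum_rings (hU : ∀ c j, Measurable (U c j)) (n : ℕ) {S : Set Ω}
    (hS : MeasurableSet S) :
    ν.real S = ν.real (S \ ⋃ c, {ω | rings U ω n = Pi.single c 1}) +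
      ∑ c : Particle k × Direction, ν.real (S ∩ {ω | rings U ω n = Pi.single c 1}) := by
  have hm : ∀ c : Particle k × Direction,
      MeasurableSet {ω | rings U ω n = Pi.single c 1} := fun c =>
    measurable_rings hU n (measurableSet_singleton _)
  rw [← measureReal_sdiff_add_inter (s := S) (MeasurableSet.iUnion hm), Set.inter_iUnion]
  congr 1
  refine measureReal_iUnion_fintype (fun c d hcd => ?_) fun c => hS.inter (hm c)
  refine Set.disjoint_left.2 fun ω h1 h2 => hcd ?_
  have e1 : rings U ω n = Pi.single c 1 := h1.2
  have e2 : rings U ω n = Pi.single d 1 := h2.2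
  exact single_one_injective (e1.symm.trans e2)

open Classical in
/-- The law of the chain at step `n + 1` on an event `A` from the first `n` steps. -/
lemma IsNoise.real_chain_succ (h : IsNoise ν θ b U) {n : ℕ} {A : Set Ω}
    (hA : MeasurableSet[past U n] A) (z : Config k) :
    ν.real (A ∩ {ω | chain (rings U ω) (n + 1) = z}) =
      ν.real (A ∩ {ω | chain (rings U ω) n = z}) + θ * b ^ clockCount k *
        (∑ c, ∑ x ∈ preds z with move x c = z, ν.real (A ∩ {ω | chain (rings U ω) n = x}) -
          clockCount k * ν.real (A ∩ {ω | chain (rings U ω) n = z})) := by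
  have hpast : ∀ x, MeasurableSet[past U n] (A ∩ {ω | chain (rings U ω) n = x}) := fun x =>
    MeasurableSet.inter hA (measurable_chain_past n (measurableSet_singleton x))
  have hS : MeasurableSet (A ∩ {ω | chain (rings U ω) (n + 1) = z}) :=
    (past_le h.measurable n _ hA).inter
      (measurable_chain h.measurable (n + 1) (measurableSet_singleton z))
  have h1 := real_eq_sum_rings (ν := ν) h.measurable n hS
  have h2 := real_eq_sum_rings (ν := ν) h.measurable n (past_le h.measurable n _ (hpast z))
  have h3 : (A ∩ {ω | chain (rings U ω) (n + 1) = z}) \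
        (⋃ c, {ω | rings U ω n = Pi.single c 1}) =
      (A ∩ {ω | chain (rings U ω) n = z}) \ (⋃ c, {ω | rings U ω n = Pi.single c 1}) := by
    ext ω
    simp only [Set.mem_sdiff, Set.mem_inter_iff, Set.mem_ofPred_eq, Set.mem_iUnion, not_exists,
      and_congr_left_iff, and_congr_right_iff]
    intro h4 _
    rw [chain, stepMap_of_forall_ne h4]
  have h5 : ∀ c : Particle k × Direction,
      ν.real ((A ∩ {ω | chain (rings U ω) (n + 1) = z}) ∩ {ω | rings U ω n = Pi.single c 1}) =
        θ * b ^ clockCount k * ∑ x ∈ preds z with move x c = z,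
          ν.real (A ∩ {ω | chain (rings U ω) n = x}) := by
    intro c
    have h6 : (A ∩ {ω | chain (rings U ω) (n + 1) = z}) ∩ {ω | rings U ω n = Pi.single c 1} =
        ⋃ x ∈ (preds z).filter (move · c = z),
          (A ∩ {ω | chain (rings U ω) n = x}) ∩ {ω | rings U ω n = Pi.single c 1} := by
      ext ω
      simp only [Set.mem_inter_iff, Set.mem_ofPred_eq, Set.mem_iUnion, Finset.mem_filter,
        exists_prop]
      constructor
      · rintro ⟨⟨h7, h8⟩, h9⟩
        rw [chain, h9, stepMap_single] at h8
        exact ⟨_, ⟨mem_preds_of_move (chain_isInterlacing _ _) h8, h8⟩, ⟨h7, rfl⟩, h9⟩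
      · rintro ⟨x, ⟨-, h8⟩, ⟨h7, rfl⟩, h9⟩
        refine ⟨⟨h7, ?_⟩, h9⟩
        rw [chain, h9, stepMap_single, h8]
    rw [h6, measureReal_biUnion_finset, Finset.mul_sum]
    · refine Finset.sum_congr rfl fun x _ => ?_
      rw [h.indep_past (hpast x), h.real_rings_single, mul_comm]
    · intro x _ y _ hxy
      refine Set.disjoint_left.2 fun ω h7 h8 => hxy ?_
      exact h7.1.2.symm.trans h8.1.2
    · exact fun x _ => (past_le h.measurable n _ (hpast x)).inter
        (measurable_rings h.measurable n (measurableSet_singleton _))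
  have h6 : ∀ c : Particle k × Direction,
      ν.real ((A ∩ {ω | chain (rings U ω) n = z}) ∩ {ω | rings U ω n = Pi.single c 1}) =
        θ * b ^ clockCount k * ν.real (A ∩ {ω | chain (rings U ω) n = z}) := by
    intro c
    rw [h.indep_past (hpast z), h.real_rings_single, mul_comm]
  rw [h3, Finset.sum_congr rfl fun c _ => h5 c, ← Finset.mul_sum] at h1
  rw [Finset.sum_congr rfl fun c _ => h6 c, Finset.sum_const, Finset.card_univ, nsmul_eq_mul] at h2
  rw [h1, eq_sub_of_add_eq h2.symm, clockCount]
  ring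

/-- On the event `A`, the row of the chain at step `n` has the law `u`, and given its row the
configuration is distributed proportionally to `patternWeight`. -/
def Spread (ν : Measure Ω) (U : Particle k × Direction → ℕ → Ω → ℕ) (A : Set Ω) (n : ℕ)
    (u : L1 (rowSpace k)) : Prop :=
  ∀ x : Config k, ν.real (A ∩ {ω | chain (rings U ω) n = x}) =
    open Classical in if h : IsInterlacing x then
      u ⟨configRow x, configRow_mem_rowSpace h⟩ * patternWeight x / gtCount k (configRow x) else 0

/-- The intertwining relation makes the conditional law of the configuration given its row
persist, so that the row evolves by `eulerOp`. -/
lemma Spread.succ (h : IsNoise ν θ b U) {n : ℕ} {A : Set Ω} {u : L1 (rowSpace k)}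
    (hA : MeasurableSet[past U n] A) (hu : Spread ν U A n u) :
    Spread ν U A (n + 1) (eulerOp k (θ * b ^ clockCount k) u) := by
  classical
  intro z
  by_cases hz : IsInterlacing z
  · rw [dif_pos hz, h.real_chain_succ hA, hu z, dif_pos hz, eulerOp_apply]
    have h1 := sum_preds_move_rowGenerator hz (fun l => u l)
    have h2 : ∑ c, ∑ x ∈ preds z with move x c = z, ν.real (A ∩ {ω | chain (rings U ω) n = x}) =
        ∑ c, ∑ x ∈ preds z with move x c = z, (if h : configRow x ∈ rowSpace k then
          u ⟨configRow x, h⟩ / gtCount k (configRow x) else 0) * patternWeight x := by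
      refine Finset.sum_congr rfl fun c _ => Finset.sum_congr (by congr) fun x hx => ?_
      have hx' : IsInterlacing x := (mem_preds.1 (Finset.mem_filter.1 hx).1).1
      rw [hu x, dif_pos hx', dif_pos (configRow_mem_rowSpace hx')]
      ring
    rw [h2]
    have h3 : (gtCount k (configRow z) : ℝ) ≠ 0 := by
      exact_mod_cast (gtCount_pos (configRow_mem_rowSpace hz)).ne'
    have h4 : (∑ c, ∑ x ∈ preds z with move x c = z, (if h : configRow x ∈ rowSpace k then
          u ⟨configRow x, h⟩ / gtCount k (configRow x) else 0) * patternWeight x : ℝ) =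
        patternWeight z / gtCount k (configRow z) *
          (clockCount k * u ⟨configRow z, configRow_mem_rowSpace hz⟩ +
            ∑ l ∈ rowBall ⟨configRow z, configRow_mem_rowSpace hz⟩,
              u l * rowGenerator k l ⟨configRow z, configRow_mem_rowSpace hz⟩) := by
      convert h1
    rw [h4]
    field_simp
    ring
  · rw [dif_neg hz]
    have : A ∩ {ω | chain (rings U ω) (n + 1) = z} = ∅ := by
      ext ω
      simp only [Set.mem_inter_iff, Set.mem_ofPred_eq, Set.mem_empty_iff_false, iff_false, not_and]
      rintro - rfl
      exact hz (chain_isInterlacing _ _)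
    rw [this, measureReal_empty]

lemma Spread.iterate (h : IsNoise ν θ b U) {n : ℕ} {A : Set Ω} {u : L1 (rowSpace k)}
    (hA : MeasurableSet[past U n] A) (hu : Spread ν U A n u) (m : ℕ) :
    Spread ν U A (n + m) ((eulerOp k (θ * b ^ clockCount k) ^ m) u) := by
  induction m with
  | zero => simpa using hu
  | succ m ih =>
    rw [pow_succ', mul_apply_eq_comp]
    exact ih.succ h (past_mono (Nat.le_add_right n m) _ hA)

/-- The rows of the chain. -/
lemma Spread.real_row (hU : ∀ c j, Measurable (U c j)) {n : ℕ} {A : Set Ω}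
    {u : L1 (rowSpace k)} (hA : MeasurableSet A) (hu : Spread ν U A n u) (l : rowSpace k) :
    ν.real (A ∩ {ω | configRow (chain (rings U ω) n) = l}) = u l := by
  classical
  have h1 : A ∩ {ω | configRow (chain (rings U ω) n) = l} =
      ⋃ x ∈ rowFiber l.1, A ∩ {ω | chain (rings U ω) n = x} := by
    ext ω
    simp only [Set.mem_inter_iff, Set.mem_ofPred_eq, Set.mem_iUnion, exists_prop, mem_rowFiber]
    constructor
    · rintro ⟨h2, h3⟩
      exact ⟨_, ⟨chain_isInterlacing _ _, h3⟩, h2, rfl⟩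
    · rintro ⟨x, ⟨-, h3⟩, h2, rfl⟩
      exact ⟨h2, h3⟩
  rw [h1, measureReal_biUnion_finset]
  · have h2 : ∀ x ∈ rowFiber l.1, ν.real (A ∩ {ω | chain (rings U ω) n = x}) =
        u l / gtCount k l.1 * patternWeight x := by
      intro x hx
      obtain ⟨hxi, hxl⟩ := mem_rowFiber.1 hx
      rw [hu x, dif_pos hxi]
      have : (⟨configRow x, configRow_mem_rowSpace hxi⟩ : rowSpace k) = l := Subtype.ext hxl
      rw [this, hxl]
      ring
    rw [Finset.sum_congr rfl h2, ← Finset.mul_sum, ← Nat.cast_sum, ← gtCount_eq l.2]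
    have h3 : (gtCount k l.1 : ℝ) ≠ 0 := by exact_mod_cast (gtCount_pos l.2).ne'
    field_simp
  · intro x _ y _ hxy
    exact Set.disjoint_left.2 fun ω h7 h8 => hxy (h7.2.symm.trans h8.2)
  · exact fun x _ => hA.inter (measurable_chain hU n (measurableSet_singleton x))

omit [IsProbabilityMeasure ν] in
lemma Spread.restrict {n : ℕ} {A : Set Ω} {u : L1 (rowSpace k)} (hu : Spread ν U A n u)
    (l : rowSpace k) :
    Spread ν U (A ∩ {ω | configRow (chain (rings U ω) n) = l}) n (u l • unitMass l) := by
  classical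
  intro x
  by_cases hx : configRow x = l
  · have h1 : A ∩ {ω | configRow (chain (rings U ω) n) = l} ∩ {ω | chain (rings U ω) n = x} =
        A ∩ {ω | chain (rings U ω) n = x} := by
      ext ω
      simp only [Set.mem_inter_iff, Set.mem_ofPred_eq, and_congr_left_iff, and_iff_left_iff_imp]
      rintro rfl -
      exact hx
    rw [h1, hu x]
    split_ifs with hxi
    · have : (⟨configRow x, configRow_mem_rowSpace hxi⟩ : rowSpace k) = l := Subtype.ext hx
      rw [this, lp.coeFn_smul, Pi.smul_apply, unitMass_self, smul_eq_mul, mul_one]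
    · rfl
  · have h1 : A ∩ {ω | configRow (chain (rings U ω) n) = l} ∩ {ω | chain (rings U ω) n = x} =
        ∅ := by
      ext ω
      simp only [Set.mem_inter_iff, Set.mem_ofPred_eq, Set.mem_empty_iff_false, iff_false]
      rintro ⟨⟨-, h2⟩, rfl⟩
      exact hx h2
    rw [h1, measureReal_empty]
    split_ifs with hxi
    · rw [lp.coeFn_smul, Pi.smul_apply, unitMass_ne fun h => hx (congrArg Subtype.val h),
        smul_eq_mul, mul_zero, zero_mul, zero_div]
    · rfl

/-- The row `0`. -/
def zeroRow (k : ℕ) : rowSpace k := ⟨fun _ => 0, fun _ _ _ => le_rfl, fun _ => le_rfl⟩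

lemma configRow_zero : configRow (0 : Config k) = (zeroRow k).1 := by
  funext j
  simp [configRow, lastRow, zeroRow]

lemma rowFiber_zeroRow : rowFiber (zeroRow k).1 = {(0 : Config k)} := by
  ext x
  rw [mem_rowFiber, Finset.mem_singleton]
  constructor
  · rintro ⟨h1, h2⟩
    funext p
    have := le_sum_row h1 h2 p
    simpa [zeroRow] using this
  · rintro rfl
    exact ⟨IsInterlacing.zero, configRow_zero⟩

lemma spread_zero (ν : Measure Ω) [IsProbabilityMeasure ν]
    (U : Particle k × Direction → ℕ → Ω → ℕ) :
    Spread ν U Set.univ 0 (unitMass (zeroRow k)) := by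
  classical
  have hc : gtCount k (zeroRow k).1 = patternWeight (0 : Config k) := by
    rw [gtCount_eq (zeroRow k).2, rowFiber_zeroRow, Finset.sum_singleton]
  intro x
  rw [Set.univ_inter]
  by_cases hx : x = 0
  · subst hx
    have h1 : {ω : Ω | chain (rings U ω) 0 = 0} = Set.univ := by
      ext ω
      simp [chain]
    have h2 : (⟨configRow (0 : Config k), configRow_mem_rowSpace IsInterlacing.zero⟩ :
      rowSpace k) = zeroRow k := Subtype.ext configRow_zero
    have h3 : (patternWeight (0 : Config k) : ℝ) ≠ 0 := by
      exact_mod_cast (patternWeight_pos (0 : Config k)).ne'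
    rw [h1, probReal_univ, dif_pos IsInterlacing.zero, h2, unitMass_self, configRow_zero, hc]
    field_simp
  · have h1 : {ω : Ω | chain (rings U ω) 0 = x} = ∅ := by
      ext ω
      simp only [Set.mem_ofPred_eq, Set.mem_empty_iff_false, iff_false, chain]
      exact fun h => hx h.symm
    rw [h1, measureReal_empty]
    split_ifs with hxi
    · rw [unitMass_ne, zero_mul, zero_div]
      intro h
      have : x ∈ rowFiber (zeroRow k).1 := mem_rowFiber.2 ⟨hxi, congrArg Subtype.val h⟩
      rw [rowFiber_zeroRow, Finset.mem_singleton] at this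
      exact hx this
    · rfl

end Noise

/-! ### Finite-dimensional distributions of the row of the chain -/

section Distributions

variable {k : ℕ} {Ω : Type*} [MeasurableSpace Ω] {ν : Measure Ω} [IsProbabilityMeasure ν]
  {θ b : ℝ} {U : Particle k × Direction → ℕ → Ω → ℕ}

/-- The event that the row of the chain is `l i` at step `m i`, for `1 ≤ i ≤ n`. -/
def rowEvent (W : ℕ → Ω → Config k) (m : ℕ → ℕ) (l : ℕ → rowSpace k) (n : ℕ) : Set Ω :=
  {ω | ∀ i < n, configRow (W (m (i + 1)) ω) = l (i + 1)}

omit [MeasurableSpace Ω] in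
lemma rowEvent_succ (W : ℕ → Ω → Config k) (m : ℕ → ℕ) (l : ℕ → rowSpace k) (n : ℕ) :
    rowEvent W m l (n + 1) = rowEvent W m l n ∩ {ω | configRow (W (m (n + 1)) ω) = l (n + 1)} := by
  ext ω
  simp only [rowEvent, Set.mem_ofPred_eq, Set.mem_inter_iff, Nat.forall_lt_succ_right]

/-- The finite-dimensional distributions of the row of the chain. The first two parts, that the
event is determined by the first `m n` steps and that `Spread` holds on it, make the induction
work. -/
lemma IsNoise.spread_rowEvent (h : IsNoise ν θ b U) {m : ℕ → ℕ} (hm : Monotone m) (hm0 : m 0 = 0)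
    {l : ℕ → rowSpace k} (hl : l 0 = zeroRow k) (n : ℕ) :
    MeasurableSet[past U (m n)] (rowEvent (fun j ω => chain (rings U ω) j) m l n) ∧
    Spread ν U (rowEvent (fun j ω => chain (rings U ω) j) m l n) (m n)
      ((∏ i ∈ Finset.range n, (eulerOp k (θ * b ^ clockCount k) ^ (m (i + 1) - m i))
        (unitMass (l i)) (l (i + 1))) • unitMass (l n)) ∧
    ν.real (rowEvent (fun j ω => chain (rings U ω) j) m l n) =
      ∏ i ∈ Finset.range n, (eulerOp k (θ * b ^ clockCount k) ^ (m (i + 1) - m i))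
        (unitMass (l i)) (l (i + 1)) := by
  induction n with
  | zero =>
    have h1 : rowEvent (fun j ω => chain (rings U ω) j) m l 0 = Set.univ := by
      ext ω
      simp [rowEvent]
    refine ⟨h1 ▸ MeasurableSet.univ, ?_, ?_⟩
    · rw [h1, Finset.range_zero, Finset.prod_empty, one_smul, hm0, hl]
      exact spread_zero ν U
    · rw [h1, probReal_univ, Finset.range_zero, Finset.prod_empty]
  | succ n ih =>
    obtain ⟨ih1, ih2, -⟩ := ih
    have h1 := ih2.iterate h ih1 (m (n + 1) - m n)
    have hmn : m n ≤ m (n + 1) := hm n.le_succ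
    rw [Nat.add_sub_cancel' hmn] at h1
    have h2 := h1.restrict (l (n + 1))
    have h3 := h1.real_row h.measurable (past_le h.measurable _ _ ih1) (l (n + 1))
    rw [map_smul, lp.coeFn_smul, Pi.smul_apply, smul_eq_mul, ← Finset.prod_range_succ (fun i =>
      (eulerOp k (θ * b ^ clockCount k) ^ (m (i + 1) - m i)) (unitMass (l i)) (l (i + 1)))] at h2 h3
    rw [rowEvent_succ]
    refine ⟨MeasurableSet.inter (past_mono hmn _ ih1) ?_, h2, h3⟩
    have h4 : Measurable fun x : Config k => configRow x := measurable_of_countable _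
    exact measurable_chain_past (m (n + 1)) (h4 (measurableSet_singleton _))

/-! ### Comparison with the chain -/

/-- No clock rings, or exactly one clock rings and only once. -/
def IsSimpleStep (r : Particle k × Direction → ℕ) : Prop :=
  open Classical in r = 0 ∨ ∃ c, r = Pi.single c 1

lemma abs_measureReal_sub_le {A B C : Set Ω} (h : ∀ᵐ ω ∂ν, ω ∉ C → (ω ∈ A ↔ ω ∈ B)) :
    |ν.real A - ν.real B| ≤ ν.real C := by
  have key : ∀ A B : Set Ω, (∀ᵐ ω ∂ν, ω ∉ C → (ω ∈ A ↔ ω ∈ B)) →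
      ν.real A ≤ ν.real B + ν.real C := by
    intro A B h
    refine le_trans ?_ (measureReal_union_le B C)
    refine ENNReal.toReal_mono (measure_ne_top _ _) (measure_mono_ae ?_)
    filter_upwards [h] with ω hω hA
    by_cases hC : ω ∈ C
    · exact Or.inr hC
    · exact Or.inl ((hω hC).1 hA)
  have h1 := key A B h
  have h2 := key B A (h.mono fun ω hω hC => (hω hC).symm)
  rw [abs_le]
  constructor <;> linarith

/-- By Bernoulli's inequality, `b ^ K ≥ 1 - K θ` for `K = clockCount k`, so that a step is simple
with probability `b ^ K (1 + K θ) ≥ 1 - (K θ) ^ 2`. -/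
lemma IsNoise.real_not_isSimpleStep_le (h : IsNoise ν θ b U) (n : ℕ) :
    ν.real {ω | ¬ IsSimpleStep (rings U ω n)} ≤ (clockCount k * θ) ^ 2 := by
  classical
  by_cases hθ : 1 ≤ clockCount k * θ
  · exact measureReal_le_one.trans (one_le_pow₀ hθ)
  push Not at hθ
  have hm := fun r => measurable_rings h.measurable n (measurableSet_singleton r)
  have h1 := real_eq_sum_rings (ν := ν) h.measurable n MeasurableSet.univ
  rw [Finset.sum_congr rfl fun c _ => by rw [Set.univ_inter, h.real_rings_single],
    Finset.sum_const, Finset.card_univ, nsmul_eq_mul, probReal_univ] at h1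
  have h2 := measureReal_sdiff_add_inter (μ := ν)
    (s := Set.univ \ ⋃ c, {ω | rings U ω n = Pi.single c 1}) (hm 0)
  have h3 : (Set.univ \ ⋃ c, {ω | rings U ω n = Pi.single c 1}) ∩ (fun ω => rings U ω n) ⁻¹' {0} =
      {ω | rings U ω n = 0} := by
    ext ω
    simp only [Set.mem_inter_iff, Set.mem_sdiff, Set.mem_univ, true_and, Set.mem_iUnion,
      Set.mem_ofPred_eq, Set.mem_preimage, Set.mem_singleton_iff, and_iff_right_iff_imp, not_exists]
    intro h4 c h5
    have h6 := congrFun (h4.symm.trans h5) c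
    simp at h6
  have h4 : (Set.univ \ ⋃ c, {ω | rings U ω n = Pi.single c 1}) \ (fun ω => rings U ω n) ⁻¹' {0} =
      {ω | ¬ IsSimpleStep (rings U ω n)} := by
    ext ω
    simp only [Set.mem_sdiff, Set.mem_univ, true_and, Set.mem_iUnion,
      Set.mem_ofPred_eq, Set.mem_preimage, Set.mem_singleton_iff, IsSimpleStep]
    tauto
  rw [h3, h4, h.real_rings_zero] at h2
  change _ = _ + (clockCount k : ℝ) * _ at h1
  have h5 : 1 - clockCount k * θ ≤ b ^ clockCount k := by
    rcases Nat.eq_zero_or_pos (clockCount k) with h6 | h6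
    · simp [h6]
    have h7 : (1 : ℝ) ≤ clockCount k := by exact_mod_cast h6
    have h8 : θ ≤ 1 := by nlinarith [h.pos]
    have h9 := one_add_mul_le_pow (a := -θ) (by linarith) (clockCount k)
    have h10 : (1 + -θ) ^ clockCount k ≤ b ^ clockCount k :=
      pow_le_pow_left₀ (by linarith) (by linarith [h.le]) _
    linarith
  have h6 : 0 ≤ clockCount k * θ := mul_nonneg (Nat.cast_nonneg _) h.pos.le
  nlinarith

lemma IsNoise.real_exists_not_isSimpleStep_le (h : IsNoise ν θ b U) (M : ℕ) :
    ν.real {ω | ∃ j < M, ¬ IsSimpleStep (rings U ω j)} ≤ M * (clockCount k * θ) ^ 2 := by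
  have h1 : {ω | ∃ j < M, ¬ IsSimpleStep (rings U ω j)} =
      ⋃ j ∈ Finset.range M, {ω | ¬ IsSimpleStep (rings U ω j)} := by
    ext ω
    simp
  rw [h1]
  refine (measureReal_biUnion_finset_le _ _).trans ?_
  refine (Finset.sum_le_sum fun j _ => h.real_not_isSimpleStep_le j).trans_eq ?_
  rw [Finset.sum_const, Finset.card_range, nsmul_eq_mul]

lemma eq_chain_of_isSimpleStep {W : ℕ → Config k} {r : ℕ → Particle k × Direction → ℕ} {M : ℕ}
    (h0 : W 0 = 0)
    (hs : ∀ j, IsInterlacing (W j) → IsSimpleStep (r j) → W (j + 1) = stepMap (W j) (r j))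
    (hr : ∀ j < M, IsSimpleStep (r j)) : ∀ j ≤ M, W j = chain r j := by
  intro j
  induction j with
  | zero => exact fun _ => h0
  | succ j ih =>
    intro hj
    have h1 := ih (by omega)
    rw [hs j (h1 ▸ chain_isInterlacing r j) (hr j hj), h1, chain]

end Distributions

section Limit

variable {k : ℕ}

/-- The probability that the row, started at `l 0` at time `t 0` and evolving according to
`rowSemigroup`, visits `l 1, …, l n` at the times `t 1, …, t n`. -/
noncomputable def rowPathProb (t : ℕ → ℝ) (l : ℕ → rowSpace k) (n : ℕ) : ℝ :=
  ∏ i ∈ Finset.range n, rowSemigroup k (t (i + 1) - t i) (unitMass (l i)) (l (i + 1))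

/-- A sequence of processes which follow the noise in its simple steps has, in the limit of small
time steps, the finite-dimensional distributions given by `rowSemigroup`. -/
lemma tendsto_real_rowEvent {Ω : ℕ → Type*} [∀ N, MeasurableSpace (Ω N)]
    {ν : ∀ N, Measure (Ω N)} [∀ N, IsProbabilityMeasure (ν N)] {θ b : ℕ → ℝ}
    {U : ∀ N, Particle k × Direction → ℕ → Ω N → ℕ} (hU : ∀ N, IsNoise (ν N) (θ N) (b N) (U N))
    (hθ : Tendsto θ atTop (𝓝 0)) (hb0 : ∀ N, 0 < b N) (hb : Tendsto b atTop (𝓝 1))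
    {W : ∀ N, ℕ → Ω N → Config k}
    (hW : ∀ N, ∀ᵐ ω ∂(ν N), W N 0 ω = 0 ∧ ∀ j, IsInterlacing (W N j ω) →
      IsSimpleStep (rings (U N) ω j) → W N (j + 1) ω = stepMap (W N j ω) (rings (U N) ω j))
    {m : ℕ → ℕ → ℕ} (hm : ∀ N, Monotone (m N)) (hm0 : ∀ N, m N 0 = 0) {t : ℕ → ℝ}
    (ht : ∀ i, Tendsto (fun N => m N i * θ N) atTop (𝓝 (t i)))
    {l : ℕ → rowSpace k} (hl : l 0 = zeroRow k) (n : ℕ) :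
    Tendsto (fun N => (ν N).real (rowEvent (W N) (m N) l n)) atTop (𝓝 (rowPathProb t l n)) := by
  set a : ℕ → ℝ := fun N => θ N * b N ^ clockCount k with ha
  have ha_pos : ∀ N, 0 < a N := fun N => mul_pos (hU N).pos (pow_pos (hb0 N) _)
  have hbk : Tendsto (fun N => b N ^ clockCount k) atTop (𝓝 1) := by
    simpa using hb.pow (clockCount k)
  have ha0 : Tendsto a atTop (𝓝 0) := by simpa using hθ.mul hbk
  have h1 : Tendsto (fun N => (ν N).real
      (rowEvent (fun j ω => chain (rings (U N) ω) j) (m N) l n)) atTop (𝓝 (rowPathProb t l n)) := by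
    simp_rw [((hU _).spread_rowEvent (hm _) (hm0 _) hl n).2.2]
    refine tendsto_finsetProd _ fun i _ => tendsto_eval ?_ _
    refine tendsto_eulerOp_pow_apply ha_pos ha0 ?_ _
    have h2 := ((ht (i + 1)).sub (ht i)).mul hbk
    rw [mul_one] at h2
    refine h2.congr fun N => ?_
    rw [Nat.cast_sub (hm N i.le_succ)]
    ring
  have h2 : Tendsto (fun N => (m N n : ℝ) * (clockCount k * θ N) ^ 2) atTop (𝓝 0) := by
    have h3 := ((ht n).mul hθ).mul_const ((clockCount k : ℝ) ^ 2)
    rw [mul_zero, zero_mul] at h3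
    refine h3.congr fun N => ?_
    ring
  refine tendsto_of_tendsto_of_dist h1 (squeeze_zero (fun _ => dist_nonneg) (fun N => ?_) h2)
  rw [Real.dist_eq]
  refine (abs_measureReal_sub_le (C := {ω | ∃ j < m N n, ¬ IsSimpleStep (rings (U N) ω j)})
    ?_).trans ((hU N).real_exists_not_isSimpleStep_le _)
  filter_upwards [hW N] with ω hω hC
  have h3 := eq_chain_of_isSimpleStep (W := fun j => W N j ω) hω.1 hω.2 (M := m N n) (by
    simpa using hC)
  simp only [rowEvent, Set.mem_ofPred_eq]
  refine forall₂_congr fun i hi => ?_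
  rw [h3 (m N (i + 1)) (hm N hi)]

end Limit

/-! ### Steps of the model with geometric jumps -/

section DiscreteStep

variable {k : ℕ}

lemma exists_diagAbove {p : Particle k} (h : p.idx ≠ 1) :
    ∃ q : Particle k, q.row + 1 = p.row ∧ q.idx + 1 = p.idx := by
  have hp := p.bounds
  obtain ⟨q, hq1, hq2⟩ := Particle.exists_of_bounds (k := k) (i := p.row - 1) (j := p.idx - 1)
    (by omega)
  exact ⟨q, by omega, by omega⟩

/-- A configuration which satisfies the defining recursion of `leftHalfStep` is its result. Here
`T` is the position of `p` after it has been pushed. -/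
lemma leftHalfStep_eq {x ξ z : Config k}
    (h : ∀ (p : Particle k) (T : ℕ), (p.idx = 1 → T = x p) →
      (∀ q : Particle k, q.row + 1 = p.row → q.idx + 1 = p.idx → T = min (x p) (z q)) →
      (p.IsWall → z p = T) ∧
      ∀ a : Particle k, a.row + 1 = p.row → a.idx = p.idx → z p = max (x a) (T - ξ p))
    (p : Particle k) : leftHalfStep (entry x) (entry ξ) p.row p.idx = z p := by
  obtain ⟨n, hn⟩ : ∃ n, p.row = n := ⟨_, rfl⟩
  induction n generalizing p with
  | zero => have := p.bounds; omega
  | succ n ih =>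
    have hp := p.bounds
    rw [hn, leftHalfStep, entry_eq_of x p hn rfl, entry_eq_of ξ p hn rfl]
    set T := if p.idx = 1 then x p else
      min (x p) (leftHalfStep (entry x) (entry ξ) n (p.idx - 1)) with hT
    have h1 := h p T (fun h1 => by rw [hT, if_pos h1]) (fun q hq1 hq2 => by
      have hq := q.bounds
      rw [hT, if_neg (by omega), ← ih q (by omega), show q.row = n by omega,
        show q.idx = p.idx - 1 by omega])
    show (if 2 * p.idx = n + 2 then T else max (entry x n p.idx) (T - ξ p)) = z p
    by_cases hw : p.IsWall
    · have hw' := hw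
      unfold Particle.IsWall at hw'
      rw [if_pos (by omega), h1.1 hw]
    · obtain ⟨a, ha1, ha2⟩ := exists_above hw
      unfold Particle.IsWall at hw
      rw [if_neg (by omega), h1.2 a ha1 ha2, entry_eq_of x a (by omega) ha2]

/-- A configuration which satisfies the defining recursion of `rightHalfStep` is its result. Here
`T` is the position which `p` would reach without being blocked. -/
lemma rightHalfStep_eq {y ξ ξ' z : Config k} {Y : ℕ → ℕ → ℕ}
    (hY : ∀ p : Particle k, Y p.row p.idx = y p)
    (h : ∀ (p : Particle k) (T : ℕ), (p.IsWall → T = ((y p : ℤ) + ξ' p - ξ p).natAbs) →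
      (∀ a : Particle k, a.row + 1 = p.row → a.idx = p.idx → T = max (z a) (y p) + ξ' p) →
      (p.idx = 1 → z p = T) ∧
      ∀ q : Particle k, q.row + 1 = p.row → q.idx + 1 = p.idx → z p = min (y q) T)
    (p : Particle k) : rightHalfStep Y (entry ξ) (entry ξ') p.row p.idx = z p := by
  obtain ⟨n, hn⟩ : ∃ n, p.row = n := ⟨_, rfl⟩
  induction n generalizing p with
  | zero => have := p.bounds; omega
  | succ n ih =>
    have hp := p.bounds
    have hYp : Y (n + 1) p.idx = y p := by rw [← hn, hY]
    rw [hn, rightHalfStep, hYp, entry_eq_of ξ p hn rfl, entry_eq_of ξ' p hn rfl]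
    set T := if 2 * p.idx = n + 2 then ((y p : ℤ) + ξ' p - ξ p).natAbs else
      max (rightHalfStep Y (entry ξ) (entry ξ') n p.idx) (y p) + ξ' p with hT
    have h1 := h p T (fun hw => by
      unfold Particle.IsWall at hw
      rw [hT, if_pos (by omega)]) (fun a ha1 ha2 => by
      have ha := a.bounds
      rw [hT, if_neg (by omega), ← ih a (by omega), show a.row = n by omega, ha2])
    show (if p.idx = 1 then T else min (Y n (p.idx - 1)) T) = z p
    by_cases hi : p.idx = 1
    · rw [if_pos hi, h1.1 hi]
    · obtain ⟨q, hq1, hq2⟩ := exists_diagAbove hi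
      rw [if_neg hi, h1.2 q hq1 hq2, ← hY q, show q.row = n by omega,
        show q.idx = p.idx - 1 by omega]

/-- The pushing and blocking rules do not change an interlacing configuration. -/
lemma leftHalfStep_of_noJump {x ξ : Config k} (hx : IsInterlacing x)
    (hξ : ∀ p : Particle k, ¬ p.IsWall → ξ p = 0) (p : Particle k) :
    leftHalfStep (entry x) (entry ξ) p.row p.idx = x p := by
  refine leftHalfStep_eq (fun p T h1 h2 => ?_) p
  have hT : T = x p := by
    by_cases hi : p.idx = 1
    · exact h1 hi
    · obtain ⟨q, hq1, hq2⟩ := exists_diagAbove hi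
      rw [h2 q hq1 hq2, min_eq_left (hx.diag q p hq1.symm hq2.symm)]
  refine ⟨fun _ => hT.symm, fun a ha1 ha2 => ?_⟩
  have hw : ¬ p.IsWall := by
    have := a.bounds
    unfold Particle.IsWall
    omega
  have h3 := hx.col a p ha1.symm ha2.symm
  rw [hT, hξ p hw]
  omega

open Classical in
/-- If the only free jump is that of `p`, by one to the left, then the left half-step is a jump of
`p` to the left. -/
lemma leftHalfStep_single {x : Config k} (hx : IsInterlacing x) {p : Particle k}
    (hp : ¬ p.IsWall) (r : Particle k) :
    leftHalfStep (entry x) (entry (Pi.single p 1 : Config k)) r.row r.idx = moveLeft x p r := by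
  obtain ⟨b, hb1, hb2⟩ := exists_above hp
  have hbp := hx.col b p hb1.symm hb2.symm
  refine leftHalfStep_eq (fun r T h1 h2 => ?_) r
  by_cases hblock : x p = x b
  · rw [moveLeft_of_blocked hp hb1 hb2 hblock] at h2 ⊢
    have hT : T = x r := by
      by_cases hi : r.idx = 1
      · exact h1 hi
      · obtain ⟨q, hq1, hq2⟩ := exists_diagAbove hi
        rw [h2 q hq1 hq2, min_eq_left (hx.diag q r hq1.symm hq2.symm)]
    refine ⟨fun _ => hT.symm, fun a ha1 ha2 => ?_⟩
    have h3 := hx.col a r ha1.symm ha2.symm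
    by_cases hrp : r = p
    · subst hrp
      have : a = b := Particle.ext' (by omega) (by omega)
      subst this
      omega
    · rw [Pi.single_eq_of_ne hrp]
      omega
  · have hm := moveLeft_apply hp hb1 hb2 hblock
    have hT : T = if p.row < r.row ∧ r.idx + p.row = p.idx + r.row ∧ x r = x p then x r - 1
        else x r := by
      by_cases hi : r.idx = 1
      · rw [h1 hi, if_neg]
        have := p.bounds
        omega
      · obtain ⟨q, hq1, hq2⟩ := exists_diagAbove hi
        rw [h2 q hq1 hq2, hm]
        have h3 := hx.diag q r hq1.symm hq2.symm
        by_cases hc : p.row < r.row ∧ r.idx + p.row = p.idx + r.row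
        · have h4 := hx.diag_le (p := p) (p' := q) (by omega) (by omega)
          split_ifs <;> omega
        · split_ifs <;> omega
    rw [hm]
    refine ⟨fun hw => ?_, fun a ha1 ha2 => ?_⟩
    · have hrp : ¬ (r.row = p.row ∧ r.idx = p.idx) := fun h =>
        hp (Particle.ext' (p := r) (q := p) h.1 h.2 ▸ hw)
      rw [hT]
      split_ifs <;> omega
    · have h3 := hx.col a r ha1.symm ha2.symm
      by_cases hrp : r = p
      · subst hrp
        have : a = b := Particle.ext' (by omega) (by omega)
        subst this
        rw [Pi.single_eq_same, hT, if_pos ⟨le_rfl, by omega, rfl⟩, if_neg (by omega)]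
        omega
      · rw [Pi.single_eq_of_ne hrp, hT, Nat.sub_zero]
        have hrp' : ¬ (r.row = p.row ∧ r.idx = p.idx) := fun h =>
          hrp (Particle.ext' h.1 h.2)
        by_cases hc : p.row < r.row ∧ r.idx + p.row = p.idx + r.row
        · have h4 := hx.diag_le (p := b) (p' := a) (by omega) (by omega)
          split_ifs <;> omega
        · rw [if_neg (by omega), if_neg (by omega)]
          omega

/-- If the free jumps leave every particle of an interlacing configuration in place, then so does
the right half-step. -/
lemma rightHalfStep_of_noJump {y ξ ξ' : Config k} {Y : ℕ → ℕ → ℕ} (hy : IsInterlacing y)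
    (hY : ∀ p : Particle k, Y p.row p.idx = y p)
    (hw : ∀ p : Particle k, p.IsWall → ((y p : ℤ) + ξ' p - ξ p).natAbs = y p)
    (hξ : ∀ p : Particle k, ¬ p.IsWall → ξ' p = 0) (p : Particle k) :
    rightHalfStep Y (entry ξ) (entry ξ') p.row p.idx = y p := by
  refine rightHalfStep_eq hY (fun p T h1 h2 => ?_) p
  have hT : T = y p := by
    by_cases hp : p.IsWall
    · rw [h1 hp, hw p hp]
    · obtain ⟨a, ha1, ha2⟩ := exists_above hp
      rw [h2 a ha1 ha2, hξ p hp, max_eq_right (hy.col a p ha1.symm ha2.symm), add_zero]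
  refine ⟨fun _ => hT.symm, fun q hq1 hq2 => ?_⟩
  rw [hT, min_eq_right (hy.diag q p hq1.symm hq2.symm)]

/-- If the free jumps move exactly the particle `p`, by one to the right, then the right half-step
is a jump of `p` to the right. -/
lemma rightHalfStep_of_jump {y ξ ξ' : Config k} {Y : ℕ → ℕ → ℕ} (hy : IsInterlacing y)
    (hY : ∀ p : Particle k, Y p.row p.idx = y p) {p : Particle k}
    (hw : ∀ r : Particle k, r.IsWall →
      ((y r : ℤ) + ξ' r - ξ r).natAbs = open Classical in if r = p then y r + 1 else y r)
    (hξ : ∀ r : Particle k, ¬ r.IsWall → ξ' r = open Classical in if r = p then 1 else 0)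
    (r : Particle k) :
    rightHalfStep Y (entry ξ) (entry ξ') r.row r.idx = moveRight y p r := by
  classical
  refine rightHalfStep_eq hY (fun r T h1 h2 => ?_) r
  by_cases hb : BlockedRight y p
  · rw [moveRight_of_blocked hb] at h2 ⊢
    have hT : T = if r = p then y r + 1 else y r := by
      by_cases hr : r.IsWall
      · rw [h1 hr, hw r hr]
      · obtain ⟨a, ha1, ha2⟩ := exists_above hr
        rw [h2 a ha1 ha2, hξ r hr, max_eq_right (hy.col a r ha1.symm ha2.symm)]
        split_ifs <;> rfl
    obtain ⟨b, hb1, hb2, hb3⟩ := (blockedRight_iff _ _).1 hb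
    refine ⟨fun hi => ?_, fun q hq1 hq2 => ?_⟩
    · rw [hT, if_neg]
      rintro rfl
      have := b.bounds
      omega
    · have h3 := hy.diag q r hq1.symm hq2.symm
      rw [hT]
      split_ifs with hrp
      · subst hrp
        have : b = q := Particle.ext' (by omega) (by omega)
        subst this
        omega
      · omega
  · have hm := moveRight_apply hb
    have hT : T = if p.row ≤ r.row ∧ r.idx = p.idx ∧ y r = y p then y r + 1 else y r := by
      by_cases hr : r.IsWall
      · rw [h1 hr, hw r hr]
        unfold Particle.IsWall at hr
        have hp := p.bounds
        refine if_congr ⟨?_, fun h => ?_⟩ rfl rfl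
        · rintro rfl
          exact ⟨le_rfl, rfl, rfl⟩
        · have := r.bounds
          exact Particle.ext' (by omega) h.2.1
      · obtain ⟨a, ha1, ha2⟩ := exists_above hr
        have h3 := hy.col a r ha1.symm ha2.symm
        rw [h2 a ha1 ha2, hξ r hr, hm]
        by_cases hrp : r = p
        · subst hrp
          rw [if_neg (by omega), if_pos rfl, if_pos ⟨le_rfl, rfl, rfl⟩]
          omega
        · have hrp' : ¬ (r.row = p.row ∧ r.idx = p.idx) := fun h =>
            hrp (Particle.ext' h.1 h.2)
          rw [if_neg hrp]
          by_cases hc : p.row < r.row ∧ r.idx = p.idx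
          · have h4 := hy.col_le (p := p) (p' := a) (by omega) (by omega)
            split_ifs <;> omega
          · rw [if_neg (by omega), if_neg (by omega)]
            omega
    rw [hm, hT]
    refine ⟨fun _ => rfl, fun q hq1 hq2 => ?_⟩
    have h3 := hy.diag q r hq1.symm hq2.symm
    split_ifs with hc
    · have hne : y r ≠ y q := by
        intro he
        have hpb := p.bounds
        have hqb := q.bounds
        obtain ⟨b, hb1, hb2⟩ := exists_diagAbove (p := p) (by omega)
        have h4 := hy.col_le (p := b) (p' := q) (by omega) (by omega)
        have h5 := hy.diag b p hb1.symm hb2.symm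
        exact hb ((blockedRight_iff _ _).2 ⟨b, hb1, hb2, by omega⟩)
      omega
    · omega

lemma discreteStep_zero {x : Config k} (hx : IsInterlacing x) : discreteStep x 0 0 = x := by
  funext p
  exact rightHalfStep_of_noJump hx (leftHalfStep_of_noJump hx fun _ _ => rfl)
    (fun _ _ => by simp) (fun _ _ => rfl) p

open Classical in
lemma discreteStep_right {x : Config k} (hx : IsInterlacing x) (p : Particle k) :
    discreteStep x 0 (Pi.single p 1) = moveRight x p := by
  funext r
  refine rightHalfStep_of_jump hx (leftHalfStep_of_noJump hx fun _ _ => rfl) (fun r _ => ?_)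
    (fun r _ => ?_) r
  · rw [Pi.single_apply, Pi.zero_apply]
    split_ifs <;> omega
  · rw [Pi.single_apply]

open Classical in
lemma discreteStep_left {x : Config k} (hx : IsInterlacing x) (p : Particle k) :
    discreteStep x (Pi.single p 1) 0 = moveLeft x p := by
  funext r
  by_cases hp : p.IsWall
  · have hL : ∀ r : Particle k,
        leftHalfStep (entry x) (entry (Pi.single p 1 : Config k)) r.row r.idx = x r :=
      leftHalfStep_of_noJump hx fun r hr => by
        rw [Pi.single_eq_of_ne]
        rintro rfl
        exact hr hp
    by_cases h0 : x p = 0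
    · rw [moveLeft_of_reflects ⟨hp, h0⟩]
      refine rightHalfStep_of_jump hx hL (fun r _ => ?_) (fun r hr => ?_) r
      · rw [Pi.single_apply, Pi.zero_apply]
        split_ifs with hr
        · subst hr
          omega
        · omega
      · rw [if_neg, Pi.zero_apply]
        rintro rfl
        exact hr hp
    · rw [moveLeft_of_wall hp h0]
      refine rightHalfStep_eq hL (fun r T h1 h2 => ?_) r
      have hT : T = Function.update x p (x p - 1) r := by
        by_cases hr : r.IsWall
        · rw [h1 hr]
          by_cases hrp : r = p
          · subst hrp
            rw [Function.update_self, Pi.single_eq_same, Pi.zero_apply]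
            omega
          · rw [Function.update_of_ne hrp, Pi.single_eq_of_ne hrp, Pi.zero_apply]
            omega
        · obtain ⟨a, ha1, ha2⟩ := exists_above hr
          have h3 := hx.col a r ha1.symm ha2.symm
          have hrp : r ≠ p := fun h => hr (h ▸ hp)
          rw [h2 a ha1 ha2, Pi.zero_apply, Function.update_of_ne hrp]
          by_cases hap : a = p
          · subst hap
            rw [Function.update_self]
            omega
          · rw [Function.update_of_ne hap]
            omega
      refine ⟨fun _ => hT.symm, fun q hq1 hq2 => ?_⟩
      have h3 := hx.diag q r hq1.symm hq2.symm
      rw [hT]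
      by_cases hrp : r = p
      · subst hrp
        rw [Function.update_self]
        omega
      · rw [Function.update_of_ne hrp]
        omega
  · exact rightHalfStep_of_noJump (hx.moveLeft p) (leftHalfStep_single hx hp)
      (fun r hr => by
        have hrp : r ≠ p := fun h => hp (h ▸ hr)
        rw [Pi.single_eq_of_ne hrp]
        simp) (fun _ _ => rfl) r

/-- In a simple step, the model with geometric jumps makes the attempted jump of the only clock
that rings. -/
lemma discreteStep_eq_stepMap {x : Config k} (hx : IsInterlacing x)
    {r : Particle k × Direction → ℕ} (hr : IsSimpleStep r) :
    discreteStep x (fun p => r (p, Direction.left)) (fun p => r (p, Direction.right)) =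
      stepMap x r := by
  classical
  rcases hr with rfl | ⟨⟨p, d⟩, rfl⟩
  · rw [stepMap_zero]
    exact discreteStep_zero hx
  · rw [stepMap_single]
    cases d
    · have h1 : (fun q : Particle k => (Pi.single (p, Direction.left) 1 :
          Particle k × Direction → ℕ) (q, Direction.left)) = Pi.single p 1 := by
        funext q
        simp [Pi.single_apply]
      have h2 : (fun q : Particle k => (Pi.single (p, Direction.left) 1 :
          Particle k × Direction → ℕ) (q, Direction.right)) = 0 := by
        funext q
        simp
      rw [h1, h2]
      exact discreteStep_left hx p
    · have h1 : (fun q : Particle k => (Pi.single (p, Direction.right) 1 :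
          Particle k × Direction → ℕ) (q, Direction.right)) = Pi.single p 1 := by
        funext q
        simp [Pi.single_apply]
      have h2 : (fun q : Particle k => (Pi.single (p, Direction.right) 1 :
          Particle k × Direction → ℕ) (q, Direction.left)) = 0 := by
        funext q
        simp
      rw [h1, h2]
      exact discreteStep_right hx p

end DiscreteStep

/-! ### The noise of the model with geometric jumps -/

section Geometric

variable {k : ℕ} {Ω : Type*} [MeasurableSpace Ω] {ν : Measure Ω} {q : ℝ}

/-- The half-step in which a clock of the given direction acts, during the step `j`. -/
def halfStep (j : ℕ) : Direction → ℕ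
  | Direction.left => 2 * j
  | Direction.right => 2 * j + 1

/-- The jumps of the model form a noise, which the model follows in all simple steps. -/
lemma exists_isNoise_of_isGeometricModel (hq0 : 0 < q) {X : ℕ → Ω → Config k}
    (hX : IsGeometricModel k q ν X) :
    (∀ n, AEMeasurable (X n) ν) ∧
    ∃ U : Particle k × Direction → ℕ → Ω → ℕ, IsNoise ν q (1 - q) U ∧
      ∀ᵐ ω ∂ν, X 0 ω = 0 ∧ ∀ j, IsInterlacing (X j ω) →
        IsSimpleStep (rings U ω j) → X (j + 1) ω = stepMap (X j ω) (rings U ω j) := by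
  obtain ⟨ξ, hm, hind, hlaw, hrec⟩ := hX
  refine ⟨fun n => ?_, fun c j => ξ c.1 (halfStep j c.2), ⟨fun c j => hm _ _, ?_, ?_, ?_, hq0,
    le_rfl⟩, ?_⟩
  · induction n with
    | zero =>
      refine (aemeasurable_const (b := (0 : Config k))).congr ?_
      filter_upwards [hrec] with ω hω
      exact hω.1.symm
    | succ n ih =>
      have h1 : Measurable fun p : Config k × Config k × Config k =>
        discreteStep p.1 p.2.1 p.2.2 := measurable_of_countable _
      have h2 : Measurable fun ω p => ξ p (2 * n) ω := measurable_pi_lambda _ fun p => hm _ _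
      have h3 : Measurable fun ω p => ξ p (2 * n + 1) ω := measurable_pi_lambda _ fun p => hm _ _
      refine (h1.comp_aemeasurable (ih.prodMk (h2.prodMk h3).aemeasurable)).congr ?_
      filter_upwards [hrec] with ω hω
      exact (hω.2 n).symm
  · refine hind.precomp (g := fun a : (Particle k × Direction) × ℕ =>
      (a.1.1, halfStep a.2 a.1.2)) ?_
    rintro ⟨⟨p, d⟩, i⟩ ⟨⟨p', d'⟩, i'⟩ h
    simp only [Prod.mk.injEq] at h ⊢
    obtain ⟨h1, h2⟩ := h
    cases d <;> cases d' <;> simp only [halfStep] at h2 <;>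
      first | omega | exact ⟨⟨h1, rfl⟩, by omega⟩
  · intro c j
    simpa using hlaw c.1 (halfStep j c.2) 0
  · intro c j
    simpa using hlaw c.1 (halfStep j c.2) 1
  · filter_upwards [hrec] with ω hω
    refine ⟨hω.1, fun j hj hs => ?_⟩
    rw [hω.2 j, ← discreteStep_eq_stepMap hj hs]
    rfl

end Geometric

/-! ### The noise of the model with exponential waiting times -/

section Poisson

variable {k : ℕ} {Ω : Type*}

/-- The numbers of rings of all clocks during `(s, t]`. -/
def increment (N : Particle k × Direction → ℝ≥0 → Ω → ℕ) (s t : ℝ≥0) (ω : Ω) :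
    Particle k × Direction → ℕ := fun c => N c t ω - N c s ω

/-- The sample path `Y · ω` starts from `0` and follows the clocks `N · · ω`. -/
structure FollowsClocks (N : Particle k × Direction → ℝ≥0 → Ω → ℕ) (Y : ℝ≥0 → Ω → Config k)
    (ω : Ω) : Prop where
  mono : ∀ c, Monotone fun t => N c t ω
  zero : Y 0 ω = 0
  step : ∀ s t, s ≤ t → IsSimpleStep (increment N s t ω) →
    Y t ω = stepMap (Y s ω) (increment N s t ω)

/-- Fewer rings than in a simple step still make a simple step. -/
lemma IsSimpleStep.of_le {r r' : Particle k × Direction → ℕ} (hr : IsSimpleStep r) (h : r' ≤ r) :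
    IsSimpleStep r' := by
  classical
  rcases hr with rfl | ⟨c, rfl⟩
  · exact Or.inl (le_antisymm h (fun _ => Nat.zero_le _))
  · have h1 : ∀ d, d ≠ c → r' d = 0 := fun d hd => by
      have h2 := h d
      rw [Pi.single_eq_of_ne hd] at h2
      exact Nat.le_zero.1 h2
    have h2 := h c
    rw [Pi.single_eq_same] at h2
    rcases Nat.le_one_iff_eq_zero_or_eq_one.1 h2 with h3 | h3
    · refine Or.inl (funext fun d => ?_)
      by_cases hd : d = c
      · rw [hd, h3, Pi.zero_apply]
      · rw [h1 d hd, Pi.zero_apply]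
    · refine Or.inr ⟨c, funext fun d => ?_⟩
      by_cases hd : d = c
      · rw [hd, h3, Pi.single_eq_same]
      · rw [h1 d hd, Pi.single_eq_of_ne hd]

lemma floor_mul_le (t : ℝ≥0) {h : ℝ≥0} (hh : 0 < h) : (⌊t / h⌋₊ : ℝ≥0) * h ≤ t := by
  have := Nat.floor_le (zero_le (a := t / h))
  calc (⌊t / h⌋₊ : ℝ≥0) * h ≤ t / h * h := by gcongr
    _ = t := div_mul_cancel₀ t hh.ne'

lemma le_floor_add_one_mul (t : ℝ≥0) {h : ℝ≥0} (hh : 0 < h) :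
    t ≤ ((⌊t / h⌋₊ : ℝ≥0) + 1) * h := by
  have := (Nat.lt_floor_add_one (t / h)).le
  calc t = t / h * h := (div_mul_cancel₀ t hh.ne').symm
    _ ≤ _ := by gcongr

/-- The numbers of rings during the cells of the grid of mesh `h`. -/
def gridNoise (N : Particle k × Direction → ℝ≥0 → Ω → ℕ) (h : ℝ≥0)
    (c : Particle k × Direction) (j : ℕ) (ω : Ω) : ℕ :=
  N c (((j + 1 : ℕ) : ℝ≥0) * h) ω - N c (j * h) ω

/-- As long as all cells of a grid are simple steps, the sample path consists of interlacing
configurations. -/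
lemma FollowsClocks.isInterlacing {N : Particle k × Direction → ℝ≥0 → Ω → ℕ}
    {Y : ℝ≥0 → Ω → Config k} {ω : Ω} (hY : FollowsClocks N Y ω) {h : ℝ≥0} (hh : 0 < h) {M : ℕ}
    (hs : ∀ j < M, IsSimpleStep (rings (gridNoise N h) ω j)) {t : ℝ≥0} (ht : t < M * h) :
    IsInterlacing (Y t ω) := by
  have h1 : ∀ j ≤ M, IsInterlacing (Y (j * h) ω) := by
    intro j
    induction j with
    | zero =>
      intro _
      rw [Nat.cast_zero, zero_mul, hY.zero]
      exact IsInterlacing.zero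
    | succ j ih =>
      intro hj
      have h2 : (j : ℝ≥0) * h ≤ ((j + 1 : ℕ) : ℝ≥0) * h := by gcongr; omega
      rw [hY.step _ _ h2 (hs j (by omega))]
      exact (ih (by omega)).stepMap _
  have h2 : ⌊t / h⌋₊ < M := by
    rw [Nat.floor_lt zero_le, div_lt_iff₀ hh]
    exact ht
  have h3 : IsSimpleStep (increment N (⌊t / h⌋₊ * h) t ω) := by
    refine (hs _ h2).of_le fun c => Nat.sub_le_sub_right (hY.mono c ?_) _
    rw [Nat.cast_add_one]
    exact le_floor_add_one_mul t hh
  rw [hY.step _ _ (floor_mul_le t hh) h3]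
  exact (h1 _ h2.le).stepMap _

variable [MeasurableSpace Ω] {μ : Measure Ω} [IsProbabilityMeasure μ]
  {N : Particle k × Direction → ℝ≥0 → Ω → ℕ} {Y : ℝ≥0 → Ω → Config k}

omit [IsProbabilityMeasure μ] in
lemma ae_followsClocks (hN : ∀ c, IsPoissonClock (N c) μ)
    (hY : ∀ᵐ ω ∂μ, Y 0 ω = 0 ∧ ∀ s t, s ≤ t →
      ((∀ c, N c t ω = N c s ω) → Y t ω = Y s ω) ∧
      ∀ c, N c t ω = N c s ω + 1 → (∀ c', c' ≠ c → N c' t ω = N c' s ω) →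
        Y t ω = move (Y s ω) c) : ∀ᵐ ω ∂μ, FollowsClocks N Y ω := by
  classical
  have h1 : ∀ᵐ ω ∂μ, ∀ c, Monotone fun t => N c t ω := by
    rw [ae_all_iff]
    exact fun c => (hN c).path.mono fun ω h => h.2.1
  filter_upwards [hY, h1] with ω hω hmono
  refine ⟨hmono, hω.1, fun s t hst hs => ?_⟩
  obtain ⟨h2, h3⟩ := hω.2 s t hst
  have hle : ∀ c, N c s ω ≤ N c t ω := fun c => hmono c hst
  rcases hs with hs | ⟨c, hs⟩
  · rw [hs, stepMap_zero]
    refine h2 fun c => ?_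
    have h4 : N c t ω - N c s ω = 0 := congrFun hs c
    have := hle c
    omega
  · rw [hs, stepMap_single]
    refine h3 c ?_ fun c' hc' => ?_
    · have h4 : N c t ω - N c s ω = (Pi.single c 1 : Particle k × Direction → ℕ) c := congrFun hs c
      rw [Pi.single_eq_same] at h4
      have := hle c
      omega
    · have h4 : N c' t ω - N c' s ω = (Pi.single c 1 : Particle k × Direction → ℕ) c' :=
        congrFun hs c'
      rw [Pi.single_eq_of_ne hc'] at h4
      have := hle c'
      omega

omit [IsProbabilityMeasure μ] in
lemma IsPoissonClock.real_sub_eq {M : ℝ≥0 → Ω → ℕ} (hM : IsPoissonClock M μ) {s t : ℝ≥0}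
    (hst : s ≤ t) (m : ℕ) : μ.real {ω | M t ω - M s ω = m} =
      Real.exp (-(t - s : ℝ≥0)) * (t - s : ℝ≥0) ^ m / m.factorial := by
  have hm : Measurable fun ω => M t ω - M s ω := (hM.measurable t).sub (hM.measurable s)
  rw [← poissonMeasure_real_singleton, ← (hM.law s t hst).map_eq,
    map_measureReal_apply hm (measurableSet_singleton m)]
  rfl

lemma IsPoissonClock.real_ne_le {M : ℝ≥0 → Ω → ℕ} (hM : IsPoissonClock M μ) {s t : ℝ≥0}
    (hst : s ≤ t) : μ.real {ω | M t ω - M s ω ≠ 0} ≤ (t : ℝ) - s := by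
  have hm : Measurable fun ω => M t ω - M s ω := (hM.measurable t).sub (hM.measurable s)
  have h1 : {ω | M t ω - M s ω ≠ 0} = {ω | M t ω - M s ω = 0}ᶜ := rfl
  have h0 : MeasurableSet {ω | M t ω - M s ω = 0} := hm (measurableSet_singleton 0)
  rw [h1, measureReal_compl h0, probReal_univ, hM.real_sub_eq hst,
    pow_zero, Nat.factorial_zero, mul_one, Nat.cast_one, div_one]
  have h2 := Real.add_one_le_exp (-((t - s : ℝ≥0) : ℝ))
  rw [NNReal.coe_sub hst] at h2 ⊢
  linarith

omit [IsProbabilityMeasure μ] in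
lemma isNoise_gridNoise (hN : ∀ c, IsPoissonClock (N c) μ)
    (hind : iIndepFun (fun c ω => (fun t => N c t ω : ℝ≥0 → ℕ)) μ) {h : ℝ≥0} (hh : 0 < h) :
    IsNoise μ h (Real.exp (-h)) (gridNoise N h) := by
  have hle : ∀ j : ℕ, (j : ℝ≥0) * h ≤ ((j + 1 : ℕ) : ℝ≥0) * h := fun j => by gcongr; omega
  have hsub : ∀ j : ℕ, ((j + 1 : ℕ) : ℝ≥0) * h - j * h = h := fun j => by
    rw [Nat.cast_add_one, add_mul, one_mul, add_tsub_cancel_left]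
  have hmeas : ∀ c j, Measurable (gridNoise N h c j) := fun c j =>
    ((hN c).measurable _).sub ((hN c).measurable _)
  refine ⟨hmeas, ?_, fun c j => ?_, fun c j => ?_, hh, ?_⟩
  · refine iIndepFun_uncurry' (X := gridNoise N h) hmeas ?_ fun c => ?_
    · refine hind.comp (fun _ f j => f (((j + 1 : ℕ) : ℝ≥0) * h) - f (j * h)) fun c => ?_
      exact measurable_pi_lambda _ fun j => (measurable_pi_apply _).sub (measurable_pi_apply _)
    · have hmono : Monotone fun j : ℕ => (j : ℝ≥0) * h := fun i j hij => by
        show (i : ℝ≥0) * h ≤ j * h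
        gcongr
      exact (hN c).indep.nat hmono
  · have := (hN c).real_sub_eq (hle j) 0
    rw [hsub] at this
    simpa [gridNoise] using this
  · have := (hN c).real_sub_eq (hle j) 1
    rw [hsub] at this
    rw [mul_comm]
    simpa [gridNoise] using this
  · have := Real.add_one_le_exp (-(h : ℝ))
    linarith

/-- The mesh of the grids. -/
noncomputable def mesh (n : ℕ) : ℝ≥0 := 1 / (n + 1)

lemma mesh_pos (n : ℕ) : 0 < mesh n := by
  unfold mesh
  positivity

lemma tendsto_mesh : Tendsto (fun n => (mesh n : ℝ)) atTop (𝓝 0) := by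
  refine tendsto_one_div_add_atTop_nhds_zero_nat.congr fun n => ?_
  simp [mesh]

/-- Almost surely the configuration is interlacing at all times: for every time horizon there is
almost surely a grid whose cells up to this horizon are all simple steps. -/
lemma ae_forall_isInterlacing (hN : ∀ c, IsPoissonClock (N c) μ)
    (hind : iIndepFun (fun c ω => (fun t => N c t ω : ℝ≥0 → ℕ)) μ)
    (hY : ∀ᵐ ω ∂μ, FollowsClocks N Y ω) : ∀ᵐ ω ∂μ, ∀ t, IsInterlacing (Y t ω) := by
  have h1 : ∀ T : ℕ, ∀ᵐ ω ∂μ, ∃ n, ∀ j < T * (n + 1),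
      IsSimpleStep (rings (gridNoise N (mesh n)) ω j) := by
    intro T
    have h2 : Tendsto (fun n : ℕ => ((T * (n + 1) : ℕ) : ℝ) * (clockCount k * mesh n) ^ 2) atTop
        (𝓝 0) := by
      have h3 := tendsto_mesh.const_mul ((T : ℝ) * (clockCount k : ℝ) ^ 2)
      rw [mul_zero] at h3
      refine h3.congr fun n => ?_
      have : (n : ℝ) + 1 ≠ 0 := by positivity
      simp only [mesh]
      push_cast
      field_simp
    have h3 : μ.real {ω | ¬ ∃ n, ∀ j < T * (n + 1),
        IsSimpleStep (rings (gridNoise N (mesh n)) ω j)} ≤ 0 := by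
      refine ge_of_tendsto' h2 fun n => ?_
      refine (measureReal_mono ?_).trans
        ((isNoise_gridNoise hN hind (mesh_pos n)).real_exists_not_isSimpleStep_le _)
      intro ω hω
      simp only [Set.mem_ofPred_eq, not_exists, not_forall] at hω ⊢
      simpa using hω n
    rw [ae_iff]
    exact (measureReal_eq_zero_iff (measure_ne_top _ _)).1 (le_antisymm h3 measureReal_nonneg)
  have h2 := ae_all_iff.2 h1
  filter_upwards [h2, hY] with ω hω hωY t
  obtain ⟨T, hT⟩ := exists_nat_gt t
  obtain ⟨n, hn⟩ := hω T
  refine hωY.isInterlacing (mesh_pos n) hn ?_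
  have : ((T * (n + 1) : ℕ) : ℝ≥0) * mesh n = T := by
    have : (n : ℝ≥0) + 1 ≠ 0 := by positivity
    simp only [mesh]
    push_cast
    field_simp
  rwa [this]

/-- The finite-dimensional distributions of the row in the model with exponential waiting times. -/
lemma real_rows_eq_rowPathProb (hN : ∀ c, IsPoissonClock (N c) μ)
    (hind : iIndepFun (fun c ω => (fun t => N c t ω : ℝ≥0 → ℕ)) μ)
    (hY : ∀ᵐ ω ∂μ, FollowsClocks N Y ω) {t : ℕ → ℝ≥0} (ht : Monotone t) (ht0 : t 0 = 0)
    {l : ℕ → rowSpace k} (hl : l 0 = zeroRow k) (n : ℕ) :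
    μ.real {ω | ∀ i < n, configRow (Y (t (i + 1)) ω) = l (i + 1)} =
      rowPathProb (fun i => (t i : ℝ)) l n := by
  set m : ℕ → ℕ → ℕ := fun M i => ⌊t i / mesh M⌋₊ with hm
  have h1 : Tendsto (fun M => μ.real (rowEvent (fun j => Y (j * mesh M)) (m M) l n)) atTop
      (𝓝 (rowPathProb (fun i => (t i : ℝ)) l n)) := by
    refine tendsto_real_rowEvent (Ω := fun _ => Ω) (ν := fun _ => μ) (θ := fun M => mesh M)
      (b := fun M => Real.exp (-mesh M)) (U := fun M => gridNoise N (mesh M))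
      (W := fun M j => Y (j * mesh M))
      (fun M => isNoise_gridNoise hN hind (mesh_pos M)) tendsto_mesh (fun M => Real.exp_pos _) ?_
      (fun M => ?_) (fun M => ?_) (fun M => ?_) (fun i => ?_) hl n
    · have := (Real.continuous_exp.tendsto _).comp tendsto_mesh.neg
      simpa [Function.comp_def] using this
    · filter_upwards [hY] with ω hω
      refine ⟨by rw [Nat.cast_zero, zero_mul, hω.zero], fun j _ hs => ?_⟩
      exact hω.step _ _ (by gcongr; omega) hs
    · intro i j hij
      exact Nat.floor_mono (div_le_div_of_nonneg_right (ht hij) zero_le)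
    · simp [hm, ht0]
    · have h2 : Tendsto (fun M => (t i : ℝ) - mesh M) atTop (𝓝 (t i)) := by
        simpa using tendsto_const_nhds.sub tendsto_mesh
      refine tendsto_of_tendsto_of_tendsto_of_le_of_le h2 tendsto_const_nhds (fun M => ?_)
        fun M => ?_
      · have h3 : (t i : ℝ) ≤ ((⌊t i / mesh M⌋₊ : ℝ) + 1) * mesh M := by
          exact_mod_cast le_floor_add_one_mul (t i) (mesh_pos M)
        simp only [hm]
        linarith
      · exact_mod_cast floor_mul_le (t i) (mesh_pos M)
  have h2 : Tendsto (fun M : ℕ => (n : ℝ) * (clockCount k * mesh M)) atTop (𝓝 0) := by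
    simpa using (tendsto_mesh.const_mul (clockCount k : ℝ)).const_mul (n : ℝ)
  refine tendsto_nhds_unique (tendsto_const_nhds) (tendsto_of_tendsto_of_dist h1
    (squeeze_zero (fun _ => dist_nonneg) (fun M => ?_) h2))
  rw [Real.dist_eq]
  -- the row has not changed since the last point of the grid, unless some clock has rung
  refine (abs_measureReal_sub_le (C := ⋃ i ∈ Finset.range n, ⋃ c,
    {ω | N c (t (i + 1)) ω - N c (m M (i + 1) * mesh M) ω ≠ 0}) ?_).trans ?_
  · filter_upwards [hY] with ω hω hC
    simp only [rowEvent, Set.mem_ofPred_eq]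
    refine forall₂_congr fun i hi => ?_
    have h3 : increment N (m M (i + 1) * mesh M) (t (i + 1)) ω = 0 := by
      funext c
      by_contra h4
      exact hC (Set.mem_biUnion (Finset.mem_coe.2 (Finset.mem_range.2 hi))
        (Set.mem_iUnion.2 ⟨c, h4⟩))
    have h4 := hω.step _ _ (floor_mul_le (t (i + 1)) (mesh_pos M)) (Or.inl h3)
    have h3' : increment N (⌊t (i + 1) / mesh M⌋₊ * mesh M) (t (i + 1)) ω = 0 := h3
    rw [h3', stepMap_zero] at h4
    rw [h4]
  · refine (measureReal_biUnion_finset_le _ _).trans ?_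
    refine (Finset.sum_le_sum (g := fun _ => (clockCount k : ℝ) * mesh M) fun i _ => ?_).trans_eq ?_
    · refine (measureReal_iUnion_fintype_le _).trans ?_
      refine (Finset.sum_le_sum (g := fun _ => (mesh M : ℝ)) fun c _ => ?_).trans_eq ?_
      · refine ((hN c).real_ne_le (floor_mul_le (t (i + 1)) (mesh_pos M))).trans ?_
        have h3 : (t (i + 1) : ℝ) ≤ ((⌊t (i + 1) / mesh M⌋₊ : ℝ) + 1) * mesh M := by
          exact_mod_cast le_floor_add_one_mul (t (i + 1)) (mesh_pos M)
        push_cast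
        linarith
      · rw [Finset.sum_const, Finset.card_univ, nsmul_eq_mul, clockCount]
    · rw [Finset.sum_const, Finset.card_range, nsmul_eq_mul]

end Poisson

/-! ### Convergence in distribution on a countable discrete space -/

/-- On a countable discrete space, convergence of the point masses implies convergence in
distribution: by Fatou's lemma no mass is lost on any set. -/
lemma tendstoInDistribution_of_tendsto_real {E : Type*} [Countable E] [TopologicalSpace E]
    [MeasurableSpace E] [MeasurableSingletonClass E] [OpensMeasurableSpace E]
    {Ω : ℕ → Type*} {mΩ : ∀ n, MeasurableSpace (Ω n)} {ν : ∀ n, Measure (Ω n)}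
    [∀ n, IsProbabilityMeasure (ν n)] {Ω₀ : Type*} {mΩ₀ : MeasurableSpace Ω₀} {μ : Measure Ω₀}
    [IsProbabilityMeasure μ] {X : ∀ n, Ω n → E} {Z : Ω₀ → E} (hX : ∀ n, AEMeasurable (X n) (ν n))
    (hZ : AEMeasurable Z μ)
    (h : ∀ x, μ.real {ω | Z ω = x} ≠ 0 →
      Tendsto (fun n => (ν n).real {ω | X n ω = x}) atTop (𝓝 (μ.real {ω | Z ω = x}))) :
    TendstoInDistribution X atTop Z ν μ := by
  refine ⟨hX, hZ, tendsto_of_forall_isOpen_le_liminf' fun G _ => ?_⟩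
  simp only [ProbabilityMeasure.coe_mk]
  have hG : MeasurableSet G := G.to_countable.measurableSet
  have key : ∀ m : Measure E, m G = ∫⁻ x, G.indicator (fun x => m {x}) x ∂Measure.count :=
    fun m => by rw [lintegral_count, Measure.tsum_indicator_apply_singleton m G hG]
  have hmeas : ∀ f : E → ENNReal, Measurable f := fun f => measurable_of_countable f
  simp_rw [key]
  refine le_trans (lintegral_mono fun x => ?_) (lintegral_liminf_le fun n => hmeas _)
  by_cases hx : x ∈ G
  · simp only [Set.indicator_of_mem hx]
    rw [Measure.map_apply_of_aemeasurable hZ (measurableSet_singleton x)]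
    have h1 : ∀ n, Measure.map (X n) (ν n) {x} = ν n {ω | X n ω = x} := fun n =>
      Measure.map_apply_of_aemeasurable (hX n) (measurableSet_singleton x)
    simp_rw [h1]
    change μ {ω | Z ω = x} ≤ _
    by_cases h0 : μ.real {ω | Z ω = x} = 0
    · rw [(measureReal_eq_zero_iff (measure_ne_top _ _)).1 h0]
      exact zero_le
    · refine (Tendsto.liminf_eq ?_).ge
      exact (ENNReal.tendsto_toReal_iff (fun n => measure_ne_top _ _) (measure_ne_top _ _)).1
        (h x h0)
  · simp only [Set.indicator_of_notMem hx]
    exact zero_le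

section Assembly

variable {k : ℕ}

/-! ### Times and rows as infinite sequences -/

/-- Increasing times, continued to a sequence that starts from `0`. -/
noncomputable def extendTime {n : ℕ} (s : Fin n → ℝ≥0) (j : ℕ) : ℝ≥0 :=
  Finset.univ.sup fun i : Fin n => if (i : ℕ) + 1 ≤ j then s i else 0

lemma extendTime_mono {n : ℕ} (s : Fin n → ℝ≥0) : Monotone (extendTime s) := fun i j hij => by
  refine Finset.sup_mono_fun fun a _ => ?_
  split_ifs
  · exact le_rfl
  · omega
  · exact zero_le
  · exact le_rfl

lemma extendTime_zero {n : ℕ} (s : Fin n → ℝ≥0) : extendTime s 0 = 0 := by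
  simp [extendTime]

lemma extendTime_succ {n : ℕ} {s : Fin n → ℝ≥0} (hs : Monotone s) (i : Fin n) :
    extendTime s (i + 1) = s i := by
  refine le_antisymm (Finset.sup_le fun j _ => ?_) ?_
  · split_ifs with h
    · exact hs (Fin.le_def.2 (by omega))
    · exact zero_le
  · refine le_trans ?_ (Finset.le_sup (Finset.mem_univ i))
    rw [if_pos le_rfl]

/-- Rows, continued to a sequence that starts from the row `0`. -/
def extendRow {n : ℕ} (x : Fin n → rowSpace k) : ℕ → rowSpace k
  | 0 => zeroRow k
  | i + 1 => if h : i < n then x ⟨i, h⟩ else zeroRow k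

lemma extendRow_succ {n : ℕ} (x : Fin n → rowSpace k) (i : Fin n) :
    extendRow x (i + 1) = x i := dif_pos i.2

/-! ### The two models -/

lemma measurable_configRow : Measurable fun x : Config k => configRow x := measurable_of_countable _

variable {Ω : Type*} [MeasurableSpace Ω] {μ : Measure Ω} [IsProbabilityMeasure μ]
  {Y : ℝ≥0 → Ω → Config k}

lemma IsExponentialModel.real_rows_eq (hY : IsExponentialModel k μ Y) {n : ℕ} {s : Fin n → ℝ≥0}
    (hs : Monotone s) (x : Fin n → rowSpace k) :
    μ.real {ω | ∀ i, configRow (Y (s i) ω) = x i} =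
      rowPathProb (fun i => (extendTime s i : ℝ)) (extendRow x) n := by
  obtain ⟨N, hN, hind, hYN⟩ := hY.driven
  rw [← real_rows_eq_rowPathProb hN hind (ae_followsClocks hN hYN) (extendTime_mono s)
    (extendTime_zero s) (l := extendRow x) rfl n]
  congr 1
  ext ω
  simp only [Set.mem_ofPred_eq]
  refine Fin.forall_iff.trans (forall₂_congr fun i hi => ?_)
  rw [extendTime_succ hs ⟨i, hi⟩, extendRow_succ x ⟨i, hi⟩]

lemma IsExponentialModel.isMarkovProcessWithGenerator (hY : IsExponentialModel k μ Y) :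
    IsMarkovProcessWithGenerator μ (fun t ω => configRow (Y t ω)) (rowSpace k)
      (rowGenerator k) := by
  refine ⟨?_, rowTransition k, rowTransition_isTransitionFunction k,
    rowTransition_hasGenerator k, fun n s t hs hst x y => ?_⟩
  · obtain ⟨N, hN, hind, hYN⟩ := hY.driven
    filter_upwards [ae_forall_isInterlacing hN hind (ae_followsClocks hN hYN)] with ω hω t
    exact configRow_mem_rowSpace (hω t)
  · have hs' : Monotone (Fin.snoc s t : Fin (n + 2) → ℝ≥0) := by
      refine Fin.monotone_iff_le_succ.2 fun i => ?_
      induction i using Fin.lastCases with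
      | last => rw [Fin.snoc_castSucc, Fin.succ_last, Fin.snoc_last]; exact hst
      | cast i =>
        rw [Fin.snoc_castSucc, Fin.succ_castSucc, Fin.snoc_castSucc]
        exact hs (Fin.castSucc_le_succ i)
    have h1 := hY.real_rows_eq hs' (Fin.snoc x y : Fin (n + 2) → rowSpace k)
    rw [rowPathProb, Finset.prod_range_succ] at h1
    have hlast := extendTime_succ hs' (Fin.last (n + 1))
    have hprev := extendTime_succ hs' (Fin.last n).castSucc
    have hlast' := extendRow_succ (Fin.snoc x y : Fin (n + 2) → rowSpace k) (Fin.last (n + 1))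
    have hprev' := extendRow_succ (Fin.snoc x y : Fin (n + 2) → rowSpace k) (Fin.last n).castSucc
    rw [Fin.snoc_last, Fin.val_last] at hlast hlast'
    rw [Fin.snoc_castSucc, Fin.val_castSucc, Fin.val_last] at hprev hprev'
    rw [hlast, hprev, hlast', hprev', ← NNReal.coe_sub hst] at h1
    have h2 : ∏ i ∈ Finset.range (n + 1),
        rowSemigroup k (extendTime (Fin.snoc s t : Fin (n + 2) → ℝ≥0) (i + 1) -
          extendTime (Fin.snoc s t : Fin (n + 2) → ℝ≥0) i)
          (unitMass (extendRow (Fin.snoc x y : Fin (n + 2) → rowSpace k) i))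
          (extendRow (Fin.snoc x y : Fin (n + 2) → rowSpace k) (i + 1)) =
        μ.real {ω | ∀ i, configRow (Y (s i) ω) = x i} := by
      rw [hY.real_rows_eq hs x, rowPathProb]
      have h3 : ∀ j ≤ n + 1, extendTime (Fin.snoc s t : Fin (n + 2) → ℝ≥0) j = extendTime s j ∧
          extendRow (Fin.snoc x y : Fin (n + 2) → rowSpace k) j = extendRow x j := by
        intro j hj
        cases j with
        | zero => exact ⟨by rw [extendTime_zero, extendTime_zero], rfl⟩
        | succ j =>
          have h4 := extendTime_succ hs' (Fin.castSucc ⟨j, hj⟩)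
          have h5 := extendTime_succ hs ⟨j, hj⟩
          have h6 := extendRow_succ (Fin.snoc x y : Fin (n + 2) → rowSpace k)
            (Fin.castSucc ⟨j, hj⟩)
          have h7 := extendRow_succ x ⟨j, hj⟩
          rw [Fin.snoc_castSucc] at h4 h6
          exact ⟨h4.trans h5.symm, h6.trans h7.symm⟩
      refine Finset.prod_congr rfl fun i hi => ?_
      have hi' := Finset.mem_range.1 hi
      rw [(h3 i (by omega)).1, (h3 i (by omega)).2, (h3 (i + 1) (by omega)).1,
        (h3 (i + 1) (by omega)).2]
    rw [h2] at h1
    rw [rowTransition, ← h1]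
    congr 1
    ext ω
    simp only [Set.mem_ofPred_eq, Fin.forall_fin_succ', Fin.snoc_castSucc, Fin.snoc_last]

/-- The finite-dimensional distributions of the row of the model with geometric jumps converge as
the parameter tends to `0`. -/
lemma tendsto_real_rows_of_isGeometricModel {q : ℕ → ℝ} (hq : ∀ n, 0 < q n ∧ q n < 1)
    (hq0 : Tendsto q atTop (𝓝 0)) {Ω' : ℕ → Type*} [∀ n, MeasurableSpace (Ω' n)]
    {ν : ∀ n, Measure (Ω' n)} [∀ n, IsProbabilityMeasure (ν n)] {X : ∀ n, ℕ → Ω' n → Config k}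
    (hX : ∀ n, IsGeometricModel k (q n) (ν n) (X n)) {n : ℕ} {s : Fin n → ℝ≥0}
    (hs : Monotone s) (x : Fin n → rowSpace k) :
    Tendsto (fun M => (ν M).real {ω | ∀ i, configRow (X M ⌊(s i : ℝ) / q M⌋₊ ω) = x i}) atTop
      (𝓝 (rowPathProb (fun i => (extendTime s i : ℝ)) (extendRow x) n)) := by
  choose U hU hW using fun M => (exists_isNoise_of_isGeometricModel (hq M).1 (hX M)).2
  have h1 := tendsto_real_rowEvent hU hq0 (fun M => sub_pos.2 (hq M).2)
    (by simpa using tendsto_const_nhds.sub hq0) hW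
    (m := fun M i => ⌊(extendTime s i : ℝ) / q M⌋₊) (fun M i j hij => Nat.floor_mono
      (div_le_div_of_nonneg_right (NNReal.coe_le_coe.2 (extendTime_mono s hij)) (hq M).1.le))
    (fun M => by simp [extendTime_zero]) (t := fun i => (extendTime s i : ℝ)) (fun i => ?_)
    (l := extendRow x) rfl n
  · refine h1.congr fun M => ?_
    congr 1
    ext ω
    simp only [rowEvent, Set.mem_ofPred_eq]
    refine Iff.symm (Fin.forall_iff.trans (forall₂_congr fun i hi => ?_))
    rw [extendTime_succ hs ⟨i, hi⟩, extendRow_succ x ⟨i, hi⟩]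
  · have h2 : Tendsto (fun M => (extendTime s i : ℝ) - q M) atTop (𝓝 (extendTime s i)) := by
      simpa using tendsto_const_nhds.sub hq0
    refine tendsto_of_tendsto_of_tendsto_of_le_of_le h2 tendsto_const_nhds (fun M => ?_)
      fun M => ?_
    · have h3 := (Nat.lt_floor_add_one ((extendTime s i : ℝ) / q M)).le
      rw [div_le_iff₀ (hq M).1] at h3
      simp only
      linarith
    · have h3 := Nat.floor_le (div_nonneg (extendTime s i).2 (hq M).1.le)
      rwa [le_div_iff₀ (hq M).1] at h3

lemma tendstoInDistribution_rows (hY : IsExponentialModel k μ Y) {q : ℕ → ℝ}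
    (hq : ∀ n, 0 < q n ∧ q n < 1) (hq0 : Tendsto q atTop (𝓝 0)) {Ω' : ℕ → Type*}
    [∀ n, MeasurableSpace (Ω' n)] {ν : ∀ n, Measure (Ω' n)} [∀ n, IsProbabilityMeasure (ν n)]
    {X : ∀ n, ℕ → Ω' n → Config k} (hX : ∀ n, IsGeometricModel k (q n) (ν n) (X n)) {m : ℕ}
    (t : Fin m → ℝ≥0) :
    TendstoInDistribution (fun n ω i => configRow (X n ⌊(t i : ℝ) / q n⌋₊ ω)) atTop
      (fun ω i => configRow (Y (t i) ω)) ν μ := by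
  refine tendstoInDistribution_of_tendsto_real (fun n => ?_) ?_ fun x hx => ?_
  · refine aemeasurable_pi_lambda _ fun i => measurable_configRow.comp_aemeasurable ?_
    exact (exists_isNoise_of_isGeometricModel (hq n).1 (hX n)).1 _
  · exact (measurable_pi_lambda _ fun i => measurable_configRow.comp
      (hY.measurable (t i))).aemeasurable
  · have hmem : ∀ i, x i ∈ rowSpace k := by
      by_contra! hcon
      obtain ⟨i, hi⟩ := hcon
      refine hx ((measureReal_eq_zero_iff (measure_ne_top _ _)).2 ?_)
      refine measure_mono_null ?_ (ae_iff.1 hY.isMarkovProcessWithGenerator.mem)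
      rintro ω rfl h
      exact hi (h (t i))
    set σ := Tuple.sort t
    have hσ : Monotone (t ∘ σ) := Tuple.monotone_sort t
    have h1 := tendsto_real_rows_of_isGeometricModel hq hq0 hX hσ fun i => ⟨x (σ i), hmem _⟩
    rw [← hY.real_rows_eq hσ] at h1
    have h2 : ∀ z : Fin m → Fin ((k + 1) / 2) → ℤ, z = x ↔ ∀ i, z (σ i) = x (σ i) := fun z =>
      ⟨fun h i => by rw [h], fun h => funext fun i => by simpa using h (σ.symm i)⟩
    simp only [h2]
    exact h1

end Assembly

theorem mainTheorem5 (k : ℕ) (hk : 1 ≤ k) {Ω : Type*} [MeasurableSpace Ω] (μ : Measure Ω)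
    [IsProbabilityMeasure μ] (Y : ℝ≥0 → Ω → Config k) (hY : IsExponentialModel k μ Y) :
    IsMarkovProcessWithGenerator μ (fun t ω => configRow (Y t ω)) (rowSpace k) (rowGenerator k) ∧
    ∀ (q : ℕ → ℝ), (∀ n, 0 < q n ∧ q n < 1) → Tendsto q atTop (𝓝 0) →
      ∀ (Ω' : ℕ → Type*) [∀ n, MeasurableSpace (Ω' n)] (ν : ∀ n, Measure (Ω' n))
        [∀ n, IsProbabilityMeasure (ν n)] (X : ∀ n, ℕ → Ω' n → Config k),
        (∀ n, IsGeometricModel k (q n) (ν n) (X n)) →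
        ∀ (m : ℕ) (t : Fin m → ℝ≥0),
          TendstoInDistribution
            (fun n ω i => configRow (X n ⌊(t i : ℝ) / q n⌋₊ ω)) atTop
            (fun ω i => configRow (Y (t i) ω)) ν μ :=
  ⟨hY.isMarkovProcessWithGenerator, fun _ hq hq0 _ _ _ _ _ hX _ t =>
    tendstoInDistribution_rows hY hq hq0 hX t⟩
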